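/- Let $K$ be a field of characteristic $p \geq 5$, let $s, t$ be two independent variables over $K$, and let $E_{s,t}$ be the elliptic curve $y^{2} = x^{3} + sx + t$ over the rational function field $K(s,t)$. For a positive integer $n$, let $E_{s,t}[p^{n}]$ be the group of $p^{n}$-torsion points of $E_{s,t}$ over an algebraic closure of $K(s,t)$, and let $K(s,t)(E_{s,t}[p^{n}])$ be the field generated over $K(s,t)$ by the $x$- and $y$-coordinates of all non-zero points of $E_{s,t}[p^{n}]$. Then, for each integer $n \geq 1$, the extension $K(s,t)(E_{s,t}[p^{n}])/K(s,t)$ is normal, with separable degree $p^{n-1}(p-1)$ and inseparable degree $p^{n}$. -/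

import Mathlib

noncomputable section

/-- The rational function field `K(s, t)` in two variables. -/
abbrev RatFunc₂ (K : Type*) [Field K] : Type _ :=
  FractionRing (MvPolynomial (Fin 2) K)

/-- The variable `s` of `K(s, t)`. -/
def RatFunc₂.s (K : Type*) [Field K] : RatFunc₂ K :=
  algebraMap (MvPolynomial (Fin 2) K) (RatFunc₂ K) (MvPolynomial.X 0)

/-- The variable `t` of `K(s, t)`. -/
def RatFunc₂.t (K : Type*) [Field K] : RatFunc₂ K :=
  algebraMap (MvPolynomial (Fin 2) K) (RatFunc₂ K) (MvPolynomial.X 1)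

/-- The generic short Weierstrass curve `E_{s,t} : y² = x³ + s x + t` over `K(s, t)`. -/
def genericCurve (K : Type*) [Field K] : WeierstrassCurve (RatFunc₂ K) where
  a₁ := 0
  a₂ := 0
  a₃ := 0
  a₄ := RatFunc₂.s K
  a₆ := RatFunc₂.t K

open Classical in
/-- The full `N`-torsion subgroup `W[N]` of the group of points of `W` over the algebraic
closure of its field of definition. -/
def WeierstrassCurve.geomTorsion {F : Type*} [Field F] (W : WeierstrassCurve F) (N : ℕ) :
    AddSubgroup (W.baseChange (AlgebraicClosure F)).toAffine.Point :=
  (nsmulAddMonoidHom N).ker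

/-- The field `F(W[N])`, generated over `F` by the `x`- and `y`-coordinates of all affine points
in `W[N]`. -/
def WeierstrassCurve.torsionField {F : Type*} [Field F] (W : WeierstrassCurve F) (N : ℕ) :
    IntermediateField F (AlgebraicClosure F) :=
  IntermediateField.adjoin F
    {z | ∃ (x y : AlgebraicClosure F)
      (h : (W.baseChange (AlgebraicClosure F)).toAffine.Nonsingular x y),
      WeierstrassCurve.Affine.Point.some x y h ∈ W.geomTorsion N ∧ (z = x ∨ z = y)}

end

/-! The degrees are found by working at one place of F = K(s,t) at which the curve has good
supersingular reduction and the Hasse invariant H is a uniformiser; the whole extension turns out to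
be totally ramified there.

Choice of the place. H, the coefficient of x^(p-1) in f^((p-1)/2) with f = x³ + sx + t, has no
multiple zero off the discriminant locus (`hasseCoeff_simple`) and is nonzero on nodal cubics
(`hasseCoeff_nodal`). Hence a prime π divides H exactly once and does not divide the discriminant
(`exists_prime_dvd_genericHasse`). A valuation v of the algebraic closure above π takes on F only
integral powers of v(π) = v(H).

The p-torsion. The invariant derivation D = 2y d/dx satisfies D^p = θD, with θ equal to H up to a
unit of the prime field. An eigenfunction a + by of D with eigenvalue c, c^(p-1) = θ, has norm -(x -
x₁)^p, so one of its zeros (x₁, y₁) is a p-torsion point. Here x₁^p lies in F(c) and y₁ in F(c, x₁),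
so F(E[p]) lies in a separable extension of degree at most p - 1 followed by a purely inseparable
one of degree at most p. On the other side v(x₁/y₁)^(p(p-1)) = v(H), and this ramification forces
the degree to be at least p(p-1). Both bounds are therefore attained.

The tower. The p-torsion is cyclic, because the p-th division polynomial loses its leading
coefficient p. Let (x, y) be a point of p-power order obtained from (x₁, y₁) by successive division
by p, all points lying in the residue disc v(x) > 1 of the origin. The x-coordinates x' of its p-th
parts are the roots of Φ_p - x ΨSq_p, of degree p². Each satisfies v(x')^(p²) = v(x), because ΨSq_p
has value 1 at x'. So each step is totally ramified of degree p² and the polynomial is irreducible.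
It has exactly p distinct roots, one for each p-torsion translate, so the separable degree grows by
p and the inseparable degree by p. The y-coordinate of the new point comes for free from the old
one.

Relating division polynomials to multiples of points (`EllSeqData.rel_aux`,
`char_nsmul_eq_zero_iff`) is done by hand, by an induction on x-coordinates. -/

open Polynomial
open WeierstrassCurve.Affine (Point)

/-! ### The action of 2y d/dx on functions a + by: it sends by to `halfOp` b, and its square sends
by to (`evenOp` b) y. -/

section CubicOps

variable {k : Type*} [CommRing k]

/-- The cubic `x³ + s x + t`. -/
noncomputable def shortCubic (s t : k) : k[X] := X ^ 3 + C s * X + C t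

/-- The operator `b ↦ 2 f b' + f' b`, where `f = x³ + s x + t`. -/
noncomputable def halfOp (s t : k) (b : k[X]) : k[X] :=
  2 * shortCubic s t * derivative b + derivative (shortCubic s t) * b

/-- The operator `b ↦ 2 (2 f b' + f' b)'`. -/
noncomputable def evenOp (s t : k) : k[X] →ₗ[k] k[X] where
  toFun b := 2 * derivative (halfOp s t b)
  map_add' a b := by simp only [halfOp, derivative_add]; simp only [map_add, derivative_mul]; ring
  map_smul' c b := by
    simp only [halfOp, smul_eq_C_mul, derivative_mul, derivative_C, map_add, RingHom.id_apply,
      map_zero]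
    ring

lemma evenOp_apply (s t : k) (b : k[X]) : evenOp s t b = 2 * derivative (halfOp s t b) := rfl

lemma derivative_shortCubic (s t : k) : derivative (shortCubic s t) = 3 * X ^ 2 + C s := by
  simp only [shortCubic, derivative_add, derivative_X_pow, derivative_C_mul, derivative_X,
    derivative_C, Nat.cast_ofNat, map_ofNat]
  ring

lemma shortCubic_map {R : Type*} [CommRing R] (φ : k →+* R) (s t : k) :
    (shortCubic s t).map φ = shortCubic (φ s) (φ t) := by
  simp [shortCubic]

lemma halfOp_map {R : Type*} [CommRing R] (φ : k →+* R) (s t : k) (b : k[X]) :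
    (halfOp s t b).map φ = halfOp (φ s) (φ t) (b.map φ) := by
  simp only [halfOp, Polynomial.map_add, Polynomial.map_mul, derivative_map, ← shortCubic_map]
  simp

lemma monic_shortCubic [Nontrivial k] (s t : k) : (shortCubic s t).Monic := by
  unfold shortCubic; monicity!

lemma natDegree_shortCubic [Nontrivial k] (s t : k) : (shortCubic s t).natDegree = 3 := by
  unfold shortCubic; compute_degree!

lemma eval_shortCubic (s t x : k) : (shortCubic s t).eval x = x ^ 3 + s * x + t := by
  simp [shortCubic]

lemma coeff_shortCubic_mul (s t : k) (b : k[X]) (i : ℕ) :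
    (shortCubic s t * b).coeff (i + 3) = b.coeff i + s * b.coeff (i + 2) + t * b.coeff (i + 3) := by
  simp only [shortCubic, add_mul, coeff_add, mul_assoc, coeff_C_mul]
  rw [coeff_X_pow_mul, coeff_X_mul]

lemma coeff_halfOp (s t : k) (b : k[X]) (i : ℕ) :
    (halfOp s t b).coeff (i + 2) = (2 * i + 3) * b.coeff i + s * (2 * i + 5) * b.coeff (i + 2)
      + 2 * t * (i + 3) * b.coeff (i + 3) := by
  have h : halfOp s t b = C 2 * (derivative b * X ^ 3) + C (2 * s) * (derivative b * X) +
      C (2 * t) * derivative b + C 3 * (b * X ^ 2) + C s * b := by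
    rw [halfOp, derivative_shortCubic]; simp only [shortCubic, C_mul, map_ofNat]; ring
  rw [h]
  simp only [coeff_add, coeff_C_mul, coeff_mul_X_pow, coeff_mul_X, coeff_derivative]
  rcases i with _ | i
  · simp [coeff_mul_X_pow']; ring
  · rw [show i + 1 + 2 = i + 3 by ring, coeff_mul_X_pow, coeff_derivative]
    push_cast; ring

/-- The term in `b.coeff i` raises the degree by one, with factor 2(i+2)(2i+3); the other two lower
it. For p = 2m + 1 the factor is a unit for i < m - 1 and vanishes at i = m - 1, which governs all
later degree arguments. -/
lemma coeff_evenOp (s t : k) (b : k[X]) (i : ℕ) :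
    (evenOp s t b).coeff (i + 1) = 2 * (i + 2) * ((2 * i + 3) * b.coeff i +
      s * (2 * i + 5) * b.coeff (i + 2) + 2 * t * (i + 3) * b.coeff (i + 3)) := by
  rw [evenOp_apply, ← map_ofNat C 2, coeff_C_mul, coeff_derivative, coeff_halfOp]
  push_cast; ring

lemma halfOp_C_mul (s t c : k) (b : k[X]) : halfOp s t (C c * b) = C c * halfOp s t b := by
  simp only [halfOp, derivative_mul, derivative_C]; ring

/-- Degree and leading coefficient of the iterates of `evenOp` at `1`. -/
lemma coeff_iterate_evenOp_one (s t : k) (j : ℕ) :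
    ((evenOp s t)^[j] 1).natDegree ≤ j ∧
      ((evenOp s t)^[j] 1).coeff j = ∏ i ∈ Finset.range j, (2 * (i + 2) * (2 * i + 3) : k) := by
  induction j with
  | zero => simp
  | succ j ih =>
    rw [Function.iterate_succ_apply']
    have h0 : ∀ i, j < i → ((evenOp s t)^[j] 1).coeff i = 0 := fun i hi =>
      coeff_eq_zero_of_natDegree_lt (ih.1.trans_lt hi)
    refine ⟨natDegree_le_iff_coeff_eq_zero.2 fun i hi => ?_, ?_⟩
    · obtain ⟨i, rfl⟩ : ∃ i', i = i' + 1 := ⟨i - 1, by omega⟩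
      rw [coeff_evenOp, h0 _ (by omega), h0 _ (by omega), h0 _ (by omega)]; simp
    · rw [coeff_evenOp, ih.2, h0 _ (by omega), h0 _ (by omega), Finset.prod_range_succ]; ring

end CubicOps

/-! ### Polynomial solutions of f h' = j f' h -/

section Field

variable {k : Type*} [Field k]

lemma isCoprime_shortCubic_derivative {s t : k}
    (hΔ : 4 * s ^ 3 + 27 * t ^ 2 ≠ 0) :
    IsCoprime (shortCubic s t) (derivative (shortCubic s t)) := by
  -- Bézout coefficients expressing the discriminant as a combination of f and f', divided by the
  -- discriminant.
  refine ⟨C (4 * s ^ 3 + 27 * t ^ 2)⁻¹ * (C (27 * t) - C (18 * s) * X),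
    C (4 * s ^ 3 + 27 * t ^ 2)⁻¹ * (C (6 * s) * X ^ 2 - C (9 * t) * X + C (4 * s ^ 2)), ?_⟩
  have h : C (4 * s ^ 3 + 27 * t ^ 2)⁻¹ * C (4 * s ^ 3 + 27 * t ^ 2) = 1 := by
    rw [← C_mul, inv_mul_cancel₀ hΔ, C_1]
  rw [derivative_shortCubic, shortCubic, ← h]
  simp only [C_add, C_mul, C_pow, map_ofNat]
  ring

/-- Since f is prime to f' and j is invertible, the equation forces f to divide h; the quotient h /
f solves the same equation with j - 1. -/
lemma shortCubic_pow_dvd {s t : k} (hc : IsCoprime (shortCubic s t) (derivative (shortCubic s t)))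
    (j : ℕ) (hj : ∀ i : ℕ, 0 < i → i ≤ j → (i : k) ≠ 0) (h : k[X])
    (hh : shortCubic s t * derivative h = C (j : k) * derivative (shortCubic s t) * h) :
    shortCubic s t ^ j ∣ h := by
  induction j generalizing h with
  | zero => simp
  | succ j ih =>
    have hj' : ((j + 1 : ℕ) : k) ≠ 0 := hj _ (by omega) le_rfl
    have hd : shortCubic s t ∣ h := by
      refine hc.dvd_of_dvd_mul_left (⟨C ((j + 1 : ℕ) : k)⁻¹ * derivative h, ?_⟩)
      rw [mul_left_comm, hh, ← mul_assoc, ← mul_assoc, ← C_mul, inv_mul_cancel₀ hj', C_1, one_mul]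
    obtain ⟨g, rfl⟩ := hd
    rw [pow_succ']
    refine mul_dvd_mul_left _ (ih (fun i hi hi' => hj i hi (by omega)) g ?_)
    apply mul_left_cancel₀ (monic_shortCubic s t).ne_zero
    rw [derivative_mul] at hh
    push_cast [C_add, C_1] at hh ⊢
    linear_combination hh

end Field

/-! ### The Hasse invariant: its zeros, and its appearance in `evenOp` -/

section CharP

variable {k : Type*} [Field k] {p m : ℕ} [CharP k p]

lemma natCast_ne_zero_of_lt {i : ℕ} (h0 : 0 < i) (hi : i < p) : (i : k) ≠ 0 := fun h =>
  absurd (Nat.le_of_dvd h0 ((CharP.cast_eq_zero_iff k p i).1 h)) (by omega)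

lemma two_mul_eq_neg_one (hp : p = 2 * m + 1) : 2 * (m : k) = -1 := by
  have : ((2 * m + 1 : ℕ) : k) = 0 := hp ▸ CharP.cast_eq_zero k p
  push_cast at this
  linear_combination this

lemma two_ne_zero_of_five_le (hp5 : 5 ≤ p) : (2 : k) ≠ 0 := by
  exact_mod_cast natCast_ne_zero_of_lt (k := k) (p := p) (i := 2) (by omega) (by omega)

lemma three_ne_zero_of_five_le (hp5 : 5 ≤ p) : (3 : k) ≠ 0 := by
  exact_mod_cast natCast_ne_zero_of_lt (k := k) (p := p) (i := 3) (by omega) (by omega)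

/-- The Hasse invariant of `y² = x³ + s x + t` is the coefficient of `x ^ (p - 1)`
in `(x³ + s x + t) ^ ((p - 1) / 2)`. -/
noncomputable def hasseCoeff {R : Type*} [CommRing R] (m : ℕ) (s t : R) : R :=
  (shortCubic s t ^ m).coeff (2 * m)

lemma hasseCoeff_map {R S : Type*} [CommRing R] [CommRing S] (φ : R →+* S) (m : ℕ) (s t : R) :
    φ (hasseCoeff m s t) = hasseCoeff m (φ s) (φ t) := by
  simp [hasseCoeff, ← shortCubic_map, ← Polynomial.map_pow]

/-- A solution of `2 f b' + f' b = 0` of degree less than `(p - 1) / 2` vanishes. -/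
lemma eq_zero_of_halfOp_eq_zero {s t : k} (hp : p = 2 * m + 1) (hp5 : 5 ≤ p)
    (hΔ : 4 * s ^ 3 + 27 * t ^ 2 ≠ 0) {b : k[X]} (hb : halfOp s t b = 0)
    (hdeg : b.natDegree < 3 * m) : b = 0 := by
  have h2 : (2 : k) ≠ 0 := two_ne_zero_of_five_le hp5
  by_contra hb0
  -- As 2m = -1 in k, the equation 2fb' + f'b = 0 reads fb' = m f'b, so f^m, of degree 3m, divides
  -- b.
  have h := shortCubic_pow_dvd (isCoprime_shortCubic_derivative hΔ) m
    (fun i hi hi' => natCast_ne_zero_of_lt (p := p) hi (by omega)) b (by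
      have e : (C (2 : k)) ≠ 0 := by simpa using h2
      apply mul_left_cancel₀ e
      have := two_mul_eq_neg_one (k := k) hp
      have h3 : C (2 : k) * C (m : k) = -1 := by rw [← C_mul, this]; simp
      unfold halfOp at hb
      rw [map_ofNat] at h3 ⊢
      linear_combination hb - derivative (shortCubic s t) * b * h3)
  have := natDegree_le_of_dvd h hb0
  rw [natDegree_pow, natDegree_shortCubic] at this
  omega

/-- Here f = (x - a)²(x + 2a), and (x - a)^(p-1) = (x^p - a^p)/(x - a) = Σ x^i a^(p-1-i). The
coefficient of x^(p-1) in its product with (x + 2a)^m is then the value of (x + 2a)^m at a. -/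
lemma hasseCoeff_nodal (hp : p = 2 * m + 1) (hprime : p.Prime) (a : k) :
    hasseCoeff m (-3 * a ^ 2) (2 * a ^ 3) = (3 * a) ^ m := by
  have : Fact p.Prime := ⟨hprime⟩
  have hf : shortCubic (-3 * a ^ 2) (2 * a ^ 3) = (X - C a) ^ 2 * (X + C (2 * a)) := by
    simp only [shortCubic, C_mul, C_pow, map_neg, map_ofNat]; ring
  have hgeom : (X - C a) ^ (2 * m) = ∑ i ∈ Finset.range p, X ^ i * C a ^ (p - 1 - i) := by
    apply mul_right_cancel₀ (X_sub_C_ne_zero a)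
    rw [← pow_succ, ← hp, geom_sum₂_mul, sub_pow_char]
  rw [hasseCoeff, hf, mul_pow, ← pow_mul, hgeom, Finset.sum_mul, finsetSum_coeff]
  have hdeg : ((X + C (2 * a)) ^ m).natDegree ≤ m := by
    refine natDegree_pow_le.trans ?_
    rw [natDegree_X_add_C, mul_one]
  have : (3 * a) ^ m = ((X + C (2 * a)) ^ m).eval a := by simp; ring
  rw [this, eval_eq_sum_range' (n := p) (by omega), ← Finset.sum_range_reflect]
  refine Finset.sum_congr rfl fun i hi => ?_
  have hi' := Finset.mem_range.1 hi
  rw [mul_assoc, coeff_X_pow_mul', if_pos (by omega), ← C_pow, coeff_C_mul, mul_comm,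
    show 2 * m - (p - 1 - i) = i by omega, show p - 1 - (p - 1 - i) = i by omega]

/-- The Hasse invariant has no multiple zeros at nonsingular curves. -/
lemma hasseCoeff_simple {s t : k} (hp : p = 2 * m + 1) (hp5 : 5 ≤ p)
    (hΔ : 4 * s ^ 3 + 27 * t ^ 2 ≠ 0) (h0 : hasseCoeff m s t = 0)
    (h1 : (shortCubic s t ^ (m - 1)).coeff (2 * m) = 0)
    (h2 : (shortCubic s t ^ (m - 1)).coeff (2 * m - 1) = 0) : False := by
  -- Up to the factor m, `h1` and `h2` say that the partial derivatives of H in t and s vanish. The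
  -- aim is a gap in G = f^(m-1): its four coefficients of degrees 2n+1 to 2n+4 = p - 1 all vanish.
  obtain ⟨n, rfl⟩ : ∃ n, m = n + 2 := ⟨m - 2, by omega⟩
  have two0 : (2 : k) ≠ 0 := two_ne_zero_of_five_le hp5
  have three0 : (3 : k) ≠ 0 := three_ne_zero_of_five_le hp5
  rw [show n + 2 - 1 = n + 1 by omega, show 2 * (n + 2) = 2 * n + 4 by ring] at h1
  rw [show n + 2 - 1 = n + 1 by omega, show 2 * (n + 2) - 1 = 2 * n + 3 by omega] at h2
  set f := shortCubic s t with hf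
  set G := f ^ (n + 1) with hG
  have hn : 2 * (n : k) = -5 := by
    have := two_mul_eq_neg_one (k := k) hp
    push_cast at this; linear_combination this
  have h4 : G.coeff (2 * n + 1) = 0 := by
    have : hasseCoeff (n + 2) s t = G.coeff (2 * n + 1) + s * G.coeff (2 * n + 3)
        + t * G.coeff (2 * n + 4) := by
      rw [hasseCoeff, pow_succ', show 2 * (n + 2) = 2 * n + 1 + 3 by ring, coeff_shortCubic_mul]
    rw [h0, h1, h2] at this
    linear_combination -this
  have hode : f * derivative G = C ((n + 1 : ℕ) : k) * derivative f * G := by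
    rw [hG, derivative_pow]
    simp only [Nat.add_sub_cancel]
    ring
  have h3 : G.coeff (2 * n + 2) = 0 := by
    have e : halfOp s t G = C (2 * ((n + 1 : ℕ) : k) + 1) * (derivative f * G) := by
      rw [halfOp]
      simp only [C_add, C_mul, map_ofNat, C_1]
      linear_combination 2 * hode
    have e1 := congrArg (fun q => q.coeff (2 * n + 2 + 2)) e
    have e2 : derivative f * G = C 3 * (G * X ^ 2) + C s * G := by
      rw [hf, derivative_shortCubic, map_ofNat]; ring
    simp only [coeff_halfOp, coeff_C_mul, e2, coeff_add, coeff_mul_X_pow, h1,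
      show 2 * n + 2 + 2 = 2 * n + 4 by ring] at e1
    have h5 : (2 * n + 5 : k) = 0 := by linear_combination hn
    push_cast at e1
    have : (3 : k) * G.coeff (2 * n + 2) = 0 := by
      linear_combination e1 + (-2 * G.coeff (2 * n + 2) - 2 * t * G.coeff (2 * n + 2 + 3)
        + 6 * G.coeff (2*n+2) - 3 * G.coeff (2*n+2)) * h5
    exact (mul_eq_zero.1 this).resolve_left three0
  have hmon : G.Monic := (monic_shortCubic s t).pow _
  have hGd : G.natDegree = 3 * (n + 1) := by
    rw [hG, natDegree_pow, hf, natDegree_shortCubic, mul_comm]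
  have hXm : (X ^ p : k[X]).Monic := monic_X_pow p
  set lo := G %ₘ X ^ p with hlo
  set hi := G /ₘ X ^ p with hhi
  have hsplit : lo + X ^ p * hi = G := modByMonic_add_div _ _
  have hcoeff : ∀ i < p, lo.coeff i = G.coeff i := fun i hi' => by
    rw [← hsplit, coeff_add, coeff_X_pow_mul', if_neg (by omega), add_zero]
  have hlodeg : lo.natDegree ≤ 2 * n := by
    refine natDegree_le_iff_coeff_eq_zero.2 fun i hi' => ?_
    rcases lt_or_ge i p with h | h
    · rw [hcoeff i h]
      have : i = 2 * n + 1 ∨ i = 2 * n + 2 ∨ i = 2 * n + 3 ∨ i = 2 * n + 4 := by omega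
      rcases this with rfl | rfl | rfl | rfl <;> assumption
    · refine coeff_eq_zero_of_degree_lt ((degree_modByMonic_lt G hXm).trans_le ?_)
      rw [degree_X_pow]; exact_mod_cast h
  have hhideg : hi.natDegree ≤ 3 * (n + 1) - p := by
    rw [hhi, natDegree_divByMonic _ hXm, hGd, natDegree_X_pow]
  have hdXp : derivative (X ^ p : k[X]) = 0 := by
    rw [derivative_X_pow, CharP.cast_eq_zero, C_0, zero_mul]
  have hsum : (f * derivative lo - C ((n + 1 : ℕ) : k) * derivative f * lo) +
      X ^ p * (f * derivative hi - C ((n + 1 : ℕ) : k) * derivative f * hi) = 0 := by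
    rw [← hsplit, derivative_add, derivative_mul, hdXp] at hode
    linear_combination hode
  have hlo0 : f * derivative lo - C ((n + 1 : ℕ) : k) * derivative f * lo = 0 := by
    refine eq_zero_of_dvd_of_natDegree_lt (p := X ^ p) ((dvd_add_left (dvd_mul_right _ _)).1
      (hsum ▸ dvd_zero _)) ?_
    rw [natDegree_X_pow]
    have hfd : f.natDegree = 3 := natDegree_shortCubic s t
    have hd1 := natDegree_derivative_le f
    have hd2 := natDegree_derivative_le lo
    have e1 := natDegree_mul_le (p := f) (q := derivative lo)
    have e2 := natDegree_mul_le (p := C ((n + 1 : ℕ) : k) * derivative f) (q := lo)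
    have e3 := natDegree_C_mul_le ((n + 1 : ℕ) : k) (derivative f)
    have e4 := natDegree_sub_le (f * derivative lo) (C ((n + 1 : ℕ) : k) * derivative f * lo)
    omega
  have hhi0 : f * derivative hi - C ((n + 1 : ℕ) : k) * derivative f * hi = 0 := by
    rw [hlo0, zero_add] at hsum
    exact (mul_eq_zero.1 hsum).resolve_left hXm.ne_zero
  have key : ∀ h : k[X], h.natDegree < 3 * (n + 1) →
      f * derivative h - C ((n + 1 : ℕ) : k) * derivative f * h = 0 → h = 0 := fun h hd he => by
    by_contra hh
    have := natDegree_le_of_dvd (shortCubic_pow_dvd (isCoprime_shortCubic_derivative hΔ) (n + 1)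
      (fun i hi hi' => natCast_ne_zero_of_lt (p := p) hi (by omega)) h (sub_eq_zero.1 he)) hh
    rw [natDegree_pow, natDegree_shortCubic] at this
    omega
  have : G = 0 := by
    rw [← hsplit, key lo (by omega) hlo0, key hi (by omega) hhi0, mul_zero, add_zero]
  exact hmon.ne_zero this

/-- The part of `f ^ m` of degree at least `p`, divided by `X ^ p`, is mapped by `evenOp` to a
multiple of the Hasse invariant. -/
lemma exists_monic_evenOp_eq_hasseCoeff (s t : k) (hp : p = 2 * m + 1) (hm : 0 < m) :
    ∃ b : k[X], b.Monic ∧ b.natDegree = m - 1 ∧ evenOp s t b = C (-2 * hasseCoeff m s t) := by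
  set e := shortCubic s t ^ m with he
  have hed : e.natDegree = 3 * m := by
    rw [he, natDegree_pow, natDegree_shortCubic, mul_comm]
  have hXm : (X ^ p : k[X]).Monic := monic_X_pow p
  have hdXp : derivative (X ^ p : k[X]) = 0 := by
    rw [derivative_X_pow, CharP.cast_eq_zero, C_0, zero_mul]
  have hle : (X ^ p : k[X]).natDegree ≤ e.natDegree := by rw [hed, natDegree_X_pow]; omega
  set lo := e %ₘ X ^ p with hlo
  set b := e /ₘ X ^ p with hb
  have hsplit : lo + X ^ p * b = e := modByMonic_add_div _ _
  have hpk : (p : k) = 0 := CharP.cast_eq_zero k p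
  have hcoeff : ∀ i < p, lo.coeff i = e.coeff i := fun i hi' => by
    rw [← hsplit, coeff_add, coeff_X_pow_mul', if_neg (by omega), add_zero]
  have hlo0 : ∀ i, p ≤ i → lo.coeff i = 0 := fun i hi => by
    refine coeff_eq_zero_of_degree_lt ((degree_modByMonic_lt e hXm).trans_le ?_)
    rw [degree_X_pow]; exact_mod_cast hi
  -- 2f(f^m)' + f' f^m = (2m + 1) f' f^m, and 2m + 1 = p.
  have he0 : halfOp s t e = 0 := by
    obtain ⟨n, rfl⟩ : ∃ n, m = n + 1 := ⟨m - 1, by omega⟩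
    have h2 : (C (n : k)) * 2 = -3 := by
      have := two_mul_eq_neg_one (k := k) hp
      rw [← map_ofNat C 2, ← C_mul, show (n : k) * 2 = -3 by push_cast at this; linear_combination this]
      simp only [map_neg, map_ofNat]
    rw [halfOp, he, derivative_pow, Nat.add_sub_cancel]
    push_cast [C_add, C_1]
    linear_combination derivative (shortCubic s t) * shortCubic s t ^ (n + 1) * h2
  have hhalf : halfOp s t lo + X ^ p * halfOp s t b = 0 := by
    rw [← he0, ← hsplit]
    simp only [halfOp, derivative_add, derivative_mul (f := X ^ p), hdXp]
    ring
  have hc : ∀ i, (halfOp s t b).coeff i = -(halfOp s t lo).coeff (i + p) := fun i => by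
    have := congrArg (fun q => q.coeff (i + p)) hhalf
    simp only [coeff_add, coeff_X_pow_mul, coeff_zero] at this
    linear_combination this
  refine ⟨b, ?_, ?_, ?_⟩
  · rw [Monic, hb, leadingCoeff_divByMonic_of_monic hXm, he]
    · exact (monic_shortCubic s t).pow m
    · rw [degree_eq_natDegree hXm.ne_zero, degree_eq_natDegree ((monic_shortCubic s t).pow m).ne_zero]
      exact_mod_cast hle
  · rw [hb, natDegree_divByMonic _ hXm, hed, natDegree_X_pow]; omega
  -- The coefficient of degree i of `evenOp` b sees `lo` only from degree i + p - 1 on, hence only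
  -- through its coefficient of degree p - 1, which is the Hasse invariant, when i = 0.
  · ext i
    rw [evenOp_apply, ← map_ofNat C 2, coeff_C_mul, coeff_derivative, hc,
      show i + 1 + p = (i + p - 1) + 2 by omega, coeff_halfOp, hlo0 (i + p - 1 + 2) (by omega),
      hlo0 (i + p - 1 + 3) (by omega)]
    rcases i with _ | i
    · rw [hcoeff _ (by omega), coeff_C_zero, hasseCoeff, show 0 + p - 1 = 2 * m by omega, ← he]
      have := two_mul_eq_neg_one (k := k) hp
      push_cast
      linear_combination (-4 * e.coeff (2 * m)) * this
    · rw [hlo0 _ (by omega), coeff_C_succ]; ring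

/-- Away from degree `(p - 1) / 2 - 1`, `evenOp` raises degrees by one. -/
lemma natDegree_evenOp_le {s t : k} (hp : p = 2 * m + 1) (hm : 0 < m) {b : k[X]}
    (hb : b.natDegree ≤ m - 1) : (evenOp s t b).natDegree ≤ m - 1 := by
  have h0 : ∀ i, m - 1 < i → b.coeff i = 0 := fun i hi =>
    coeff_eq_zero_of_natDegree_lt (hb.trans_lt hi)
  refine natDegree_le_iff_coeff_eq_zero.2 fun i hi => ?_
  obtain ⟨i, rfl⟩ : ∃ i', i = i' + 1 := ⟨i - 1, by omega⟩
  rw [coeff_evenOp, h0 (i + 2) (by omega), h0 (i + 3) (by omega)]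
  rcases eq_or_ne i (m - 1) with rfl | hne
  · have := two_mul_eq_neg_one (k := k) hp
    rw [Nat.cast_sub (by omega)]
    push_cast
    linear_combination (2 * ((m : k) + 1) * b.coeff (m - 1)) * this
  · rw [h0 i (by omega)]; ring

/-- An eigenvector of `evenOp` of degree at most `(p - 1) / 2 - 1` has exactly that degree. -/
lemma natDegree_eq_of_evenOp_eigenvector {s t c : k} (hp : p = 2 * m + 1) (hp5 : 5 ≤ p)
    {b : k[X]} (hb0 : b ≠ 0) (hb : b.natDegree ≤ m - 1) (he : evenOp s t b = C c * b) :
    b.natDegree = m - 1 := by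
  by_contra hne
  have h := congrArg (fun q => q.coeff (b.natDegree + 1)) he
  simp only [coeff_evenOp, coeff_C_mul, coeff_eq_zero_of_natDegree_lt
    (show b.natDegree < b.natDegree + 1 by omega), coeff_eq_zero_of_natDegree_lt
    (show b.natDegree < b.natDegree + 2 by omega), coeff_eq_zero_of_natDegree_lt
    (show b.natDegree < b.natDegree + 3 by omega), mul_zero, add_zero] at h
  have h1 : ((b.natDegree + 2 : ℕ) : k) ≠ 0 := natCast_ne_zero_of_lt (p := p) (by omega) (by omega)
  have h2 : ((2 * b.natDegree + 3 : ℕ) : k) ≠ 0 :=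
    natCast_ne_zero_of_lt (p := p) (by omega) (by omega)
  have h3 : (2 : k) ≠ 0 := two_ne_zero_of_five_le hp5
  have h4 : b.coeff b.natDegree ≠ 0 := leadingCoeff_ne_zero.2 hb0
  push_cast at h1 h2
  exact (mul_ne_zero (mul_ne_zero h3 h1) (mul_ne_zero h2 h4)) h

end CharP

/-! ### Iterates of a derivation in characteristic p -/

section IterateDerivation

/-- The Leibniz rule for iterates of a derivation. -/
lemma Derivation.iterate_mul {R A : Type*} [CommRing R] [CommRing A] [Algebra R A]
    (D : Derivation R A A) (n : ℕ) (a b : A) :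
    D^[n] (a * b) = ∑ i ∈ Finset.range (n + 1), (n.choose i : A) * (D^[i] a * D^[n - i] b) := by
  induction n with
  | zero => simp
  | succ n ih =>
    have h : ∀ i ∈ Finset.range (n + 1), D ((n.choose i : A) * (D^[i] a * D^[n - i] b)) =
        (n.choose i : A) * (D^[i] a * D^[n + 1 - i] b) +
        (n.choose i : A) * (D^[i + 1] a * D^[n + 1 - (i + 1)] b) := by
      intro i hi
      have hi' := Finset.mem_range.1 hi
      rw [show n + 1 - i = (n - i) + 1 by omega, show n + 1 - (i + 1) = n - i by omega]
      simp only [Derivation.leibniz, Function.iterate_succ_apply', smul_eq_mul, map_natCast,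
        Derivation.map_natCast]
      ring
    rw [Function.iterate_succ_apply', ih, map_sum, Finset.sum_congr rfl h, Finset.sum_add_distrib,
      Finset.sum_range_succ' _ (n + 1), Finset.sum_range_succ' _ n]
    simp only [Nat.choose_succ_succ, Nat.cast_add, add_mul, Finset.sum_add_distrib]
    rw [Finset.sum_range_succ (fun i => ((n.choose (i + 1) : ℕ) : A) * _) n]
    simp
    ring

/-- In characteristic `p`, the `p`-th iterate of a derivation satisfies the Leibniz rule. -/
lemma Derivation.iterate_char_mul {R A : Type*} [CommRing R] [CommRing A] [Algebra R A] (p : ℕ)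
    [CharP A p] (hp : p.Prime) (D : Derivation R A A) (a b : A) :
    D^[p] (a * b) = a * D^[p] b + b * D^[p] a := by
  obtain ⟨q, rfl⟩ : ∃ q, p = q + 1 := ⟨p - 1, by have := hp.pos; omega⟩
  rw [Derivation.iterate_mul, Finset.sum_range_succ, Finset.sum_range_succ',
    Finset.sum_eq_zero]
  · simp; ring
  · intro i hi
    have hi' := Finset.mem_range.1 hi
    rw [(CharP.cast_eq_zero_iff A (q + 1) _).2 (hp.dvd_choose_self (by omega) (by omega)), zero_mul]

end IterateDerivation

/-! ### D^p = θD, and θ is the Hasse invariant up to a constant -/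

section InvariantDerivation

variable {k : Type*} [Field k]

/-- The coordinate ring `k[x, y] / (y² - f(x))`, as a free `k[x]`-module of rank two. -/
abbrev CubicRing (s t : k) : Type _ := QuadraticAlgebra k[X] (shortCubic s t) 0

/-- The invariant derivation `2 y d/dx`. -/
noncomputable def invDer (s t : k) : Derivation k (CubicRing s t) (CubicRing s t) :=
  Derivation.mk'
    { toFun := fun z => ⟨halfOp s t z.im, 2 * derivative z.re⟩
      map_add' := fun z w => by
        ext1
        · simp only [halfOp, QuadraticAlgebra.im_add, QuadraticAlgebra.re_add, derivative_add]; ring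
        · simp only [QuadraticAlgebra.im_add, QuadraticAlgebra.re_add, derivative_add]; ring
      map_smul' := fun c z => by
        ext1
        · simp only [QuadraticAlgebra.im_smul, QuadraticAlgebra.re_smul, smul_eq_C_mul,
            halfOp_C_mul, RingHom.id_apply]
        · simp only [QuadraticAlgebra.im_smul, QuadraticAlgebra.re_smul, smul_eq_C_mul,
            RingHom.id_apply, derivative_C_mul]
          ring }
    (fun z w => by
      ext1
      · simp only [LinearMap.coe_mk, AddHom.coe_mk, QuadraticAlgebra.re_mul,
          QuadraticAlgebra.im_mul, QuadraticAlgebra.re_add, smul_eq_mul, halfOp, derivative_add,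
          derivative_mul, derivative_zero]
        ring
      · simp only [LinearMap.coe_mk, AddHom.coe_mk, QuadraticAlgebra.re_mul,
          QuadraticAlgebra.im_mul, QuadraticAlgebra.im_add, smul_eq_mul, halfOp, derivative_add,
          derivative_mul, derivative_zero]
        ring)

variable (s t : k)

lemma invDer_apply (z : CubicRing s t) : invDer s t z = ⟨halfOp s t z.im, 2 * derivative z.re⟩ :=
  rfl

/-- D² preserves k[x], and (D²a)' = `evenOp` a'. Even iterates on k[x] are thus read off from
iterates of `evenOp` on derivatives. -/
lemma iterate_invDer_re (a : k[X]) (j : ℕ) : ∃ g : k[X],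
    (invDer s t)^[2 * j] ⟨a, 0⟩ = ⟨g, 0⟩ ∧ derivative g = (evenOp s t)^[j] (derivative a) := by
  induction j with
  | zero => exact ⟨a, rfl, rfl⟩
  | succ j ih =>
    obtain ⟨g, h1, h2⟩ := ih
    refine ⟨halfOp s t (2 * derivative g), ?_, ?_⟩
    · rw [show 2 * (j + 1) = 2 * j + 1 + 1 by ring, Function.iterate_succ_apply',
        Function.iterate_succ_apply', h1]
      simp [invDer_apply]; simp [halfOp]
    · rw [Function.iterate_succ_apply', ← h2, evenOp_apply, ← map_ofNat C 2, halfOp_C_mul,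
        derivative_C_mul]

variable {p m : ℕ} [CharP k p]

/-- `(2 y d/dx) ^ p` is a constant multiple of `2 y d/dx`. -/
theorem exists_iterate_invDer_eq (hp : p = 2 * m + 1) (hp5 : 5 ≤ p) (hprime : p.Prime) :
    ∃ θ : k, (∀ z, (invDer s t)^[p] z = C θ • invDer s t z) ∧
      (evenOp s t)^[m] 1 = C θ := by
  have two0 : (2 : k) ≠ 0 := two_ne_zero_of_five_le hp5
  have twoX : (2 : k[X]) ≠ 0 := by rw [← map_ofNat C 2]; simpa using two0
  have : CharP (CubicRing s t) p := by
    have : CharP k[X] p := inferInstance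
    exact charP_of_injective_algebraMap (R := k[X]) QuadraticAlgebra.algebraMap_injective p
  set D := invDer s t with hD
  set E : CubicRing s t → CubicRing s t := D^[p] with hE
  -- E = D^p is again a derivation and commutes with D, so it is known once its values at x and y
  -- are. Commutation at x gives Ey in terms of q, and y² = f then forces q' = 0.
  have hmul : ∀ a b, E (a * b) = a * E b + b * E a := D.iterate_char_mul p hprime
  have hadd : ∀ a b, E (a + b) = E a + E b := fun a b => iterate_map_add D p a b
  have hcomm : ∀ a, E (D a) = D (E a) := fun a => by
    rw [hE, ← Function.iterate_succ_apply, Function.iterate_succ_apply']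
  set q := 2 * (evenOp s t)^[m] 1 with hq
  have hEX : E ⟨X, 0⟩ = ⟨0, q⟩ := by
    obtain ⟨g, h1, h2⟩ := iterate_invDer_re s t X m
    rw [hE, hp, Function.iterate_succ_apply', h1, hD, invDer_apply]
    simp only [h2, derivative_X, hq]
    simp [halfOp]
  have hsmulC : ∀ (c : k) z, E (C c • z) = C c • E z := fun c z => by
    have h : ∀ z : CubicRing s t, C c • z = c • z := fun z => by
      ext1 <;> simp [smul_eq_C_mul]
    simp only [h]
    have : ∀ n : ℕ, D^[n] (c • z) = c • D^[n] z := fun n => by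
      induction n with
      | zero => rfl
      | succ n ih => rw [Function.iterate_succ_apply', ih, Derivation.map_smul,
          Function.iterate_succ_apply']
    exact this p
  have hE1 : E ⟨1, 0⟩ = 0 := by
    have h : (⟨1, 0⟩ : CubicRing s t) = 1 := rfl
    have := hmul 1 1
    rw [one_mul, one_mul] at this
    rw [h]; simpa using this
  -- on polynomials in `x`
  have hEpoly : ∀ a : k[X], E ⟨a, 0⟩ = ⟨0, derivative a * q⟩ := fun a => by
    induction a using Polynomial.induction_on' with
    | add a b ha hb =>
      have : (⟨a + b, 0⟩ : CubicRing s t) = ⟨a, 0⟩ + ⟨b, 0⟩ := by ext1 <;> simp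
      rw [this, hadd, ha, hb]; ext1 <;> simp [add_mul]
    | monomial n c =>
      have h1 : ∀ n : ℕ, E ⟨X ^ n, 0⟩ = ⟨0, derivative (X ^ n) * q⟩ := fun n => by
        induction n with
        | zero => rw [pow_zero, hE1, derivative_one, zero_mul]; rfl
        | succ n ih =>
          have : (⟨X ^ (n + 1), 0⟩ : CubicRing s t) = ⟨X ^ n, 0⟩ * ⟨X, 0⟩ := by
            ext1 <;> simp [pow_succ]
          rw [this, hmul, ih, hEX]
          ext1
          · simp
          · simp [derivative_mul, pow_succ]; ring
      have : (⟨monomial n c, 0⟩ : CubicRing s t) = C c • ⟨X ^ n, 0⟩ := by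
        ext1 <;> simp [C_mul_X_pow_eq_monomial]
      rw [this, hsmulC, h1]
      ext1
      · simp
      · rw [← C_mul_X_pow_eq_monomial, derivative_C_mul]; simp [mul_assoc]
  -- on `y`
  obtain ⟨u, v, huv⟩ : ∃ u v, E ⟨0, 1⟩ = ⟨u, v⟩ := ⟨_, _, rfl⟩
  have hu : 2 * u = halfOp s t q ∧ v = 0 := by
    have h1 : (2 : k[X]) • (⟨0, 1⟩ : CubicRing s t) = D ⟨X, 0⟩ := by
      rw [hD, invDer_apply]; ext1 <;> simp [halfOp]
    have h2 := hcomm ⟨X, 0⟩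
    rw [← h1, hEX, ← map_ofNat C 2, hsmulC, huv, hD, invDer_apply] at h2
    have h3 := congrArg QuadraticAlgebra.re h2
    have h4 := congrArg QuadraticAlgebra.im h2
    simp only [QuadraticAlgebra.re_smul, QuadraticAlgebra.im_smul, smul_eq_mul, map_ofNat,
      derivative_zero, mul_zero] at h3 h4
    exact ⟨h3, (mul_eq_zero.1 h4).resolve_left twoX⟩
  obtain ⟨hu, rfl⟩ := hu
  have hq' : derivative q = 0 := by
    have h1 : (⟨0, 1⟩ : CubicRing s t) * ⟨0, 1⟩ = ⟨shortCubic s t, 0⟩ := by ext1 <;> simp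
    have h2 := hmul ⟨0, 1⟩ ⟨0, 1⟩
    rw [h1, hEpoly, huv] at h2
    have h3 := congrArg QuadraticAlgebra.im h2
    simp only [QuadraticAlgebra.im_add, QuadraticAlgebra.im_mul, mul_zero, zero_mul, one_mul,
      zero_add, add_zero] at h3
    have h4 : 2 * shortCubic s t * derivative q = 0 := by
      rw [halfOp] at hu
      linear_combination -h3 - hu
    exact (mul_eq_zero.1 h4).resolve_left (mul_ne_zero twoX (monic_shortCubic s t).ne_zero)
  -- A polynomial of degree at most m < p with zero derivative is constant.
  have hθ : ∃ θ : k, (evenOp s t)^[m] 1 = C θ := by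
    have hd := (coeff_iterate_evenOp_one s t m).1
    set w := (evenOp s t)^[m] 1
    have hw' : derivative w = 0 := by
      rw [hq, ← map_ofNat C 2, derivative_C_mul, map_ofNat] at hq'
      exact (mul_eq_zero.1 hq').resolve_left twoX
    refine ⟨w.coeff 0, ?_⟩
    ext i
    rcases i with _ | i
    · simp
    · rw [coeff_C_succ]
      rcases lt_or_ge m (i + 1) with h | h
      · exact coeff_eq_zero_of_natDegree_lt (hd.trans_lt h)
      · have h1 := congrArg (fun q => q.coeff i) hw'
        simp only [coeff_derivative, coeff_zero] at h1
        have h2 : ((i + 1 : ℕ) : k) ≠ 0 := natCast_ne_zero_of_lt (p := p) (by omega) (by omega)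
        push_cast at h2
        exact (mul_eq_zero.1 h1).resolve_right h2
  obtain ⟨θ, hθ⟩ := hθ
  refine ⟨θ, fun z => ?_, hθ⟩
  obtain ⟨a, b⟩ := z
  have h1 : (⟨a, b⟩ : CubicRing s t) = ⟨a, 0⟩ + ⟨b, 0⟩ * ⟨0, 1⟩ := by ext1 <;> simp
  have h2 : q = 2 * C θ := by rw [hq, hθ]
  have h3 : u = C θ * derivative (shortCubic s t) := by
    apply mul_left_cancel₀ twoX
    rw [hu, halfOp, hq', h2]; ring
  change E _ = _
  rw [h1, hadd, hmul, hEpoly, hEpoly, huv, ← h1, h3, h2, hD, invDer_apply]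
  ext1
  · simp [halfOp]; ring
  · simp; ring

/-- `evenOp ^ ((p - 1) / 2)` is multiplication by a constant in small degrees. -/
lemma iterate_evenOp_eq {θ : k} (hp : p = 2 * m + 1) (hp5 : 5 ≤ p)
    (hθ : ∀ z, (invDer s t)^[p] z = C θ • invDer s t z) {b : k[X]} (hb : b.natDegree ≤ m - 1) :
    (evenOp s t)^[m] b = C θ * b := by
  have twoX : (2 : k[X]) ≠ 0 := by
    rw [← map_ofNat C 2]; simpa using two_ne_zero_of_five_le (k := k) hp5
  -- In degrees below p - 1 polynomials can be integrated; the y-part of D^p a = θ Da is then the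
  -- claim for b = a'.
  obtain ⟨a, rfl⟩ : ∃ a : k[X], derivative a = b := by
    refine ⟨∑ i ∈ Finset.range m, C (b.coeff i / (i + 1)) * X ^ (i + 1), ?_⟩
    conv_rhs => rw [b.as_sum_range' m (by omega)]
    rw [derivative_sum]
    refine Finset.sum_congr rfl fun i hi => ?_
    have : ((i + 1 : ℕ) : k) ≠ 0 :=
      natCast_ne_zero_of_lt (p := p) (by omega) (by have := Finset.mem_range.1 hi; omega)
    push_cast at this
    rw [derivative_C_mul, derivative_X_pow, ← mul_assoc, ← C_mul, ← C_mul_X_pow_eq_monomial]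
    push_cast
    rw [div_mul_cancel₀ _ this]
  obtain ⟨g, h1, h2⟩ := iterate_invDer_re s t a m
  have h3 := hθ ⟨a, 0⟩
  rw [show p = 2 * m + 1 from hp, Function.iterate_succ_apply', h1] at h3
  simp only [invDer_apply] at h3
  have h4 := congrArg QuadraticAlgebra.im h3
  simp only [QuadraticAlgebra.im_smul, smul_eq_mul, h2] at h4
  apply mul_left_cancel₀ twoX
  linear_combination h4

/-- The constant `θ` with `(2 y d/dx) ^ p = θ · (2 y d/dx)` is the Hasse invariant, up to a unit of
the prime field. -/
theorem iterate_invDer_const_eq {θ : k} (hp : p = 2 * m + 1) (hp5 : 5 ≤ p)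
    (hθ : ∀ z, (invDer s t)^[p] z = C θ • invDer s t z) :
    θ = -2 * hasseCoeff m s t * ∏ i ∈ Finset.range (m - 1), (2 * (i + 2) * (2 * i + 3) : k) := by
  -- For this b, `evenOp`^m b = θb becomes `evenOp`^(m-1)(-2H) = θb; the coefficients of degree m -
  -- 1 are compared.
  obtain ⟨b, hbm, hbd, hb⟩ := exists_monic_evenOp_eq_hasseCoeff s t hp (by omega)
  have h5 := iterate_evenOp_eq s t hp hp5 hθ hbd.le
  rw [show m = (m - 1) + 1 by omega, Function.iterate_succ_apply, hb] at h5
  have hl : ∀ n (c : k), (evenOp s t)^[n] (C c) = C c * (evenOp s t)^[n] 1 := fun n c => by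
    induction n with
    | zero => simp
    | succ n ih =>
      rw [Function.iterate_succ_apply', ih, Function.iterate_succ_apply', ← smul_eq_C_mul, map_smul,
        smul_eq_C_mul]
  have h6 := congrArg (fun q => q.coeff (m - 1)) h5
  simp only [hl, coeff_C_mul, (coeff_iterate_evenOp_one s t (m - 1)).2] at h6
  rw [← hbd, hbm.coeff_natDegree, hbd, mul_one] at h6
  exact h6.symm

end InvariantDerivation

/-! ### Torsion points from functions of prescribed norm, through the class group -/

lemma Ideal.pow_eq_span_of_isCoprime {A : Type*} [CommRing A] {I J : Ideal A} {f g : A} {n : ℕ}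
    (h : I ^ n * J ^ n = Ideal.span {f * g}) (hf : IsCoprime (Ideal.span {f}) J)
    (hg : IsCoprime (Ideal.span {g}) I) : I ^ n = Ideal.span {f} := by
  have hf' : Ideal.span {f} ⊔ J ^ n = ⊤ := Ideal.isCoprime_iff_sup_eq.1 hf.pow_right
  have hg' : Ideal.span {g} ⊔ I ^ n = ⊤ := Ideal.isCoprime_iff_sup_eq.1 hg.pow_right
  have hfg : Ideal.span {f * g} = Ideal.span {f} * Ideal.span {g} :=
    (Ideal.span_singleton_mul_span_singleton f g).symm
  apply le_antisymm
  · calc I ^ n = I ^ n * (Ideal.span {f} ⊔ J ^ n) := by rw [hf', Ideal.mul_top]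
      _ = I ^ n * Ideal.span {f} ⊔ Ideal.span {f} * Ideal.span {g} := by
        rw [Ideal.mul_sup, h, hfg]
      _ ≤ Ideal.span {f} := sup_le Ideal.mul_le_right Ideal.mul_le_left
  · calc Ideal.span {f} = Ideal.span {f} * (Ideal.span {g} ⊔ I ^ n) := by rw [hg', Ideal.mul_top]
      _ = I ^ n * J ^ n ⊔ Ideal.span {f} * I ^ n := by rw [Ideal.mul_sup, h, hfg]
      _ ≤ I ^ n := sup_le Ideal.mul_le_left Ideal.mul_le_right

/-- The Weierstrass curve `y² = x³ + s x + t`. -/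
@[simps] def shortW {R : Type*} [CommRing R] (s t : R) : WeierstrassCurve R where
  a₁ := 0
  a₂ := 0
  a₃ := 0
  a₄ := s
  a₆ := t

section ShortW

variable {R : Type*} [CommRing R] (s t : R)

lemma shortW_map {S : Type*} [CommRing S] (φ : R →+* S) :
    (shortW s t).map φ = shortW (φ s) (φ t) := by
  ext <;> simp [shortW]

lemma shortW_Δ : (shortW s t).Δ = -16 * (4 * s ^ 3 + 27 * t ^ 2) := by
  simp only [WeierstrassCurve.Δ, WeierstrassCurve.b₂, WeierstrassCurve.b₄, WeierstrassCurve.b₆,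
    WeierstrassCurve.b₈, shortW]
  ring

variable {s t}

lemma shortW_equation_iff {x y : R} :
    (shortW s t).toAffine.Equation x y ↔ y ^ 2 = x ^ 3 + s * x + t := by
  rw [WeierstrassCurve.Affine.equation_iff]; simp [shortW]

lemma shortW_negY {x y : R} : (shortW s t).toAffine.negY x y = -y := by
  simp [WeierstrassCurve.Affine.negY, shortW]

lemma shortW_nonsingular {k : Type*} [Field k] {s t x y : k} (h2 : (2 : k) ≠ 0)
    (hΔ : 4 * s ^ 3 + 27 * t ^ 2 ≠ 0)
    (h : y ^ 2 = x ^ 3 + s * x + t) : (shortW s t).toAffine.Nonsingular x y := by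
  refine (WeierstrassCurve.Affine.equation_iff_nonsingular_of_Δ_ne_zero ?_).1
    (shortW_equation_iff.2 h)
  rw [shortW_Δ]
  refine mul_ne_zero (neg_ne_zero.2 ?_) hΔ
  have : (16 : k) = 2 ^ 4 := by norm_num
  rw [this]; exact pow_ne_zero _ h2

lemma shortW_polynomial :
    (shortW s t).toAffine.polynomial = X ^ 2 - C (shortCubic s t) := by
  simp [WeierstrassCurve.Affine.polynomial, shortW, shortCubic]

end ShortW

/-- The ideal-theoretic core of `nsmul_eq_zero_of_norm_eq`, in an arbitrary ring containing a square
root `Y` of `f(x)`. -/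
lemma span_pair_pow_eq_span {k A : Type*} [Field k] [CommRing A] (φ : k[X] →+* A) (Y : A) {s t : k}
    (hY : Y ^ 2 = φ (shortCubic s t)) {n : ℕ} (h2 : (2 : k) ≠ 0) {a b : k[X]} {x y : k}
    (hnorm : a ^ 2 - b ^ 2 * shortCubic s t = -(X - C x) ^ n)
    (hneg : Ideal.span {φ (X - C x), Y - φ (C (-y))} * Ideal.span {φ (X - C x), Y - φ (C y)} =
      Ideal.span {φ (X - C x)})
    (hf : a.eval x + b.eval x * y = 0) (ha : a.eval x ≠ 0) :
    Ideal.span {φ (X - C x), Y - φ (C y)} ^ n = Ideal.span {φ a + φ b * Y} := by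
  have hfg : (φ a + φ b * Y) * (φ a - φ b * Y) = -φ (X - C x) ^ n := by
    have := congrArg φ hnorm
    simp only [map_sub, map_mul, map_pow, map_neg] at this ⊢
    linear_combination this - φ b ^ 2 * hY
  have hlin : ∀ e : k[X], ∃ q, φ e = φ (C (e.eval x)) + φ (X - C x) * q := fun e => by
    obtain ⟨q, hq⟩ := X_sub_C_dvd_sub_C_eval (a := x) (p := e)
    refine ⟨φ q, ?_⟩
    rw [← map_mul, ← hq, ← map_add, add_sub_cancel]
  -- Both a + bY at (x, -y) and a - bY at (x, y) take the value 2a(x), a unit; so neither factor of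
  -- the norm vanishes at the other's point.
  have hcop : ∀ (e : A) (I : Ideal A), e - φ (C (2 * a.eval x)) ∈ I →
      IsCoprime (Ideal.span {e}) I := fun e I he => by
    rw [Ideal.isCoprime_iff_exists]
    have hu : φ (C (2 * a.eval x)⁻¹) * φ (C (2 * a.eval x)) = 1 := by
      rw [← map_mul, ← C_mul, inv_mul_cancel₀ (mul_ne_zero h2 ha), C_1, map_one]
    refine ⟨φ (C (2 * a.eval x)⁻¹) * e, Ideal.mul_mem_left _ _ (Ideal.mem_span_singleton_self e),
      -(φ (C (2 * a.eval x)⁻¹) * (e - φ (C (2 * a.eval x)))),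
      neg_mem (Ideal.mul_mem_left _ _ he), ?_⟩
    linear_combination hu
  obtain ⟨qa, hqa⟩ := hlin a
  obtain ⟨qb, hqb⟩ := hlin b
  have e1 : φ (C (b.eval x)) * φ (C y) = -φ (C (a.eval x)) := by
    rw [← map_mul, ← C_mul, ← map_neg, ← C_neg]
    congr 2; linear_combination hf
  have e2 : φ (C (2 * a.eval x)) = 2 * φ (C (a.eval x)) := by
    rw [C_mul, map_mul, map_ofNat, map_ofNat]
  have e3 : φ (C (-y)) = -φ (C y) := by simp
  have hfc : IsCoprime (Ideal.span {φ a + φ b * Y})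
      (Ideal.span {φ (X - C x), Y - φ (C (-y))}) := by
    refine hcop _ _ (Ideal.mem_span_pair.2 ⟨qa + qb * Y, φ (C (b.eval x)), ?_⟩)
    rw [e2, e3]
    linear_combination -hqa - Y * hqb + e1
  have hgc : IsCoprime (Ideal.span {φ a - φ b * Y}) (Ideal.span {φ (X - C x), Y - φ (C y)}) := by
    refine hcop _ _ (Ideal.mem_span_pair.2 ⟨qa - qb * Y, -φ (C (b.eval x)), ?_⟩)
    rw [e2]
    linear_combination -hqa + Y * hqb + e1
  refine Ideal.pow_eq_span_of_isCoprime ?_ hfc hgc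
  rw [← mul_pow, mul_comm (Ideal.span {φ (X - C x), Y - φ (C y)}), hneg, Ideal.span_singleton_pow,
    hfg, Ideal.span_singleton_neg]

open WeierstrassCurve.Affine in
/-- If `a + b y` has norm `-(x - x₁) ^ n`, vanishes at `(x₁, y₁)` and does not vanish at
`(x₁, -y₁)`, then `(x₁, y₁)` is an `n`-torsion point. -/
theorem nsmul_eq_zero_of_norm_eq {k : Type*} [Field k] [DecidableEq k] {s t : k} {n : ℕ}
    (h2 : (2 : k) ≠ 0) {a b : k[X]} {x y : k}
    (hnorm : a ^ 2 - b ^ 2 * shortCubic s t = -(X - C x) ^ n)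
    (h : (shortW s t).toAffine.Nonsingular x y)
    (hf : a.eval x + b.eval x * y = 0) (ha : a.eval x ≠ 0) :
    n • (Point.some x y h) = 0 := by
  let φ : k[X] →+* (shortW s t).toAffine.CoordinateRing :=
    (CoordinateRing.mk (shortW s t).toAffine).comp C
  let Y' := CoordinateRing.mk (shortW s t).toAffine X
  have hY : Y' ^ 2 = φ (shortCubic s t) := by
    have : CoordinateRing.mk (shortW s t).toAffine (X ^ 2 - C (shortCubic s t)) = 0 := by
      rw [← shortW_polynomial]; exact AdjoinRoot.mk_self
    rw [map_sub, map_pow, sub_eq_zero] at this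
    exact this
  have hXY : ∀ z, CoordinateRing.XYIdeal (shortW s t).toAffine x (C z) =
      Ideal.span {φ (X - C x), Y' - φ (C z)} := fun z => by
    simp only [CoordinateRing.XYIdeal, CoordinateRing.XClass, CoordinateRing.YClass, map_sub, φ, Y',
      RingHom.comp_apply]
  have hneg := CoordinateRing.XYIdeal_neg_mul h
  rw [shortW_negY, hXY, hXY] at hneg
  have hpow := span_pair_pow_eq_span φ Y' hY h2 hnorm hneg hf ha
  rw [← hXY] at hpow
  have hf0 : φ a + φ b * Y' ≠ 0 := fun h0 => by
    have hX : φ (X - C x) ^ n = 0 := by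
      have h1 := congrArg φ hnorm
      rw [map_neg, map_pow, map_sub, map_mul, map_pow, map_pow] at h1
      rw [← neg_eq_zero, ← h1, ← hY]
      linear_combination (φ a - φ b * Y') * h0
    exact CoordinateRing.XClass_ne_zero (W' := (shortW s t).toAffine) x (eq_zero_of_pow_eq_zero hX)
  -- A point is zero exactly when its class is, so it suffices that the n-th power of its ideal is
  -- principal.
  rw [← Point.toClass_eq_zero, map_nsmul, Point.toClass_some]
  change (ClassGroup.mk _ _) ^ n = 1
  rw [← map_pow]
  refine (ClassGroup.mk_eq_one_of_coe_ideal (I' := CoordinateRing.XYIdeal _ x (C y) ^ n) ?_).2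
    ⟨_, hf0, hpow⟩
  rw [Units.val_pow_eq_pow_val, CoordinateRing.XYIdeal'_eq, FractionalIdeal.coeIdeal_pow]

/-! ### Eigenfunctions of the invariant derivation and their zeros -/

section Eigenvector

variable {k : Type*} [Field k] {p m : ℕ} [CharP k p] {s t : k}

/-- Over an algebraically closed field `evenOp` has a monic eigenvector of degree
`(p - 1) / 2 - 1`. -/
lemma exists_evenOp_eigenvector [IsAlgClosed k] (hp : p = 2 * m + 1) (hp5 : 5 ≤ p) (s t : k) :
    ∃ (c : k) (b : k[X]), b.Monic ∧ b.natDegree = m - 1 ∧ evenOp s t b = C c * b := by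
  have hmem : ∀ b : k[X], b ∈ degreeLT k m ↔ b.natDegree ≤ m - 1 := fun b => by
    rw [mem_degreeLT]
    rcases eq_or_ne b 0 with rfl | hb
    · simp
    · rw [degree_eq_natDegree hb]
      constructor
      · intro h; have : b.natDegree < m := by exact_mod_cast h
        omega
      · intro h; have : b.natDegree < m := by omega
        exact_mod_cast this
  have hmaps : ∀ b ∈ degreeLT k m, evenOp s t b ∈ degreeLT k m := fun b hb =>
    (hmem _).2 (natDegree_evenOp_le hp (by omega) ((hmem _).1 hb))
  have : Nontrivial (degreeLT k m) :=
    ⟨⟨⟨1, (hmem _).2 (by simp)⟩, 0, fun h => one_ne_zero (congrArg Subtype.val h)⟩⟩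
  have : Module.Finite k (degreeLT k m) := Module.Finite.equiv (degreeLTEquiv k m).symm
  obtain ⟨c, hc⟩ := Module.End.exists_eigenvalue ((evenOp s t).restrict hmaps)
  obtain ⟨b, hb⟩ := hc.exists_hasEigenvector
  have hb0 : (b : k[X]) ≠ 0 := fun h => hb.2 (Subtype.ext h)
  have hbe : evenOp s t b = C c * b := by
    have := congrArg Subtype.val hb.apply_eq_smul
    simpa [smul_eq_C_mul] using this
  have hbd := natDegree_eq_of_evenOp_eigenvector hp hp5 hb0 ((hmem _).1 b.2) hbe
  refine ⟨c, C (b : k[X]).leadingCoeff⁻¹ * b, monic_C_mul_of_mul_leadingCoeff_eq_one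
    (inv_mul_cancel₀ (leadingCoeff_ne_zero.2 hb0)), ?_, ?_⟩
  · rw [natDegree_C_mul (inv_ne_zero (leadingCoeff_ne_zero.2 hb0)), hbd]
  · rw [← smul_eq_C_mul, map_smul, hbe, smul_eq_C_mul, smul_eq_C_mul]; ring

/-- The eigenvalues of `evenOp` are roots of the Hasse invariant, up to a unit. -/
lemma eigenvalue_pow_eq {θ : k} (hp : p = 2 * m + 1) (hp5 : 5 ≤ p)
    (hθ : ∀ z, (invDer s t)^[p] z = C θ • invDer s t z) {c : k} {b : k[X]} (hb0 : b ≠ 0)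
    (hbd : b.natDegree ≤ m - 1) (hb : evenOp s t b = C c * b) : c ^ m = θ := by
  have h := iterate_evenOp_eq s t hp hp5 hθ hbd
  have h' : ∀ n, (evenOp s t)^[n] b = C (c ^ n) * b := fun n => by
    induction n with
    | zero => simp
    | succ n ih =>
      rw [Function.iterate_succ_apply', ih, ← smul_eq_C_mul, map_smul, hb, smul_eq_C_mul, pow_succ,
        C_mul]
      ring
  rw [h'] at h
  exact C_injective (mul_right_cancel₀ hb0 h)

/-- The expected coefficient of degree m + 1 carries the factor 2(m - 1) + 3 = p. -/
lemma natDegree_halfOp_le (hp : p = 2 * m + 1) (hp5 : 5 ≤ p) {b : k[X]}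
    (hbd : b.natDegree ≤ m - 1) : (halfOp s t b).natDegree ≤ m := by
  have h0 : ∀ i, m - 1 < i → b.coeff i = 0 := fun i hi =>
    coeff_eq_zero_of_natDegree_lt (hbd.trans_lt hi)
  refine natDegree_le_iff_coeff_eq_zero.2 fun i hi => ?_
  obtain ⟨i, rfl⟩ : ∃ i', i = i' + 2 := ⟨i - 2, by omega⟩
  rw [coeff_halfOp, h0 (i + 2) (by omega), h0 (i + 3) (by omega)]
  rcases eq_or_ne i (m - 1) with rfl | hne
  · have := two_mul_eq_neg_one (k := k) hp
    rw [Nat.cast_sub (by omega)]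
    push_cast
    linear_combination b.coeff (m - 1) * this
  · rw [h0 i (by omega)]; ring

/-- The norm of the eigenfunction `a + b y` of the invariant derivation. -/
lemma norm_eigenfunction (hp : p = 2 * m + 1) (hp5 : 5 ≤ p) {c : k} (hc : c ≠ 0) {b : k[X]}
    (hbm : b.Monic) (hbd : b.natDegree = m - 1) (hb : evenOp s t b = C (c ^ 2) * b) :
    (C c⁻¹ * halfOp s t b) ^ 2 - b ^ 2 * shortCubic s t =
      -(X ^ p - C ((c⁻¹ * (halfOp s t b).coeff 0) ^ 2 - b.coeff 0 ^ 2 * t)) := by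
  set a := C c⁻¹ * halfOp s t b with ha
  have hcc : C c * C c⁻¹ = 1 := by rw [← C_mul, mul_inv_cancel₀ hc, C_1]
  have h1 : halfOp s t b = C c * a := by rw [ha, ← mul_assoc, hcc, one_mul]
  have h2 : 2 * derivative a = C c * b := by
    rw [evenOp_apply, h1, derivative_C_mul, pow_two, C_mul] at hb
    apply mul_left_cancel₀ (show C c ≠ 0 by simpa using hc)
    linear_combination hb
  set N := b ^ 2 * shortCubic s t - a ^ 2 with hN
  -- `h1` and `h2` say D(a + by) = c(a + by), and N' = b(ca) - a(cb) = 0. Being monic of degree p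
  -- with zero derivative, N is X^p minus a constant.
  have hN' : derivative N = 0 := by
    rw [halfOp] at h1
    rw [hN, derivative_sub, derivative_mul, derivative_pow, derivative_pow]
    push_cast
    simp only [map_ofNat, pow_one]
    linear_combination b * h1 - a * h2
  have had : (a ^ 2).natDegree ≤ 2 * m := by
    refine natDegree_pow_le.trans (Nat.mul_le_mul le_rfl ((natDegree_C_mul_le _ _).trans ?_))
    exact natDegree_halfOp_le hp hp5 hbd.le
  have hBm : (b ^ 2 * shortCubic s t).Monic := (hbm.pow 2).mul (monic_shortCubic s t)
  have hBd : (b ^ 2 * shortCubic s t).natDegree = p := by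
    rw [(hbm.pow 2).natDegree_mul (monic_shortCubic s t), hbm.natDegree_pow, hbd,
      natDegree_shortCubic]
    omega
  suffices N = X ^ p - C ((c⁻¹ * (halfOp s t b).coeff 0) ^ 2 - b.coeff 0 ^ 2 * t) by
    rw [← this, hN]; ring
  ext i
  rcases Nat.eq_zero_or_pos i with rfl | hi
  · have : (shortCubic s t).coeff 0 = t := by simp [shortCubic]
    rw [hN, coeff_sub, coeff_sub, mul_coeff_zero, this, ha, coeff_zero_eq_eval_zero (_ ^ 2),
      coeff_zero_eq_eval_zero (_ ^ 2), coeff_C_zero, coeff_X_pow, if_neg (by omega)]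
    simp [← coeff_zero_eq_eval_zero]
  · rw [coeff_sub (X ^ p), coeff_C, if_neg (by omega), sub_zero, coeff_X_pow]
    rcases lt_trichotomy i p with h | rfl | h
    · rw [if_neg (by omega)]
      obtain ⟨i, rfl⟩ : ∃ i', i = i' + 1 := ⟨i - 1, by omega⟩
      have h3 := congrArg (fun q => q.coeff i) hN'
      simp only [coeff_derivative, coeff_zero] at h3
      have h4 : ((i + 1 : ℕ) : k) ≠ 0 := natCast_ne_zero_of_lt (p := p) (by omega) (by omega)
      push_cast at h4
      exact (mul_eq_zero.1 h3).resolve_right h4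
    · rw [if_pos rfl, hN, coeff_sub, coeff_eq_zero_of_natDegree_lt (p := a ^ 2) (by omega), sub_zero]
      conv_lhs => rw [← hBd]
      exact hBm
    · rw [if_neg (by omega), hN, coeff_sub, coeff_eq_zero_of_natDegree_lt (p := a ^ 2) (by omega),
        coeff_eq_zero_of_natDegree_lt (p := b ^ 2 * _) (by omega), sub_zero]

/-- The zeros of an eigenfunction of the invariant derivation are `p`-torsion points. -/
theorem exists_torsion_of_eigenfunction [DecidableEq k] (hp : p = 2 * m + 1) (hp5 : 5 ≤ p)
    (hprime : p.Prime) (hΔ : 4 * s ^ 3 + 27 * t ^ 2 ≠ 0) {c : k} (hc : c ≠ 0) {b : k[X]}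
    (hbm : b.Monic) (hbd : b.natDegree = m - 1) (hb : evenOp s t b = C (c ^ 2) * b) {x : k}
    (hx : x ^ p = (c⁻¹ * (halfOp s t b).coeff 0) ^ 2 - b.coeff 0 ^ 2 * t)
    (hfx : x ^ 3 + s * x + t ≠ 0) :
    ∃ (y : k) (h : (shortW s t).toAffine.Nonsingular x y), p • Point.some x y h = 0 ∧
      b.eval x ≠ 0 ∧ y = -(c⁻¹ * (halfOp s t b).eval x) / b.eval x := by
  have : Fact p.Prime := ⟨hprime⟩
  have two0 : (2 : k) ≠ 0 := two_ne_zero_of_five_le hp5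
  have hnorm := norm_eigenfunction hp hp5 hc hbm hbd hb
  rw [← hx, C_pow, ← sub_pow_char] at hnorm
  set a := C c⁻¹ * halfOp s t b with ha
  have hcc : C c * C c⁻¹ = 1 := by rw [← C_mul, mul_inv_cancel₀ hc, C_1]
  have h1 : halfOp s t b = C c * a := by rw [ha, ← mul_assoc, hcc, one_mul]
  have h2 : 2 * derivative a = C c * b := by
    rw [evenOp_apply, h1, derivative_C_mul, pow_two, C_mul] at hb
    apply mul_left_cancel₀ (show C c ≠ 0 by simpa using hc)
    linear_combination hb
  have hev : a.eval x ^ 2 = b.eval x ^ 2 * (x ^ 3 + s * x + t) := by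
    have := congrArg (eval x) hnorm
    simp only [eval_sub, eval_pow, eval_mul, eval_shortCubic, eval_neg, eval_X, eval_C, sub_self,
      zero_pow hprime.ne_zero, neg_zero] at this
    linear_combination this
  -- If a and b had a common zero x, the system 2a' = cb, 2fb' + f'b = ca with f(x) ≠ 0 would raise
  -- its order in both step by step up to m, more than the degree of b.
  have hbx : b.eval x ≠ 0 := fun hbx => by
    have hax : a.eval x = 0 := by
      rw [hbx] at hev; simpa using hev
    have hdvd : ∀ e : ℕ, e < m → (X - C x) ^ (e + 1) ∣ a ∧ (X - C x) ^ (e + 1) ∣ b := fun e => by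
      induction e with
      | zero => intro _; rw [zero_add, pow_one]; exact ⟨dvd_iff_isRoot.2 hax, dvd_iff_isRoot.2 hbx⟩
      | succ e ih =>
        intro he
        obtain ⟨⟨a1, ha1⟩, ⟨b1, hb1⟩⟩ := ih (by omega)
        have hP0 : (X - C x) ^ e ≠ 0 := pow_ne_zero _ (X_sub_C_ne_zero x)
        have hek : ((e + 1 : ℕ) : k) ≠ 0 := natCast_ne_zero_of_lt (p := p) (by omega) (by omega)
        have hd : derivative ((X - C x) ^ (e + 1)) = C ((e + 1 : ℕ) : k) * (X - C x) ^ e := by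
          rw [derivative_X_sub_C_pow]; simp
        have hu : IsUnit (2 * C ((e + 1 : ℕ) : k)) := by
          rw [← map_ofNat C 2, ← C_mul]
          exact isUnit_C.2 (mul_ne_zero two0 hek).isUnit
        have hA : (X - C x) ∣ a1 := by
          rw [ha1, hb1, derivative_mul, hd] at h2
          have : (X - C x) ∣ 2 * C ((e + 1 : ℕ) : k) * a1 := by
            refine ⟨C c * b1 - 2 * derivative a1, mul_left_cancel₀ hP0 ?_⟩
            linear_combination h2
          exact (hu.dvd_mul_left).1 this
        have hB : (X - C x) ∣ b1 := by
          rw [halfOp, ha1, hb1, derivative_mul, hd] at h1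
          have h3 : (X - C x) ∣ 2 * C ((e + 1 : ℕ) : k) * (shortCubic s t * b1) := by
            refine ⟨C c * a1 - 2 * shortCubic s t * derivative b1 -
              derivative (shortCubic s t) * b1, mul_left_cancel₀ hP0 ?_⟩
            linear_combination h1
          rw [hu.dvd_mul_left, dvd_iff_isRoot, IsRoot.def, eval_mul, eval_shortCubic] at h3
          exact dvd_iff_isRoot.2 ((mul_eq_zero.1 h3).resolve_left hfx)
        rw [ha1, hb1, pow_succ _ (e + 1)]
        exact ⟨mul_dvd_mul_left _ hA, mul_dvd_mul_left _ hB⟩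
    have := natDegree_le_of_dvd (hdvd (m - 1) (by omega)).2 hbm.ne_zero
    rw [natDegree_pow, natDegree_X_sub_C, hbd] at this
    omega
  have hax : a.eval x ≠ 0 := fun h0 => by
    rw [h0] at hev
    have := mul_ne_zero (pow_ne_zero 2 hbx) hfx
    exact this (by rw [← hev]; ring)
  have hy : (-(a.eval x) / b.eval x) ^ 2 = x ^ 3 + s * x + t := by
    field_simp; linear_combination hev
  have hns := shortW_nonsingular two0 hΔ hy
  have hea : a.eval x = c⁻¹ * (halfOp s t b).eval x := by simp [ha]
  rw [← hea]
  refine ⟨_, hns, ?_, hbx, rfl⟩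
  exact nsmul_eq_zero_of_norm_eq two0 hnorm hns (by field_simp; ring) hax

end Eigenvector

/-! ### Elliptic relations between division polynomials and x-coordinates -/

section EllSequence

/-- The hypotheses on a sequence `w` and a sequence `u` of `x`-coordinates of multiples of a point
`(x, y)`, up to index `N`, which relate `w` to the division polynomials. -/
structure EllSeqData {k : Type*} [Field k] (s t x y : k) (N : ℕ) (w u : ℕ → k) : Prop where
  y_sq : y ^ 2 = x ^ 3 + s * x + t
  w_one : w 1 = 1
  w_two : w 2 = 2 * y
  w_three : w 3 = 3 * x ^ 4 + 6 * s * x ^ 2 + 12 * t * x - s ^ 2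
  w_four : w 4 = 2 * y * (2 * x ^ 6 + 10 * s * x ^ 4 + 40 * t * x ^ 3 - 10 * s ^ 2 * x ^ 2
    - 8 * s * t * x - 2 * s ^ 3 - 16 * t ^ 2)
  w_odd : ∀ j, w (2 * j + 5) = w (j + 4) * w (j + 2) ^ 3 - w (j + 1) * w (j + 3) ^ 3
  w_even : ∀ j, w (2 * j + 6) * w 2 = w (j + 2) ^ 2 * w (j + 3) * w (j + 5)
    - w (j + 1) * w (j + 3) * w (j + 4) ^ 2
  u_one : u 1 = x
  u_two : 2 < N → (2 * y) ^ 2 * u 2 = x ^ 4 - 2 * s * x ^ 2 - 8 * t * x + s ^ 2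
  y_ne : 2 < N → 2 * y ≠ 0
  u_ne : ∀ j, 2 ≤ j → j + 1 < N → u j ≠ x
  u_add : ∀ j, 2 ≤ j → j + 1 < N → (u (j + 1) + u (j - 1)) * (u j - x) ^ 2 =
    2 * ((x * u j + s) * (x + u j) + 2 * t)
  u_mul : ∀ j, 2 ≤ j → j + 1 < N → u (j + 1) * u (j - 1) * (u j - x) ^ 2 =
    (x * u j - s) ^ 2 - 4 * t * (x + u j)

namespace EllSeqData

variable {k : Type*} [Field k] {s t x y : k} {N : ℕ} {w u : ℕ → k}

/-- One outward step, away from the diagonal, in the proof of `rel`. -/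
lemma rel_step (h : EllSeqData s t x y N w u) {M : ℕ} (hM : M + 1 ≤ N)
    (h0 : ∀ j, 0 < j → j ≤ M → w j ≠ 0)
    (ih : ∀ m n, 1 ≤ n → n < m → m + n ≤ M →
      w (m + n) * w (m - n) = (u n - u m) * w m ^ 2 * w n ^ 2)
    {m n : ℕ} (hn : 1 ≤ n) (hnm : n + 1 < m) (hmn : m + n = M)
    (hstep : w (m + (n + 1)) * w (m - (n + 1)) = (u (n + 1) - u m) * w m ^ 2 * w (n + 1) ^ 2) :
    w (m + 1 + n) * w (m + 1 - n) = (u n - u (m + 1)) * w (m + 1) ^ 2 * w n ^ 2 := by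
  obtain ⟨d, rfl⟩ : ∃ d, m = n + 2 + d := ⟨m - n - 2, by omega⟩
  have hu1 := h.u_add (n + 2 + d) (by omega) (by omega)
  have hu2 := h.u_mul (n + 2 + d) (by omega) (by omega)
  have i4 := ih (n + 2 + d) 1 le_rfl (by omega) (by omega)
  rw [h.u_one, h.w_one] at i4
  rcases Nat.lt_or_ge n 2 with hn2 | hn2
  · obtain rfl : n = 1 := by omega
    have i2 := ih (1 + 1 + d) 1 le_rfl (by omega) (by omega)
    rw [h.u_one, h.w_one] at i2
    have hx2 := h.u_two (by omega)
    rw [h.w_two] at hstep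
    simp only [show 1 + 2 + d = d + 3 by ring, show 1 + 1 + d = d + 2 by ring,
      show d + 3 + 1 = d + 4 by ring, show d + 3 - 1 = d + 2 by omega, show (1 + 1) = 2 by rfl,
      show d + 2 + 1 = d + 3 by ring, show d + 2 - 1 = d + 1 by omega] at *
    rw [show d + 3 + 2 = d + 5 by ring, show d + 3 - 2 = d + 1 by omega] at hstep
    rw [show d + 4 + 1 = d + 5 by ring, show d + 4 - 1 = d + 3 by omega, h.u_one, h.w_one]
    have e1 := h0 (d + 3) (by omega) (by omega)
    have e2 := h0 (d + 1) (by omega) (by omega)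
    have id1 : (u (d + 4) - x) * (u (d + 2) - x) * (u (d + 3) - x) ^ 2 =
        (u 2 - u (d + 3)) * (2 * y) ^ 2 := by
      linear_combination hu2 - x * hu1 - hx2 + 4 * u (d + 3) * h.y_sq
    apply mul_right_cancel₀ (mul_ne_zero e1 e2)
    calc w (d + 5) * w (d + 3) * (w (d + 3) * w (d + 1))
        = w (d + 3) ^ 2 * (w (d + 5) * w (d + 1)) := by ring
      _ = ((u 2 - u (d + 3)) * (2 * y) ^ 2) * w (d + 3) ^ 4 := by rw [hstep]; ring
      _ = (u (d + 4) - x) * (u (d + 2) - x) * ((x - u (d + 3)) * w (d + 3) ^ 2 * 1 ^ 2) ^ 2 := by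
        rw [← id1]; ring
      _ = (x - u (d + 4)) * w (d + 4) ^ 2 * ((x - u (d + 2)) * w (d + 2) ^ 2 * 1 ^ 2) := by
        rw [← i4]; ring
      _ = (x - u (d + 4)) * w (d + 4) ^ 2 * 1 ^ 2 * (w (d + 3) * w (d + 1)) := by rw [← i2]; ring
  · have hv1 := h.u_add n hn2 (by omega)
    have hv2 := h.u_mul n hn2 (by omega)
    have i5 := ih n 1 le_rfl (by omega) (by omega)
    rw [h.u_one, h.w_one] at i5
    have i2 := ih (n + 1 + d) n hn (by omega) (by omega)
    have i3 := ih (n + 2 + d) (n - 1) (by omega) (by omega) (by omega)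
    obtain ⟨n, rfl⟩ : ∃ n', n = n' + 1 := ⟨n - 1, by omega⟩
    simp only [show n + 1 + 2 + d = n + d + 3 by ring, show n + 1 + 1 + d = n + d + 2 by ring,
      show n + d + 3 + 1 = n + d + 4 by ring, show n + d + 3 - 1 = n + d + 2 by omega,
      show n + 1 + 1 = n + 2 by ring, show n + 1 - 1 = n by omega,
      show n + d + 2 + (n + 1) = 2 * n + d + 3 by ring, show n + d + 2 - (n + 1) = d + 1 by omega,
      show n + d + 3 + n = 2 * n + d + 3 by ring, show n + d + 3 - n = d + 3 by omega] at *
    rw [show n + d + 3 + (n + 2) = 2 * n + d + 5 by ring,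
      show n + d + 3 - (n + 2) = d + 1 by omega] at hstep
    rw [show n + d + 4 + (n + 1) = 2 * n + d + 5 by ring,
      show n + d + 4 - (n + 1) = d + 3 by omega]
    have e1 := h0 (2 * n + d + 3) (by omega) (by omega)
    have e2 := h0 (d + 1) (by omega) (by omega)
    -- For points A, P the product (x(A+P) - z)(x(A-P) - z)(x(A) - x(P))² is a polynomial in x(A),
    -- x(P), z that is symmetric in x(A) and z. Applied with A = mP, z = x(nP), and with the roles
    -- exchanged, it gives this identity.
    have id1 : (u (n + d + 4) - u (n + 1)) * (u (n + d + 2) - u (n + 1)) *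
        (u (n + d + 3) - x) ^ 2 = (u (n + 2) - u (n + d + 3)) * (u n - u (n + d + 3)) *
        (u (n + 1) - x) ^ 2 := by
      linear_combination hu2 - u (n + 1) * hu1 - hv2 + u (n + d + 3) * hv1
    apply mul_right_cancel₀ (mul_ne_zero e1 e2)
    calc w (2 * n + d + 5) * w (d + 3) * (w (2 * n + d + 3) * w (d + 1))
        = (w (2 * n + d + 5) * w (d + 1)) * (w (2 * n + d + 3) * w (d + 3)) := by ring
      _ = (u (n + 2) - u (n + d + 3)) * (u n - u (n + d + 3)) * w (n + d + 3) ^ 4 *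
          (w (n + 2) * w n) ^ 2 := by rw [hstep, i3]; ring
      _ = ((u (n + 2) - u (n + d + 3)) * (u n - u (n + d + 3)) * (u (n + 1) - x) ^ 2) *
          w (n + d + 3) ^ 4 * w (n + 1) ^ 4 := by rw [i5]; ring
      _ = (u (n + d + 4) - u (n + 1)) * (u (n + d + 2) - u (n + 1)) *
          ((x - u (n + d + 3)) * w (n + d + 3) ^ 2 * 1 ^ 2) ^ 2 * w (n + 1) ^ 4 := by
        rw [← id1]; ring
      _ = (u (n + 1) - u (n + d + 4)) * w (n + d + 4) ^ 2 * w (n + 1) ^ 2 *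
          ((u (n + 1) - u (n + d + 2)) * w (n + d + 2) ^ 2 * w (n + 1) ^ 2) := by
        rw [← i4]; ring
      _ = _ := by rw [← i2]

/-- The terms `w j` do not vanish for `0 < j < N`, and `u` and `w` satisfy the elliptic relations. -/
theorem rel_aux (h : EllSeqData s t x y N w u) (M : ℕ) (hM : M ≤ N) :
    (∀ j, 0 < j → j ≤ M → j < N → w j ≠ 0) ∧
    (∀ m n, 1 ≤ n → n < m → m + n ≤ M →
      w (m + n) * w (m - n) = (u n - u m) * w m ^ 2 * w n ^ 2) := by
  induction M with
  | zero => exact ⟨fun j h1 h2 => by omega, fun m n h1 h2 h3 => by omega⟩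
  | succ M ih =>
    obtain ⟨ih0, ih1⟩ := ih (by omega)
    have hw : ∀ j, 0 < j → j ≤ M → w j ≠ 0 := fun j h1 h2 => ih0 j h1 h2 (by omega)
    have hrel : ∀ m n, 1 ≤ n → n < m → m + n = M + 1 →
        w (m + n) * w (m - n) = (u n - u m) * w m ^ 2 * w n ^ 2 := by
      -- from the centre outwards
      have out : ∀ c i n, 1 ≤ n → n < c → c + n + i = M + 1 →
          w (c + (n + i)) * w (c - (n + i)) = (u (n + i) - u c) * w c ^ 2 * w (n + i) ^ 2 →
          n + i < c →
          w (c + i + n) * w (c + i - n) = (u n - u (c + i)) * w (c + i) ^ 2 * w n ^ 2 := by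
        intro c i
        induction i generalizing c with
        | zero => intro n _ _ _ hc _; simpa using hc
        | succ i ihi =>
          intro n h1 h2 h3 hc h4
          have hs := ihi c (n + 1) (by omega) (by omega) (by omega)
            (by rw [show n + 1 + i = n + (i + 1) by ring]; exact hc) (by omega)
          exact h.rel_step hM hw ih1 (m := c + i) h1 (by omega) (by omega) hs
      -- For index difference 1 or 2 the duplication recursions express the left side through
      -- relations with second index 1; the smallest indices are checked from the explicit formulas.
      have centre : ∀ c n, 1 ≤ n → n < c → c ≤ n + 2 → c + n = M + 1 →
          w (c + n) * w (c - n) = (u n - u c) * w c ^ 2 * w n ^ 2 := by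
        intro c n h1 h2 h3 h4
        have h3' : c = n + 1 ∨ c = n + 2 := by omega
        rcases h3' with rfl | rfl
        · rcases Nat.lt_or_ge n 2 with hn | hn
          · obtain rfl : n = 1 := by omega
            have hx2 := h.u_two (by omega)
            norm_num
            rw [h.w_three, h.w_one, h.w_two, h.u_one]
            linear_combination hx2 - 4 * x * h.y_sq
          · obtain ⟨j, rfl⟩ : ∃ j, n = j + 2 := ⟨n - 2, by omega⟩
            have r1 := ih1 (j + 3) 1 le_rfl (by omega) (by omega)
            have r2 := ih1 (j + 2) 1 le_rfl (by omega) (by omega)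
            simp only [show j + 3 + 1 = j + 4 by ring, show j + 3 - 1 = j + 2 by omega,
              show j + 2 + 1 = j + 3 by ring, show j + 2 - 1 = j + 1 by omega, h.u_one,
              h.w_one] at r1 r2
            rw [show j + 2 + 1 + (j + 2) = 2 * j + 5 by ring, show j + 2 + 1 - (j + 2) = 1 by omega,
              h.w_odd, h.w_one]
            linear_combination w (j + 2) ^ 2 * r1 - w (j + 3) ^ 2 * r2
        · rcases Nat.lt_or_ge n 2 with hn | hn
          · obtain rfl : n = 1 := by omega
            have hx2 := h.u_two (by omega)
            have hx3 := h.u_add 2 le_rfl (by omega)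
            have hy := h.y_sq
            norm_num at hx3 ⊢
            rw [h.u_one] at hx3
            rw [h.w_three, h.w_one, h.w_two, h.w_four, h.u_one]
            have e3 : 3 * x ^ 4 + 6 * s * x ^ 2 + 12 * t * x - s ^ 2 = (x - u 2) * (2 * y) ^ 2 := by
              linear_combination hx2 - 4 * x * hy
            have e4 : (2 * y) ^ 2 * (2 * y) ^ 2 * (u 2 + x) * (x * u 2 + s) =
              (x ^ 4 - 2 * s * x ^ 2 - 8 * t * x + s ^ 2 + x * (2 * y) ^ 2) *
              (x * (x ^ 4 - 2 * s * x ^ 2 - 8 * t * x + s ^ 2) + s * (2 * y) ^ 2) := by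
              rw [← hx2]; ring
            have e5 : (x - u 3) * (3 * x ^ 4 + 6 * s * x ^ 2 + 12 * t * x - s ^ 2) ^ 2 =
              2 * x * (3 * x ^ 4 + 6 * s * x ^ 2 + 12 * t * x - s ^ 2) ^ 2 -
              2 * ((x ^ 4 - 2 * s * x ^ 2 - 8 * t * x + s ^ 2 + x * (2 * y) ^ 2) *
              (x * (x ^ 4 - 2 * s * x ^ 2 - 8 * t * x + s ^ 2) + s * (2 * y) ^ 2) +
              2 * t * (2 * y) ^ 4) := by
              rw [← e4, e3]
              linear_combination -(2 * y) ^ 4 * hx3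
            have hy4 : (2 * y) ^ 4 = (4 * (x ^ 3 + s * x + t)) ^ 2 := by
              rw [← hy]; ring
            have hy2 : (2 * y) ^ 2 = 4 * (x ^ 3 + s * x + t) := by
              rw [← hy]; ring
            rw [one_pow, mul_one, e5, hy4, hy2]
            linear_combination 4 * (2 * x ^ 6 + 10 * s * x ^ 4 + 40 * t * x ^ 3
              - 10 * s ^ 2 * x ^ 2 - 8 * s * t * x - 2 * s ^ 3 - 16 * t ^ 2) * hy
          · obtain ⟨j, rfl⟩ : ∃ j, n = j + 2 := ⟨n - 2, by omega⟩
            have r1 := ih1 (j + 4) 1 le_rfl (by omega) (by omega)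
            have r2 := ih1 (j + 2) 1 le_rfl (by omega) (by omega)
            simp only [show j + 4 + 1 = j + 5 by ring, show j + 4 - 1 = j + 3 by omega,
              show j + 2 + 1 = j + 3 by ring, show j + 2 - 1 = j + 1 by omega, h.u_one,
              h.w_one] at r1 r2
            rw [show j + 2 + 2 + (j + 2) = 2 * j + 6 by ring, show j + 2 + 2 - (j + 2) = 2 by omega,
              h.w_even]
            linear_combination w (j + 2) ^ 2 * r1 - w (j + 4) ^ 2 * r2
      intro m n h1 h2 h3
      -- The pair (m - i, n + i) has the same sum and difference 1 or 2; i outward steps lead back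
      -- to (m, n).
      set i := (m - n - 1) / 2 with hi
      have hc := centre (m - i) (n + i) (by omega) (by omega) (by omega) (by omega)
      have := out (m - i) i n h1 (by omega) (by omega) hc (by omega)
      rwa [show m - i + i = m by omega] at this
    refine ⟨fun j h1 h2 h3 => ?_, fun m n h1 h2 h3 => ?_⟩
    · rcases Nat.lt_or_ge j (M + 1) with hj | hj
      · exact hw j h1 (by omega)
      · obtain rfl : j = M + 1 := by omega
        have hM3 : M = 0 ∨ M = 1 ∨ 2 ≤ M := by omega
        rcases hM3 with rfl | rfl | hM2
        · rw [h.w_one]; exact one_ne_zero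
        · rw [h.w_two]; exact h.y_ne (by omega)
        -- w (M+1) w (M-1) = (x - u M) w(M)², and neither factor on the right vanishes.
        · have hr := hrel M 1 le_rfl (by omega) rfl
          intro h0
          rw [h0, h.u_one, h.w_one, zero_mul, one_pow, mul_one] at hr
          exact mul_ne_zero (sub_ne_zero.2 (h.u_ne M hM2 (by omega)).symm)
            (pow_ne_zero 2 (hw M (by omega) le_rfl)) hr.symm
    · rcases Nat.lt_or_ge (m + n) (M + 1) with hj | hj
      · exact ih1 m n h1 h2 (by omega)
      · exact hrel m n h1 h2 (by omega)

end EllSeqData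

end EllSequence

/-! ### x-coordinates of sums and differences of points -/

section PointCoordinates

variable {k : Type*} [Field k] {s t : k}

/-- The `x`-coordinate of a point, with junk value `0` at infinity. -/
def xCoord : (shortW s t).toAffine.Point → k
  | 0 => 0
  | .some x _ _ => x

@[simp] lemma xCoord_some {x y : k} (h : (shortW s t).toAffine.Nonsingular x y) :
    xCoord (Point.some x y h) = x := rfl

lemma exists_eq_some_xCoord {A : (shortW s t).toAffine.Point} (hA : A ≠ 0) :
    ∃ y h, A = Point.some (xCoord A) y h := by
  rcases A with _ | ⟨x, y, h⟩
  · exact absurd rfl hA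
  · exact ⟨y, h, rfl⟩

lemma eq_or_eq_neg_of_xCoord_eq {A B : (shortW s t).toAffine.Point} (hA : A ≠ 0) (hB : B ≠ 0)
    (h : xCoord A = xCoord B) : A = B ∨ A = -B := by
  obtain ⟨y, hy, hA'⟩ := exists_eq_some_xCoord hA
  obtain ⟨z, hz, hB'⟩ := exists_eq_some_xCoord hB
  rw [hA', hB']
  exact Point.X_eq_iff.1 h

@[simp] lemma xCoord_neg (A : (shortW s t).toAffine.Point) : xCoord (-A) = xCoord A := by
  rcases A with _ | ⟨x, y, h⟩ <;> rfl

variable [DecidableEq k]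

lemma xCoord_add_some {x y a b : k} {h : (shortW s t).toAffine.Nonsingular x y}
    {h' : (shortW s t).toAffine.Nonsingular a b} (hax : a ≠ x) :
    xCoord (Point.some a b h' + Point.some x y h) = ((b - y) / (a - x)) ^ 2 - a - x := by
  rw [Point.add_of_X_ne hax, xCoord_some, WeierstrassCurve.Affine.slope_of_X_ne hax,
    WeierstrassCurve.Affine.addX]
  simp

lemma xCoord_sub_some {x y a b : k} {h : (shortW s t).toAffine.Nonsingular x y}
    {h' : (shortW s t).toAffine.Nonsingular a b} (hax : a ≠ x) :
    xCoord (Point.some a b h' - Point.some x y h) = ((b + y) / (a - x)) ^ 2 - a - x := by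
  rw [sub_eq_add_neg, Point.neg_some, xCoord_add_some hax, shortW_negY, sub_neg_eq_add]

/-- With the product formula below, x(A + P) and x(A - P) are the roots of a quadratic depending
only on x(A) and x(P); this lets the induction on multiples avoid y-coordinates. -/
lemma xCoord_add_add_xCoord_sub {A P : (shortW s t).toAffine.Point} (hA : A ≠ 0) (hP : P ≠ 0)
    (h : xCoord A ≠ xCoord P) :
    (xCoord (A + P) + xCoord (A - P)) * (xCoord A - xCoord P) ^ 2 =
      2 * ((xCoord P * xCoord A + s) * (xCoord P + xCoord A) + 2 * t) := by
  obtain ⟨b, hb, hA'⟩ := exists_eq_some_xCoord hA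
  obtain ⟨y, hy, hP'⟩ := exists_eq_some_xCoord hP
  have e1 := shortW_equation_iff.1 hb.1
  have e2 := shortW_equation_iff.1 hy.1
  have hne := sub_ne_zero.2 h
  generalize xCoord A = a at *
  generalize xCoord P = x at *
  rw [hA', hP', xCoord_add_some h, xCoord_sub_some h]
  field_simp
  linear_combination 2 * e1 + 2 * e2

lemma xCoord_add_mul_xCoord_sub {A P : (shortW s t).toAffine.Point} (hA : A ≠ 0) (hP : P ≠ 0)
    (h : xCoord A ≠ xCoord P) :
    xCoord (A + P) * xCoord (A - P) * (xCoord A - xCoord P) ^ 2 =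
      (xCoord P * xCoord A - s) ^ 2 - 4 * t * (xCoord P + xCoord A) := by
  obtain ⟨b, hb, hA'⟩ := exists_eq_some_xCoord hA
  obtain ⟨y, hy, hP'⟩ := exists_eq_some_xCoord hP
  have e1 := shortW_equation_iff.1 hb.1
  have e2 := shortW_equation_iff.1 hy.1
  have hne := sub_ne_zero.2 h
  generalize xCoord A = a at *
  generalize xCoord P = x at *
  rw [hA', hP', xCoord_add_some h, xCoord_sub_some h]
  have e3 : (((b - y) / (a - x)) ^ 2 - a - x) * (((b + y) / (a - x)) ^ 2 - a - x) * (a - x) ^ 2 =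
      ((b ^ 2 - y ^ 2) / (a - x)) ^ 2 - 2 * (a + x) * (b ^ 2 + y ^ 2) +
        (a + x) ^ 2 * (a - x) ^ 2 := by
    field_simp
    ring
  have e4 : (b ^ 2 - y ^ 2) / (a - x) = a ^ 2 + a * x + x ^ 2 + s := by
    rw [e1, e2]
    field_simp
    ring
  rw [e3, e4, e1, e2]
  ring

lemma xCoord_two_nsmul {x y : k} {h : (shortW s t).toAffine.Nonsingular x y} (hy : 2 * y ≠ 0) :
    (2 * y) ^ 2 * xCoord (2 • Point.some x y h) = x ^ 4 - 2 * s * x ^ 2 - 8 * t * x + s ^ 2 := by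
  have e := shortW_equation_iff.1 h.1
  have hne : y ≠ (shortW s t).toAffine.negY x y := by
    rw [shortW_negY]
    intro h0
    exact hy (by linear_combination h0)
  rw [two_nsmul, Point.add_self_of_Y_ne hne, xCoord_some,
    WeierstrassCurve.Affine.slope_of_Y_ne rfl hne, WeierstrassCurve.Affine.addX, shortW_negY]
  have hl : (3 * x ^ 2 + s) / (2 * y) * (2 * y) = 3 * x ^ 2 + s := div_mul_cancel₀ _ hy
  simp only [shortW_a₁, shortW_a₂, shortW_a₄, sub_neg_eq_add, ← two_mul, zero_mul, mul_zero,
    add_zero, sub_zero]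
  generalize (3 * x ^ 2 + s) / (2 * y) = l at hl ⊢
  linear_combination (l * (2 * y) + (3 * x ^ 2 + s)) * hl - 8 * x * e

lemma two_nsmul_eq_zero_iff {x y : k} {h : (shortW s t).toAffine.Nonsingular x y} :
    2 • Point.some x y h = 0 ↔ 2 * y = 0 := by
  constructor
  · intro h0
    by_contra hy
    have hne : y ≠ (shortW s t).toAffine.negY x y := by
      rw [shortW_negY]
      intro h0
      exact hy (by linear_combination h0)
    rw [two_nsmul, Point.add_self_of_Y_ne hne] at h0
    exact Point.some_ne_zero _ h0
  · intro hy
    rw [two_nsmul, Point.add_self_of_Y_eq]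
    rw [shortW_negY]
    linear_combination hy

end PointCoordinates

/-! ### Values of division polynomials at a point -/

section DivisionSequence

variable {R : Type*} [CommRing R] (s t x y : R)

/-- The values at a point `(x, y)` of the bivariate division polynomials of `y² = x³ + s x + t`. -/
noncomputable def divSeq (n : ℕ) : R := ((shortW s t).preΨ' n).eval x * if Even n then 2 * y else 1

variable {s t x y}

lemma eval_shortW_Ψ₂Sq (h : y ^ 2 = x ^ 3 + s * x + t) :
    (shortW s t).Ψ₂Sq.eval x = (2 * y) ^ 2 := by
  simp [WeierstrassCurve.Ψ₂Sq, WeierstrassCurve.b₂, WeierstrassCurve.b₄, WeierstrassCurve.b₆]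
  linear_combination -4 * h

lemma eval_shortW_Ψ₃ :
    (shortW s t).Ψ₃.eval x = 3 * x ^ 4 + 6 * s * x ^ 2 + 12 * t * x - s ^ 2 := by
  simp [WeierstrassCurve.Ψ₃, WeierstrassCurve.b₂, WeierstrassCurve.b₄, WeierstrassCurve.b₆,
    WeierstrassCurve.b₈]
  ring

lemma eval_shortW_preΨ₄ :
    (shortW s t).preΨ₄.eval x = 2 * x ^ 6 + 10 * s * x ^ 4 + 40 * t * x ^ 3
    - 10 * s ^ 2 * x ^ 2 - 8 * s * t * x - 2 * s ^ 3 - 16 * t ^ 2 := by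
  simp [WeierstrassCurve.preΨ₄, WeierstrassCurve.b₂, WeierstrassCurve.b₄, WeierstrassCurve.b₆,
    WeierstrassCurve.b₈]
  ring

lemma divSeq_sq (h : y ^ 2 = x ^ 3 + s * x + t) (n : ℕ) :
    divSeq s t x y n ^ 2 = ((shortW s t).ΨSq n).eval x := by
  rw [WeierstrassCurve.ΨSq_ofNat, divSeq]
  split_ifs <;> simp [eval_shortW_Ψ₂Sq h]
  ring

lemma eval_shortW_Φ (h : y ^ 2 = x ^ 3 + s * x + t) (n : ℕ) :
    ((shortW s t).Φ (n + 1 : ℕ)).eval x = x * divSeq s t x y (n + 1) ^ 2 -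
      divSeq s t x y (n + 2) * divSeq s t x y n := by
  rw [Nat.cast_add, Nat.cast_one, WeierstrassCurve.Φ_ofNat]
  simp only [divSeq]
  by_cases hn : Even n <;> simp [hn, Nat.even_add_one, eval_shortW_Ψ₂Sq h, parity_simps] <;> ring

lemma divSeq_add_mul_divSeq_sub (h : y ^ 2 = x ^ 3 + s * x + t) {m n : ℕ} (hnm : n ≤ m) :
    divSeq s t x y (m + n) * divSeq s t x y (m - n) =
      ((shortW s t).preΨ' (m + n) * (shortW s t).preΨ' (m - n) *
        if Even (m + n) then (shortW s t).Ψ₂Sq else 1).eval x := by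
  have : Even (m - n) ↔ Even (m + n) := by rw [Nat.even_sub hnm, Nat.even_add]
  simp only [divSeq, this]
  split_ifs <;> simp [eval_shortW_Ψ₂Sq h]
  ring

lemma divSeq_odd (h : y ^ 2 = x ^ 3 + s * x + t) (j : ℕ) :
    divSeq s t x y (2 * j + 5) = divSeq s t x y (j + 4) * divSeq s t x y (j + 2) ^ 3 -
      divSeq s t x y (j + 1) * divSeq s t x y (j + 3) ^ 3 := by
  simp only [divSeq]
  rw [show 2 * j + 5 = 2 * (j + 2) + 1 by ring, WeierstrassCurve.preΨ'_odd]
  by_cases hj : Even j <;> simp [hj, eval_shortW_Ψ₂Sq h, parity_simps] <;> ring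

lemma divSeq_even (j : ℕ) :
    divSeq s t x y (2 * j + 6) * divSeq s t x y 2 =
      divSeq s t x y (j + 2) ^ 2 * divSeq s t x y (j + 3) * divSeq s t x y (j + 5)
      - divSeq s t x y (j + 1) * divSeq s t x y (j + 3) * divSeq s t x y (j + 4) ^ 2 := by
  simp only [divSeq]
  rw [show 2 * j + 6 = 2 * (j + 3) by ring, WeierstrassCurve.preΨ'_even]
  by_cases hj : Even j <;> simp [hj, parity_simps] <;> ring

lemma divSeq_zero : divSeq s t x y 0 = 0 := by simp [divSeq]

lemma divSeq_one : divSeq s t x y 1 = 1 := by simp [divSeq]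

lemma divSeq_two : divSeq s t x y 2 = 2 * y := by simp [divSeq]

lemma divSeq_three :
    divSeq s t x y 3 = 3 * x ^ 4 + 6 * s * x ^ 2 + 12 * t * x - s ^ 2 := by
  simp [divSeq, eval_shortW_Ψ₃, show ¬ Even 3 by decide]

lemma divSeq_four : divSeq s t x y 4 = 2 * y * (2 * x ^ 6 + 10 * s * x ^ 4 + 40 * t * x ^ 3
    - 10 * s ^ 2 * x ^ 2 - 8 * s * t * x - 2 * s ^ 3 - 16 * t ^ 2) := by
  simp [divSeq, eval_shortW_preΨ₄, show Even 4 by decide, mul_comm]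

end DivisionSequence

/-! ### Multiples of a point and vanishing of division polynomials -/

section Multiples

variable {k : Type*} [Field k] [DecidableEq k] {s t x y : k}
  {h : (shortW s t).toAffine.Nonsingular x y} {N : ℕ}

/-- If x(jP) = x(P) then (j - 1)P = 0 or (j + 1)P = 0, and both are excluded below N; this also
keeps the junk value of `xCoord` at infinity out of the relations. -/
lemma ellSeqData_of_nsmul_ne_zero (hN : ∀ j, 0 < j → j < N → j • Point.some x y h ≠ 0) :
    EllSeqData s t x y N (divSeq s t x y) (fun j ↦ xCoord (j • Point.some x y h)) := by
  have e := shortW_equation_iff.1 h.1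
  have hP : Point.some x y h ≠ 0 := Point.some_ne_zero h
  have hne : ∀ j, 2 ≤ j → j + 1 < N → xCoord (j • Point.some x y h) ≠ x := by
    intro j h1 h2 h3
    rcases eq_or_eq_neg_of_xCoord_eq (hN j (by omega) (by omega)) hP h3 with h4 | h4
    · apply hN (j - 1) (by omega) (by omega)
      obtain ⟨i, rfl⟩ : ∃ i, j = i + 1 := ⟨j - 1, by omega⟩
      rw [succ_nsmul, add_eq_right] at h4
      exact h4
    · apply hN (j + 1) (by omega) (by omega)
      rw [succ_nsmul, h4, neg_add_cancel]
  refine ⟨e, divSeq_one, divSeq_two, divSeq_three, divSeq_four, divSeq_odd e, divSeq_even,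
    by simp, fun h2 ↦ ?_, fun h2 h0 ↦ ?_, hne, fun j h1 h2 ↦ ?_, fun j h1 h2 ↦ ?_⟩
  · exact xCoord_two_nsmul fun h0 ↦ hN 2 (by omega) h2 (two_nsmul_eq_zero_iff.2 h0)
  · exact hN 2 (by omega) h2 (two_nsmul_eq_zero_iff.2 h0)
  · have := xCoord_add_add_xCoord_sub (hN j (by omega) (by omega)) hP (hne j h1 h2)
    obtain ⟨i, rfl⟩ : ∃ i, j = i + 1 := ⟨j - 1, by omega⟩
    rw [← succ_nsmul, succ_nsmul _ i, add_sub_cancel_right, ← succ_nsmul] at this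
    exact this
  · have := xCoord_add_mul_xCoord_sub (hN j (by omega) (by omega)) hP (hne j h1 h2)
    obtain ⟨i, rfl⟩ : ∃ i, j = i + 1 := ⟨j - 1, by omega⟩
    rw [← succ_nsmul, succ_nsmul _ i, add_sub_cancel_right, ← succ_nsmul] at this
    exact this

lemma divSeq_ne_zero_of_nsmul_ne_zero (hN : ∀ j, 0 < j → j < N → j • Point.some x y h ≠ 0)
    {j : ℕ} (h0 : 0 < j) (hj : j < N) : divSeq s t x y j ≠ 0 :=
  ((ellSeqData_of_nsmul_ne_zero hN).rel_aux N le_rfl).1 j h0 hj.le hj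

lemma divSeq_rel_of_nsmul_ne_zero (hN : ∀ j, 0 < j → j < N → j • Point.some x y h ≠ 0)
    {m n : ℕ} (hn : 1 ≤ n) (hnm : n < m) (hmn : m + n ≤ N) :
    divSeq s t x y (m + n) * divSeq s t x y (m - n) =
      (xCoord (n • Point.some x y h) - xCoord (m • Point.some x y h)) * divSeq s t x y m ^ 2 *
        divSeq s t x y n ^ 2 :=
  ((ellSeqData_of_nsmul_ne_zero hN).rel_aux N le_rfl).2 m n hn hnm hmn

/-- From w(N) w(N-2) = (x(P) - x((N-1)P)) w(N-1)², vanishing of w(N) means (N-1)P = ±P, and the plus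
sign would give (N-2)P = 0. -/
lemma nsmul_eq_zero_iff_divSeq_eq_zero (h0 : 0 < N)
    (hN : ∀ j, 0 < j → j < N → j • Point.some x y h ≠ 0) :
    N • Point.some x y h = 0 ↔ divSeq s t x y N = 0 := by
  have hN' : N = 1 ∨ N = 2 ∨ ∃ M, N = M + 3 := by
    rcases N with _ | _ | _ | M
    · omega
    · simp
    · simp
    · exact .inr (.inr ⟨M, rfl⟩)
  rcases hN' with rfl | rfl | ⟨M, rfl⟩
  · simp [divSeq_one]
  · rw [two_nsmul_eq_zero_iff, divSeq_two]
  · have h1 := divSeq_rel_of_nsmul_ne_zero hN (m := M + 2) le_rfl (by omega) le_rfl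
    rw [show M + 2 + 1 = M + 3 by ring, show M + 2 - 1 = M + 1 by omega, divSeq_one, one_nsmul,
      one_pow, mul_one, xCoord_some] at h1
    have h2 := divSeq_ne_zero_of_nsmul_ne_zero hN (j := M + 2) (by omega) (by omega)
    have h3 := divSeq_ne_zero_of_nsmul_ne_zero hN (j := M + 1) (by omega) (by omega)
    have h4 : divSeq s t x y (M + 3) = 0 ↔ xCoord ((M + 2) • Point.some x y h) = x := by
      constructor
      · intro h5
        rw [h5, zero_mul] at h1
        rcases mul_eq_zero.1 h1.symm with h6 | h6
        · exact (sub_eq_zero.1 h6).symm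
        · exact absurd h6 (pow_ne_zero _ h2)
      · intro h5
        rw [h5, sub_self, zero_mul] at h1
        exact (mul_eq_zero.1 h1).resolve_right h3
    rw [h4]
    constructor
    · intro h5
      rw [succ_nsmul] at h5
      rw [eq_neg_of_add_eq_zero_left h5, xCoord_neg, xCoord_some]
    · intro h5
      rcases eq_or_eq_neg_of_xCoord_eq (hN (M + 2) (by omega) (by omega))
        (Point.some_ne_zero h) h5 with h6 | h6
      · rw [succ_nsmul, add_eq_right] at h6
        exact absurd h6 (hN (M + 1) (by omega) (by omega))
      · rw [succ_nsmul, h6, neg_add_cancel]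

lemma nsmul_ne_zero_of_divSeq_ne_zero (hN : ∀ j, 0 < j → j < N → divSeq s t x y j ≠ 0) :
    ∀ j, 0 < j → j < N → j • Point.some x y h ≠ 0 := by
  intro j
  induction j using Nat.strong_induction_on with
  | _ j ih =>
    intro h0 hj h1
    exact hN j h0 hj ((nsmul_eq_zero_iff_divSeq_eq_zero h0
      fun i hi hij ↦ ih i hij hi (by omega)).1 h1)

lemma xCoord_nsmul_mul_divSeq_sq (hN : ∀ j, 0 < j → j < N → j • Point.some x y h ≠ 0)
    {j : ℕ} (h0 : 0 < j) (hj : j < N) :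
    xCoord (j • Point.some x y h) * ((shortW s t).ΨSq j).eval x =
      ((shortW s t).Φ j).eval x := by
  have e := shortW_equation_iff.1 h.1
  obtain ⟨i, rfl⟩ : ∃ i, j = i + 1 := ⟨j - 1, by omega⟩
  rw [← divSeq_sq e, eval_shortW_Φ e]
  rcases Nat.eq_zero_or_pos i with rfl | hi
  · simp [divSeq_zero, divSeq_one]
  · have := divSeq_rel_of_nsmul_ne_zero hN (m := i + 1) le_rfl (by omega) (by omega)
    rw [show i + 1 + 1 = i + 2 by ring, show i + 1 - 1 = i by omega, divSeq_one, one_nsmul,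
      one_pow, mul_one, xCoord_some] at this
    linear_combination this

end Multiples

/-! ### Division polynomials of index up to p in characteristic p -/

section CharP

variable {k : Type*} [Field k] {p : ℕ} [CharP k p] {s t : k}

lemma shortW_ΨSq_ne_zero_of_lt {r : ℕ} (h0 : 0 < r) (hr : r < p) : (shortW s t).ΨSq r ≠ 0 := by
  apply WeierstrassCurve.ΨSq_ne_zero
  rw [Int.cast_natCast]
  exact natCast_ne_zero_of_lt (p := p) h0 hr

variable [IsAlgClosed k] (hp5 : 5 ≤ p) (hΔ : 4 * s ^ 3 + 27 * t ^ 2 ≠ 0)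
include hp5 hΔ

/-- The relation between division polynomials expressing the `x`-coordinates of the multiples of
a point. -/
lemma shortW_Φ_mul_ΨSq_sub {m n : ℕ} (hn : 1 ≤ n) (hnm : n < m) (hmn : m + n ≤ p) :
    (shortW s t).Φ n * (shortW s t).ΨSq m - (shortW s t).Φ m * (shortW s t).ΨSq n =
      (shortW s t).preΨ' (m + n) * (shortW s t).preΨ' (m - n) *
        if Even (m + n) then (shortW s t).Ψ₂Sq else 1 := by
  classical
  -- The identity is known at abscissae of points with no vanishing multiple of index below p.
  -- Multiplying by this nonzero product makes it hold at every x of the infinite field.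
  have hprod : ∏ r ∈ Finset.Ioo 0 p, (shortW s t).ΨSq r ≠ 0 := by
    rw [Finset.prod_ne_zero_iff]
    intro r hr
    rw [Finset.mem_Ioo] at hr
    exact shortW_ΨSq_ne_zero_of_lt (p := p) hr.1 hr.2
  rw [← sub_eq_zero]
  apply (mul_eq_zero.1 (?_ : _ * ∏ r ∈ Finset.Ioo 0 p, (shortW s t).ΨSq r = 0)).resolve_right hprod
  apply Polynomial.funext
  intro x
  rw [eval_mul, eval_zero]
  by_cases hx : (∏ r ∈ Finset.Ioo 0 p, (shortW s t).ΨSq r).eval x = 0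
  · rw [hx, mul_zero]
  · obtain ⟨y, hy⟩ := IsAlgClosed.exists_pow_nat_eq (x ^ 3 + s * x + t) two_pos
    have hns := shortW_nonsingular (two_ne_zero_of_five_le hp5) hΔ hy
    have hN : ∀ j, 0 < j → j < p → j • Point.some x y hns ≠ 0 := by
      refine nsmul_ne_zero_of_divSeq_ne_zero fun j h0 hj hw ↦ hx ?_
      rw [eval_prod]
      refine Finset.prod_eq_zero (Finset.mem_Ioo.2 ⟨h0, hj⟩) ?_
      rw [← divSeq_sq hy, hw, zero_pow two_ne_zero]
    have h1 := divSeq_rel_of_nsmul_ne_zero hN hn hnm hmn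
    rw [divSeq_add_mul_divSeq_sub hy hnm.le, divSeq_sq hy, divSeq_sq hy] at h1
    have h2 := xCoord_nsmul_mul_divSeq_sq hN (j := m) (by omega) (by omega)
    have h3 := xCoord_nsmul_mul_divSeq_sq hN (j := n) (by omega) (by omega)
    rw [eval_sub, eval_sub, h1, eval_mul, eval_mul, ← h2, ← h3]
    ring

lemma divSeq_rel {x y : k} (hy : y ^ 2 = x ^ 3 + s * x + t) {m n : ℕ} (hnm : n < m)
    (hmn : m + 1 + (n + 1) ≤ p) :
    divSeq s t x y (m + 1 + (n + 1)) * divSeq s t x y (m - n) =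
      divSeq s t x y (m + 2) * divSeq s t x y m * divSeq s t x y (n + 1) ^ 2 -
      divSeq s t x y (n + 2) * divSeq s t x y n * divSeq s t x y (m + 1) ^ 2 := by
  have h1 := congrArg (eval x) (shortW_Φ_mul_ΨSq_sub hp5 hΔ (m := m + 1) (n := n + 1) (by omega)
    (by omega) hmn)
  rw [← divSeq_add_mul_divSeq_sub hy (by omega), eval_sub, eval_mul, eval_mul, eval_shortW_Φ hy,
    eval_shortW_Φ hy, ← divSeq_sq hy, ← divSeq_sq hy, Nat.add_sub_add_right] at h1
  rw [← h1]
  ring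

variable [DecidableEq k]

/-- As w(r) = 0, `divSeq_rel` makes w(j) times another term equal to ± w(r+1) w(r-1) w(j-r)², so
nonvanishing passes from j - r to j. The input is w(r+1) ≠ 0, where r = 2 uses nonsingularity and r
= 3 uses y ≠ 0. -/
lemma divSeq_ne_zero_of_not_dvd {x y : k} {h : (shortW s t).toAffine.Nonsingular x y} {r : ℕ}
    (hr2 : 2 ≤ r) (hrp : r < p) (hr : r • Point.some x y h = 0)
    (hmin : ∀ j, 0 < j → j < r → j • Point.some x y h ≠ 0) (j : ℕ) (hj : j ≤ p) (hrj : ¬ r ∣ j) :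
    divSeq s t x y j ≠ 0 := by
  have hy := shortW_equation_iff.1 h.1
  have hlt : ∀ j, 0 < j → j < r → divSeq s t x y j ≠ 0 := fun j h1 h2 ↦
    divSeq_ne_zero_of_nsmul_ne_zero hmin h1 h2
  have hwr : divSeq s t x y r = 0 := (nsmul_eq_zero_iff_divSeq_eq_zero (by omega) hmin).1 hr
  have h2 : (2 : k) ≠ 0 := two_ne_zero_of_five_le hp5
  have hsucc : divSeq s t x y (r + 1) ≠ 0 := by
    have hr' : r = 2 ∨ r = 3 ∨ ∃ q, r = q + 4 := by
      rcases r with _ | _ | _ | _ | q <;> simp at hr2 ⊢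
    rcases hr' with rfl | rfl | ⟨q, rfl⟩
    · rw [divSeq_two] at hwr
      have hy0 : y = 0 := (mul_eq_zero.1 hwr).resolve_left h2
      rw [divSeq_three]
      have h3 : 3 * x ^ 2 + s ≠ 0 := by
        have := (WeierstrassCurve.Affine.nonsingular_iff ..).1 h
        simp only [shortW_a₁, shortW_a₂, shortW_a₃, shortW_a₄, hy0] at this
        rcases this.2 with h4 | h4
        · intro h5
          exact h4 (by linear_combination -h5)
        · simp at h4
      intro h0
      apply pow_ne_zero 2 h3
      rw [hy0] at hy
      linear_combination -h0 - 12 * x * hy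
    · rw [divSeq_four]
      have hy0 : y ≠ 0 := by
        have := hlt 2 (by omega) (by omega)
        rw [divSeq_two] at this
        exact right_ne_zero_of_mul this
      rw [divSeq_three] at hwr
      refine mul_ne_zero (mul_ne_zero h2 hy0) fun h0 ↦ ?_
      have : (2 * y) ^ 4 = 0 := by
        have e1 : y ^ 4 = (x ^ 3 + s * x + t) ^ 2 := by rw [← hy]; ring
        linear_combination 2 * (3 * x ^ 2 + s) * hwr - h0 + 16 * e1
      exact pow_ne_zero 4 (mul_ne_zero h2 hy0) this
    · have := divSeq_rel hp5 hΔ hy (m := q + 2) (n := 1) (by omega) (by omega)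
      rw [show q + 2 + 1 + (1 + 1) = q + 4 + 1 by ring, show q + 2 - 1 = q + 1 by omega,
        show q + 2 + 2 = q + 4 by ring, hwr, divSeq_one] at this
      intro h0
      rw [h0] at this
      refine mul_ne_zero (hlt 3 (by omega) (by omega))
        (pow_ne_zero 2 (hlt (q + 3) (by omega) (by omega))) ?_
      linear_combination this
  obtain ⟨q, rfl⟩ : ∃ q, r = q + 1 := ⟨r - 1, by omega⟩
  have hcent : divSeq s t x y (q + 2) * divSeq s t x y q ≠ 0 :=
    mul_ne_zero hsucc (hlt q (by omega) (by omega))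
  induction j using Nat.strong_induction_on with
  | _ j ih =>
    rcases Nat.lt_or_ge j (q + 1) with hjr | hjr
    · exact hlt j (Nat.pos_of_ne_zero fun h0 ↦ hrj (h0 ▸ dvd_zero _)) hjr
    · have hm0 : j - (q + 1) ≠ 0 := fun h0 ↦ hrj (by rw [show j = q + 1 by omega])
      obtain ⟨m, hm⟩ : ∃ m, j = m + 1 + (q + 1) := ⟨j - (q + 2), by omega⟩
      have hm1 : ¬ (q + 1) ∣ m + 1 := fun h0 ↦ hrj (hm ▸ h0.add (dvd_refl _))
      have hw := ih (m + 1) (by omega) (by omega) hm1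
      have hmq : m ≠ q := by rintro rfl; exact hm1 (dvd_refl _)
      intro h0
      rw [hm] at h0
      refine mul_ne_zero hcent (pow_ne_zero 2 hw) ?_
      rcases Nat.lt_or_gt_of_ne hmq with hlt' | hgt
      · have := divSeq_rel hp5 hΔ hy (m := q) (n := m) hlt' (by omega)
        rw [show q + 1 + (m + 1) = m + 1 + (q + 1) by ring, h0, hwr] at this
        linear_combination -this
      · have := divSeq_rel hp5 hΔ hy (m := m) (n := q) hgt (by omega)
        rw [h0, hwr] at this
        linear_combination this

/-- The new case is a point of order r < p: it is not killed by p, and the division polynomial does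
not vanish there because r does not divide p. -/
lemma char_nsmul_eq_zero_iff (hprime : p.Prime) {x y : k}
    {h : (shortW s t).toAffine.Nonsingular x y} :
    p • Point.some x y h = 0 ↔ ((shortW s t).preΨ' p).eval x = 0 := by
  have hodd : ¬ Even p := by
    rw [Nat.not_even_iff_odd]
    exact hprime.odd_of_ne_two (by omega)
  have hw : divSeq s t x y p = ((shortW s t).preΨ' p).eval x := by simp [divSeq, hodd]
  rw [← hw]
  by_cases hN : ∀ j, 0 < j → j < p → j • Point.some x y h ≠ 0
  · exact nsmul_eq_zero_iff_divSeq_eq_zero hprime.pos hN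
  · push Not at hN
    have hex : ∃ j, 0 < j ∧ j < p ∧ j • Point.some x y h = 0 := hN
    classical
    obtain ⟨r0, rp, hr⟩ := Nat.find_spec hex
    have hmin : ∀ j, 0 < j → j < Nat.find hex → j • Point.some x y h ≠ 0 := fun j h1 h2 h3 ↦
      Nat.find_min hex h2 ⟨h1, h2.trans rp, h3⟩
    have hr1 : Nat.find hex ≠ 1 := by
      intro h1
      rw [h1, one_nsmul] at hr
      exact Point.some_ne_zero h hr
    have hdvd : ¬ Nat.find hex ∣ p := fun h1 ↦ by
      rcases (Nat.dvd_prime hprime).1 h1 with h2 | h2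
      · exact hr1 h2
      · omega
    refine iff_of_false (fun h1 ↦ ?_)
      (divSeq_ne_zero_of_not_dvd hp5 hΔ (by omega) rp hr hmin p le_rfl hdvd)
    have hord := addOrderOf_eq_prime (hp := ⟨hprime⟩) h1 (Point.some_ne_zero h)
    have := addOrderOf_dvd_iff_nsmul_eq_zero.2 hr
    rw [hord] at this
    exact absurd (Nat.le_of_dvd r0 this) (by omega)

omit [DecidableEq k] in
-- A point of order two is not killed by the odd prime p, so the polynomial is nonzero at its
-- abscissa.
lemma shortW_preΨ'_char_ne_zero (hprime : p.Prime) : (shortW s t).preΨ' p ≠ 0 := by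
  classical
  intro h0
  have hdeg : (shortCubic s t).degree ≠ 0 := by
    rw [degree_eq_natDegree (monic_shortCubic s t).ne_zero, natDegree_shortCubic]
    norm_num
  obtain ⟨x, hx⟩ := IsAlgClosed.exists_root _ hdeg
  rw [IsRoot.def, eval_shortCubic] at hx
  have hns := shortW_nonsingular (y := 0) (two_ne_zero_of_five_le hp5) hΔ
    (by rw [hx, zero_pow two_ne_zero])
  have h1 : p • Point.some x 0 hns = 0 := by
    rw [char_nsmul_eq_zero_iff hp5 hΔ hprime, h0, eval_zero]
  have h2 : 2 • Point.some x 0 hns = 0 := by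
    rw [two_nsmul_eq_zero_iff, mul_zero]
  have h3 := addOrderOf_eq_prime (hp := ⟨hprime⟩) h1 (Point.some_ne_zero hns)
  have h4 := addOrderOf_dvd_iff_nsmul_eq_zero.2 h2
  rw [h3] at h4
  exact absurd (Nat.le_of_dvd two_pos h4) (by omega)

end CharP

/-! ### Independent p-torsion elements and p-divisible sequences -/

section GroupTheory

lemma mem_zmultiples_of_zsmul_mem {G : Type*} [AddCommGroup G] {p : ℕ} (hprime : p.Prime)
    {H : AddSubgroup G} {Q : G} (hQ : p • Q = 0) {d : ℤ} (hd : ¬ (p : ℤ) ∣ d) (h : d • Q ∈ H) :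
    Q ∈ H := by
  have hco : IsCoprime d (p : ℤ) :=
    ((Nat.prime_iff_prime_int.1 hprime).coprime_iff_not_dvd.2 hd).symm
  obtain ⟨a, b, hab⟩ := hco
  have : Q = a • (d • Q) := by
    have e : (a * d + b * p) • Q = Q := by rw [hab, one_zsmul]
    rw [add_zsmul, mul_zsmul, mul_zsmul, natCast_zsmul, hQ, zsmul_zero, add_zero] at e
    exact e.symm
  rw [this]
  exact H.zsmul_mem h a

lemma injective_nsmul_add_nsmul {G : Type*} [AddCommGroup G] {p : ℕ} (hprime : p.Prime) {P Q : G}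
    (hP : p • P = 0) (hP0 : P ≠ 0) (hQ : p • Q = 0) (hPQ : Q ∉ AddSubgroup.zmultiples P) :
    Function.Injective fun a : Fin p × Fin p ↦ a.1.1 • P + a.2.1 • Q := by
  have key : ∀ i j : Fin p, ((p : ℤ) ∣ (i.1 : ℤ) - j.1) → i = j := by
    intro i j hij
    have := Int.eq_zero_of_abs_lt_dvd hij (by rw [abs_lt]; omega)
    exact Fin.ext (by omega)
  rintro ⟨i, j⟩ ⟨i', j'⟩ h
  simp only at h
  have h1 : ((j.1 : ℤ) - j'.1) • Q = ((i'.1 : ℤ) - i.1) • P := by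
    simp only [sub_zsmul, natCast_zsmul]
    rw [← sub_eq_add_neg, ← sub_eq_add_neg, sub_eq_sub_iff_add_eq_add, add_comm, h, add_comm]
  have hj : j = j' := by
    apply key
    by_contra hd
    apply hPQ
    refine mem_zmultiples_of_zsmul_mem hprime hQ hd ?_
    rw [h1]
    exact AddSubgroup.zsmul_mem_zmultiples P _
  subst hj
  have hi : i' = i := by
    apply key
    by_contra hd
    rw [sub_self, zero_zsmul] at h1
    refine hP0 ((AddSubgroup.mem_bot).1 (mem_zmultiples_of_zsmul_mem hprime hP hd ?_))
    rw [← h1]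
    exact zero_mem _
  rw [hi]

/-- If the `p`-torsion of `G` is generated by `P 0`, and `P` is a `p`-divisible sequence, then the
`p ^ (n + 1)`-torsion is generated by `P n`. -/
lemma mem_zmultiples_of_pow_nsmul_eq_zero {G : Type*} [AddCommGroup G] {p : ℕ} {P : ℕ → G}
    (h0 : ∀ Q : G, p • Q = 0 → Q ∈ AddSubgroup.zmultiples (P 0))
    (hP : ∀ n, p • P (n + 1) = P n) (n : ℕ) (Q : G) (hQ : p ^ (n + 1) • Q = 0) :
    Q ∈ AddSubgroup.zmultiples (P n) := by
  have hmem : ∀ n, P 0 ∈ AddSubgroup.zmultiples (P n) := by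
    intro n
    induction n with
    | zero => exact AddSubgroup.mem_zmultiples _
    | succ n ih =>
      refine AddSubgroup.zmultiples_le_of_mem ?_ ih
      rw [← hP n]
      exact AddSubgroup.nsmul_mem_zmultiples _ _
  induction n generalizing Q with
  | zero => exact h0 Q (by simpa using hQ)
  | succ n ih =>
    have h1 := ih (p • Q) (by rw [← mul_nsmul', ← pow_succ]; exact hQ)
    obtain ⟨j, hj⟩ := AddSubgroup.mem_zmultiples_iff.1 h1
    have h2 : p • (Q - j • P (n + 1)) = 0 := by
      rw [nsmul_sub, ← hj, ← hP n, smul_comm, sub_self]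
    have h3 := AddSubgroup.zmultiples_le_of_mem (hmem (n + 1)) (h0 _ h2)
    have := add_mem h3 (AddSubgroup.zsmul_mem_zmultiples (P (n + 1)) j)
    rwa [sub_add_cancel] at this

end GroupTheory

/-! ### The p-torsion is cyclic -/

section Torsion

variable {k : Type*} [Field k] {p : ℕ} [CharP k p] {s t : k} [IsAlgClosed k] [DecidableEq k]

omit [IsAlgClosed k] [DecidableEq k] in
-- The coefficient of degree (p² - 1)/2 is p = 0.
lemma two_mul_natDegree_shortW_preΨ'_char_lt (hp5 : 5 ≤ p) (hprime : p.Prime)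
    (h0 : (shortW s t).preΨ' p ≠ 0) : 2 * ((shortW s t).preΨ' p).natDegree < p ^ 2 - 1 := by
  have hodd : ¬ Even p := by
    rw [Nat.not_even_iff_odd]
    exact hprime.odd_of_ne_two (by omega)
  have h1 := (shortW s t).natDegree_preΨ'_le p
  have h2 := (shortW s t).coeff_preΨ' p
  simp only [hodd, if_false, CharP.cast_eq_zero] at h1 h2
  have h3 : ((shortW s t).preΨ' p).natDegree ≠ (p ^ 2 - 1) / 2 := by
    intro h4
    rw [← h4, coeff_natDegree, leadingCoeff_eq_zero] at h2
    exact h0 h2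
  omega

/-- In characteristic `p`, the `p`-torsion of `y² = x³ + s x + t` is cyclic. -/
theorem mem_zmultiples_of_char_nsmul_eq_zero (hp5 : 5 ≤ p) (hprime : p.Prime)
    (hΔ : 4 * s ^ 3 + 27 * t ^ 2 ≠ 0) {P Q : (shortW s t).toAffine.Point} (hP0 : P ≠ 0)
    (hP : p • P = 0) (hQ : p • Q = 0) : Q ∈ AddSubgroup.zmultiples P := by
  by_contra hPQ
  -- Two independent p-torsion points would give p² - 1 nonzero ones; at most two share an abscissa,
  -- which is a root of a polynomial of degree below (p² - 1)/2.
  have hinj := injective_nsmul_add_nsmul hprime hP hP0 hQ hPQ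
  set φ := fun a : Fin p × Fin p ↦ a.1.1 • P + a.2.1 • Q with hφ
  have hne := shortW_preΨ'_char_ne_zero hp5 hΔ hprime
  set S := (Finset.univ.image φ).erase 0 with hS
  have hcard : p ^ 2 - 1 ≤ S.card := by
    have := Finset.pred_card_le_card_erase (s := Finset.univ.image φ) (a := 0)
    rwa [Finset.card_image_of_injective _ hinj, Finset.card_univ, Fintype.card_prod,
      Fintype.card_fin, ← sq] at this
  have hmaps : ∀ A ∈ S, xCoord A ∈ ((shortW s t).preΨ' p).roots.toFinset := by
    intro A hA
    rw [hS, Finset.mem_erase, Finset.mem_image] at hA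
    obtain ⟨hA0, a, -, rfl⟩ := hA
    obtain ⟨y, h, hA⟩ := exists_eq_some_xCoord hA0
    rw [Multiset.mem_toFinset, mem_roots hne, IsRoot.def,
      ← char_nsmul_eq_zero_iff hp5 hΔ hprime (h := h), ← hA]
    simp only [hφ]
    rw [nsmul_add, smul_comm p, smul_comm p, hP, hQ, nsmul_zero, nsmul_zero, add_zero]
  have h1 := Finset.card_le_mul_card_image_of_maps_to hmaps 2 fun b _ ↦ by
    rcases Finset.eq_empty_or_nonempty {A ∈ S | xCoord A = b} with h0 | ⟨A, hA⟩
    · rw [h0]; simp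
    · refine (Finset.card_le_card (t := {A, -A}) fun B hB ↦ ?_).trans Finset.card_le_two
      rw [Finset.mem_filter] at hA hB
      rw [Finset.mem_insert, Finset.mem_singleton]
      exact eq_or_eq_neg_of_xCoord_eq (Finset.ne_of_mem_erase hB.1) (Finset.ne_of_mem_erase hA.1)
        (hB.2.trans hA.2.symm)
  have h2 := Multiset.toFinset_card_le ((shortW s t).preΨ' p).roots
  have h3 := card_roots' ((shortW s t).preΨ' p)
  have h4 := two_mul_natDegree_shortW_preΨ'_char_lt hp5 hprime hne
  omega

end Torsion

/-! ### Fields of definition of multiples of points -/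

section Rationality

variable {k : Type*} [Field k] [DecidableEq k] {s t : k}

/-- The points of `y² = x³ + s x + t` over a field `k` which are rational over the subfield `M` on
the quadratic twist by `η`. -/
def twistedPoints (M : Subfield k) (hs : s ∈ M) {η : k} (h0 : η ≠ 0)
    (hη : η ^ 2 ∈ M) : AddSubgroup (shortW s t).toAffine.Point where
  carrier := {A | ∀ x y h, A = Point.some x y h → x ∈ M ∧ y / η ∈ M}
  zero_mem' := fun x y h h0 ↦ absurd h0.symm (Point.some_ne_zero h)
  neg_mem' := by
    rintro A hA x y h hx
    rw [neg_eq_iff_eq_neg, Point.neg_some] at hx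
    have := hA _ _ _ hx
    rw [shortW_negY, neg_div, neg_mem_iff] at this
    exact this
  add_mem' := by
    rintro (_ | ⟨x₁, y₁, h₁⟩) (_ | ⟨x₂, y₂, h₂⟩) hA hB
    · exact fun x y h h0 ↦ absurd h0.symm (Point.some_ne_zero h)
    · exact hB
    · exact hA
    · intro x y h hx
      obtain ⟨a1, b1⟩ := hA _ _ _ rfl
      obtain ⟨a2, b2⟩ := hB _ _ _ rfl
      have hxy : ¬ (x₁ = x₂ ∧ y₁ = (shortW s t).toAffine.negY x₂ y₂) := by
        rintro ⟨h1, h2⟩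
        rw [Point.add_of_Y_eq h1 h2] at hx
        exact Point.some_ne_zero h hx.symm
      rw [Point.add_some hxy, Point.some.injEq] at hx
      have hl : (shortW s t).toAffine.slope x₁ x₂ y₁ y₂ / η ∈ M := by
        simp only [WeierstrassCurve.Affine.slope, shortW_negY, shortW_a₁, shortW_a₂, shortW_a₄,
          mul_zero, zero_mul, add_zero, sub_zero]
        split_ifs
        · simp
        · have : (3 * x₁ ^ 2 + s) / (y₁ - -y₁) / η = (3 * x₁ ^ 2 + s) / (2 * (y₁ / η) * η ^ 2) := by
            rw [div_div]; congr 1; field_simp; ring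
          rw [this]
          exact div_mem (add_mem (mul_mem (ofNat_mem M 3) (pow_mem a1 2)) hs)
            (mul_mem (mul_mem (ofNat_mem M 2) b1) hη)
        · rw [div_right_comm, sub_div]
          exact div_mem (sub_mem b1 b2) (sub_mem a1 a2)
      generalize (shortW s t).toAffine.slope x₁ x₂ y₁ y₂ = l at hx hl
      have hX : (shortW s t).toAffine.addX x₁ x₂ l ∈ M := by
        have : (shortW s t).toAffine.addX x₁ x₂ l = (l / η) ^ 2 * η ^ 2 - x₁ - x₂ := by
          simp only [WeierstrassCurve.Affine.addX, shortW_a₁, shortW_a₂]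
          field_simp
          ring
        rw [this]
        exact sub_mem (sub_mem (mul_mem (pow_mem hl 2) hη) a1) a2
      rw [← hx.1, ← hx.2]
      refine ⟨hX, ?_⟩
      have : (shortW s t).toAffine.addY x₁ x₂ y₁ l / η =
          -(l / η * ((shortW s t).toAffine.addX x₁ x₂ l - x₁) + y₁ / η) := by
        rw [WeierstrassCurve.Affine.addY, shortW_negY, WeierstrassCurve.Affine.negAddY]
        field_simp
      rw [this]
      exact neg_mem (add_mem (mul_mem hl (sub_mem hX a1)) b1)

lemma mem_twistedPoints {M : Subfield k} {hs : s ∈ M} {η : k} {h0 : η ≠ 0}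
    {hη : η ^ 2 ∈ M} {x y : k} {h : (shortW s t).toAffine.Nonsingular x y} :
    Point.some x y h ∈ twistedPoints M hs h0 hη ↔ x ∈ M ∧ y / η ∈ M := by
  constructor
  · intro h1
    exact h1 _ _ _ rfl
  · rintro h1 x' y' h' h2
    rw [Point.some.injEq] at h2
    rw [← h2.1, ← h2.2]
    exact h1

/-- Coordinates of multiples of a rational point are rational. -/
lemma coordinates_mem_of_mem_zmultiples {M : Subfield k} (hs : s ∈ M) {x y x' y' : k}
    {h : (shortW s t).toAffine.Nonsingular x y} {h' : (shortW s t).toAffine.Nonsingular x' y'}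
    (hx : x ∈ M) (hy : y ∈ M) (hm : Point.some x' y' h' ∈ AddSubgroup.zmultiples (Point.some x y h)) :
    x' ∈ M ∧ y' ∈ M := by
  have h1 : Point.some x y h ∈ twistedPoints M hs one_ne_zero (by simp) :=
    mem_twistedPoints.2 ⟨hx, by simpa using hy⟩
  have h2 := AddSubgroup.zmultiples_le_of_mem h1 hm
  simpa using mem_twistedPoints.1 h2

/-- The `y`-coordinate of a point can be recovered from its `x`-coordinate and a multiple. -/
lemma y_mem_of_nsmul_eq {M : Subfield k} (hs : s ∈ M) (ht : t ∈ M) {x y x' y' : k}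
    {h : (shortW s t).toAffine.Nonsingular x y} {h' : (shortW s t).toAffine.Nonsingular x' y'}
    {n : ℕ} (hn : n • Point.some x' y' h' = Point.some x y h) (hy0 : y ≠ 0) (hy : y ∈ M)
    (hx' : x' ∈ M) : y' ∈ M := by
  rcases eq_or_ne y' 0 with rfl | hy'
  · exact zero_mem M
  · have hη : y' ^ 2 ∈ M := by
      rw [shortW_equation_iff.1 h'.1]
      exact add_mem (add_mem (pow_mem hx' 3) (mul_mem hs hx')) ht
    -- On the twist by y' itself the point becomes rational over M, hence so does its multiple (x,
    -- y); thus y/y' is in M.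
    have h1 : Point.some x' y' h' ∈ twistedPoints M hs hy' hη :=
      mem_twistedPoints.2 ⟨hx', by rw [div_self hy']; exact one_mem M⟩
    have h2 := nsmul_mem h1 n
    rw [hn] at h2
    have h3 := div_mem hy (mem_twistedPoints.1 h2).2
    rwa [div_div_cancel₀ hy0] at h3

end Rationality

/-! ### Valuations of polynomial values -/

section ValuationEval

variable {k Γ : Type*} [Field k] [LinearOrderedCommGroupWithZero Γ] {v : Valuation k Γ} {g : k[X]}
  {x : k} {d : ℕ}

lemma Valuation.map_eval_le_pow (hg : ∀ i, v (g.coeff i) ≤ 1) (hd : g.natDegree ≤ d)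
    (hx : 1 ≤ v x) : v (g.eval x) ≤ v x ^ d := by
  rw [eval_eq_sum_range' (Nat.lt_succ_of_le hd)]
  refine v.map_sum_le fun i hi ↦ ?_
  rw [Finset.mem_range] at hi
  rw [map_mul, map_pow]
  exact (mul_le_of_le_one_left' (hg i)).trans (pow_le_pow_right₀ hx (by omega))

lemma Valuation.map_eval_le_one (hg : ∀ i, v (g.coeff i) ≤ 1) (hx : v x ≤ 1) :
    v (g.eval x) ≤ 1 := by
  rw [eval_eq_sum_range]
  refine v.map_sum_le fun i _ ↦ ?_
  rw [map_mul, map_pow]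
  exact mul_le_one' (hg i) (pow_le_one' hx i)

lemma Valuation.map_eval_eq_pow (hg : ∀ i, v (g.coeff i) ≤ 1) (hd : g.natDegree ≤ d)
    (hc : v (g.coeff d) = 1) (hx : 1 < v x) : v (g.eval x) = v x ^ d := by
  rw [eval_eq_sum_range' (Nat.lt_succ_of_le hd), Finset.sum_range_succ]
  have h0 : v (g.coeff d * x ^ d) = v x ^ d := by rw [map_mul, map_pow, hc, one_mul]
  rw [← h0]
  apply v.map_add_eq_of_lt_right
  rw [h0]
  refine v.map_sum_lt (pow_ne_zero _ (zero_lt_one.trans hx).ne') fun i hi ↦ ?_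
  rw [Finset.mem_range] at hi
  rw [map_mul, map_pow]
  exact (mul_le_of_le_one_left' (hg i)).trans_lt (pow_lt_pow_right₀ hx hi)

/-- A polynomial all of whose roots have the same valuation `γ` has constant valuation on the open
ball of radius `γ`. -/
lemma Valuation.map_eval_eq_of_roots [IsAlgClosed k] {γ : Γ} (hroots : ∀ r ∈ g.roots, v r = γ)
    {z : k} (hx : v x < γ) (hz : v z < γ) : v (g.eval x) = v (g.eval z) := by
  have key : ∀ x, v x < γ → v (g.eval x) = v g.leadingCoeff * γ ^ g.roots.card := by
    intro x hx
    have h1 := (IsAlgClosed.splits g).eq_prod_roots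
    have h2 := congrArg (fun q ↦ v (eval x q)) h1
    simp only [eval_mul, eval_C, map_mul, eval_multiset_prod, Multiset.map_map,
      Function.comp_def, eval_sub, eval_X, map_multiset_prod] at h2
    rw [h2, Multiset.map_congr rfl (g := fun _ ↦ γ), Multiset.map_const', Multiset.prod_replicate]
    intro r hr
    rw [← hroots r hr]
    exact v.map_sub_eq_of_lt_right (by rwa [hroots r hr])
  rw [key x hx, key z hz]

/-- By Fermat's little theorem n is a root of unity. -/
lemma Valuation.map_natCast_eq_one {p : ℕ} [CharP k p] (hprime : p.Prime) {n : ℕ} (h0 : 0 < n)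
    (hn : n < p) : v (n : k) = 1 := by
  have : Fact p.Prime := ⟨hprime⟩
  have h1 : ((n : ZMod p)) ≠ 0 := natCast_ne_zero_of_lt (p := p) h0 hn
  have h2 : ((n : ZMod p)) ^ (p - 1) = 1 := ZMod.pow_card_sub_one_eq_one h1
  have h3 := congrArg (ZMod.castHom (dvd_refl p) k) h2
  rw [map_pow, map_natCast, map_one] at h3
  have h4 := congrArg v h3
  rw [map_pow, map_one] at h4
  exact (pow_eq_one_iff_of_nonneg zero_le (Nat.sub_pos_of_lt hprime.one_lt).ne').1 h4

end ValuationEval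

/-! ### Integrality of division polynomials -/

section Integrality

variable {R : Type*} [CommRing R] {s t : R} (S : Subring R) (hs : s ∈ S) (ht : t ∈ S)
include hs ht

lemma shortW_eq_map_subtype : shortW s t = (shortW (⟨s, hs⟩ : S) ⟨t, ht⟩).map S.subtype := by
  rw [shortW_map]; rfl

lemma coeff_ΨSq_mem (n : ℤ) (i : ℕ) : ((shortW s t).ΨSq n).coeff i ∈ S := by
  rw [shortW_eq_map_subtype S hs ht, WeierstrassCurve.map_ΨSq, coeff_map]
  exact Subtype.prop _

lemma coeff_Φ_mem (n : ℤ) (i : ℕ) : ((shortW s t).Φ n).coeff i ∈ S := by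
  rw [shortW_eq_map_subtype S hs ht, WeierstrassCurve.map_Φ, coeff_map]
  exact Subtype.prop _

lemma coeff_shortCubic_mem (i : ℕ) : (shortCubic s t).coeff i ∈ S := by
  have : shortCubic s t = (shortCubic (⟨s, hs⟩ : S) ⟨t, ht⟩).map S.subtype := by
    rw [shortCubic_map]; rfl
  rw [this, coeff_map]
  exact Subtype.prop _

end Integrality

/-! ### Division by p in the residue disc of the origin -/

section GoodReduction

variable {k Γ : Type*} [Field k] [LinearOrderedCommGroupWithZero Γ] {v : Valuation k Γ} {p : ℕ}
  [CharP k p] {s t : k} (hp5 : 5 ≤ p) (hprime : p.Prime) (hs : v s ≤ 1) (ht : v t ≤ 1)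
include hp5 hprime hs ht

omit hp5 hprime [CharP k p] in
lemma map_root_shortCubic_le_one {x : k} (hx : x ^ 3 + s * x + t = 0) : v x ≤ 1 := by
  by_contra! h1
  have h2 := Valuation.map_eval_eq_pow (d := 3) (coeff_shortCubic_mem v.integer hs ht)
    (natDegree_shortCubic s t).le (by rw [← natDegree_shortCubic s t, coeff_natDegree,
      (monic_shortCubic s t).leadingCoeff, map_one]) h1
  rw [eval_shortCubic, hx, map_zero] at h2
  exact pow_ne_zero _ (zero_lt_one.trans h1).ne' h2.symm

omit hp5 in
lemma map_eval_ΨSq_eq_pow {j : ℕ} (h0 : 0 < j) (hj : j < p) {x : k} (hx : 1 < v x) :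
    v (((shortW s t).ΨSq j).eval x) = v x ^ (j ^ 2 - 1) := by
  refine Valuation.map_eval_eq_pow (coeff_ΨSq_mem v.integer hs ht _) ?_ ?_ hx
  · simpa using (shortW s t).natDegree_ΨSq_le j
  · have := (shortW s t).coeff_ΨSq j
    rw [Int.natAbs_natCast] at this
    rw [this, Int.cast_natCast, map_pow, Valuation.map_natCast_eq_one hprime h0 hj, one_pow]

omit hp5 hprime in
lemma map_eval_Φ_eq_pow (j : ℕ) {x : k} (hx : 1 < v x) :
    v (((shortW s t).Φ j).eval x) = v x ^ (j ^ 2) := by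
  refine Valuation.map_eval_eq_pow (coeff_Φ_mem v.integer hs ht _) ?_ ?_ hx
  · simp
  · have := (shortW s t).leadingCoeff_Φ j
    rw [leadingCoeff, WeierstrassCurve.natDegree_Φ, Int.natAbs_natCast] at this
    rw [this, map_one]

variable [DecidableEq k]

omit hp5 in
lemma nsmul_ne_zero_of_one_lt {x y : k} {h : (shortW s t).toAffine.Nonsingular x y}
    (hx : 1 < v x) {j : ℕ} (h0 : 0 < j) (hj : j < p) : j • Point.some x y h ≠ 0 := by
  refine nsmul_ne_zero_of_divSeq_ne_zero (N := p) (fun i h0 hi hw ↦ ?_) j h0 hj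
  have h1 := map_eval_ΨSq_eq_pow hprime hs ht h0 hi hx
  rw [← divSeq_sq (shortW_equation_iff.1 h.1), hw, zero_pow two_ne_zero, map_zero] at h1
  exact pow_ne_zero _ (zero_lt_one.trans hx).ne' h1.symm

omit hp5 in
-- x(jP) = Φ_j / ΨSq_j, of degrees j² and j² - 1 with leading coefficients 1 and j², units as j < p;
-- for v(x) > 1 only the leading terms count.
lemma map_xCoord_nsmul {x y : k} {h : (shortW s t).toAffine.Nonsingular x y}
    (hx : 1 < v x) {j : ℕ} (h0 : 0 < j) (hj : j < p) :
    v (xCoord (j • Point.some x y h)) = v x := by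
  have h1 := congrArg v (xCoord_nsmul_mul_divSeq_sq (N := p)
    (fun i h0 hi ↦ nsmul_ne_zero_of_one_lt hprime hs ht hx h0 hi (h := h)) h0 hj)
  rw [map_mul, map_eval_ΨSq_eq_pow hprime hs ht h0 hj hx, map_eval_Φ_eq_pow hs ht j hx] at h1
  have h2 : 1 ≤ j ^ 2 := Nat.one_le_pow _ _ h0
  rw [← Nat.sub_add_cancel h2, pow_succ' (v x), Nat.add_sub_cancel] at h1
  exact mul_right_cancel₀ (pow_ne_zero _ (zero_lt_one.trans hx).ne') h1

omit hp5 hprime [DecidableEq k] [CharP k p] in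
/-- The division polynomials of odd index are units at the points of order two. -/
lemma map_divSeq_odd_eq_one (hΔ : v (4 * s ^ 3 + 27 * t ^ 2) = 1) {x : k}
    (hx : x ^ 3 + s * x + t = 0) (n : ℕ) : v (divSeq s t x 0 (2 * n + 1)) = 1 := by
  have hx1 := map_root_shortCubic_le_one hs ht hx
  have h3 : v (3 * x ^ 2 + s) = 1 := by
    -- At a root x of f, f'(x) = 3x² + s divides the discriminant, so it is a unit. Terms of even
    -- index vanish as y = 0, leaving one product in each recursion below.
    have e : 4 * s ^ 3 + 27 * t ^ 2 = (3 * x ^ 2 + s) * (9 * x ^ 4 + 15 * s * x ^ 2 + 4 * s ^ 2) := by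
      have : t = -(x ^ 3 + s * x) := by linear_combination hx
      rw [this]; ring
    have hint : ∀ a ∈ v.integer, v a ≤ 1 := fun a ha ↦ ha
    have hxm : x ∈ v.integer := hx1
    have hsm : s ∈ v.integer := hs
    have e1 : v (3 * x ^ 2 + s) ≤ 1 := hint _ <|
      add_mem (mul_mem (ofNat_mem _ 3) (pow_mem hxm 2)) hsm
    have e2 : v (9 * x ^ 4 + 15 * s * x ^ 2 + 4 * s ^ 2) ≤ 1 := hint _ <|
      add_mem (add_mem (mul_mem (ofNat_mem _ 9) (pow_mem hxm 4)) (mul_mem (mul_mem (ofNat_mem _ 15)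
        hsm) (pow_mem hxm 2))) (mul_mem (ofNat_mem _ 4) (pow_mem hsm 2))
    rw [e, map_mul] at hΔ
    refine le_antisymm e1 ?_
    rw [← hΔ]
    exact mul_le_of_le_one_right' e2
  have heq : (0 : k) ^ 2 = x ^ 3 + s * x + t := by rw [hx, zero_pow two_ne_zero]
  have heven : ∀ j, divSeq s t x 0 (2 * j) = 0 := fun j ↦ by simp [divSeq]
  induction n using Nat.strong_induction_on with
  | _ n ih =>
    rcases n with _ | _ | j
    · rw [show 2 * 0 + 1 = 1 by rfl, divSeq_one, map_one]
    · rw [show 2 * (0 + 1) + 1 = 3 by rfl, divSeq_three,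
        show 3 * x ^ 4 + 6 * s * x ^ 2 + 12 * t * x - s ^ 2 = -(3 * x ^ 2 + s) ^ 2 by
          linear_combination 12 * x * hx, Valuation.map_neg, map_pow, h3, one_pow]
    · rw [show 2 * (j + 1 + 1) + 1 = 2 * j + 5 by ring, divSeq_odd heq]
      rcases Nat.even_or_odd' j with ⟨i, rfl | rfl⟩
      · rw [show 2 * i + 4 = 2 * (i + 2) by ring, heven, zero_mul, zero_sub, Valuation.map_neg,
          map_mul, map_pow, ih i (by omega), show 2 * i + 3 = 2 * (i + 1) + 1 by ring,
          ih (i + 1) (by omega)]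
        simp
      · rw [show 2 * i + 1 + 1 = 2 * (i + 1) by ring, heven, zero_mul, sub_zero,
          map_mul, map_pow, show 2 * i + 1 + 4 = 2 * (i + 2) + 1 by ring, ih (i + 2) (by omega),
          show 2 * i + 1 + 2 = 2 * (i + 1) + 1 by ring, ih (i + 1) (by omega)]
        simp

variable [IsAlgClosed k] (hΔ : v (4 * s ^ 3 + 27 * t ^ 2) = 1) {x₁ y₁ : k}
  {h₁ : (shortW s t).toAffine.Nonsingular x₁ y₁} (hP₁ : p • Point.some x₁ y₁ h₁ = 0)
  (hx₁ : 1 < v x₁)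
include hΔ hP₁ hx₁

omit hp5 hprime hs ht hP₁ hx₁ [CharP k p] [DecidableEq k] [IsAlgClosed k] in
lemma disc_ne_zero_of_map_eq_one : 4 * s ^ 3 + 27 * t ^ 2 ≠ 0 := by
  intro h0
  rw [h0, map_zero] at hΔ
  exact zero_ne_one hΔ

/-- By cyclicity r is the abscissa of j(x₁, y₁) with 0 < j < p, and such multiples do not change the
valuation. -/
lemma map_root_preΨ' {r : k} (hr : ((shortW s t).preΨ' p).eval r = 0) : v r = v x₁ := by
  have hΔ0 := disc_ne_zero_of_map_eq_one hΔ
  obtain ⟨y, hy⟩ := IsAlgClosed.exists_pow_nat_eq (r ^ 3 + s * r + t) two_pos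
  have hns := shortW_nonsingular (two_ne_zero_of_five_le hp5) hΔ0 hy
  have h1 := (char_nsmul_eq_zero_iff hp5 hΔ0 hprime (h := hns)).2 hr
  have h2 := mem_zmultiples_of_char_nsmul_eq_zero hp5 hprime hΔ0 (Point.some_ne_zero h₁) hP₁ h1
  obtain ⟨z, hz⟩ := AddSubgroup.mem_zmultiples_iff.1 h2
  have hord := addOrderOf_eq_prime (hp := ⟨hprime⟩) hP₁ (Point.some_ne_zero h₁)
  have h3 : z % (p : ℤ) = ((z % (p : ℤ)).toNat : ℤ) :=
    (Int.toNat_of_nonneg (Int.emod_nonneg _ (by exact_mod_cast hprime.ne_zero))).symm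
  have h4 : z % (p : ℤ) < p := Int.emod_lt_of_pos _ (by exact_mod_cast hprime.pos)
  rw [← mod_addOrderOf_zsmul, hord, h3, natCast_zsmul] at hz
  have h5 : 0 < (z % (p : ℤ)).toNat := by
    rcases Nat.eq_zero_or_pos (z % (p : ℤ)).toNat with h0 | h0
    · rw [h0, zero_nsmul] at hz
      exact absurd hz.symm (Point.some_ne_zero hns)
    · exact h0
  have h6 := map_xCoord_nsmul hprime hs ht hx₁ (h := h₁) h5 (by omega)
  rw [hz, xCoord_some] at h6
  exact h6

/-- All roots have valuation v(x₁), so the value is constant on this disc; it is computed at a point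
of order two. -/
lemma map_eval_preΨ'_eq_one {x : k} (hx : v x < v x₁) :
    v (((shortW s t).preΨ' p).eval x) = 1 := by
  have hdeg : (shortCubic s t).degree ≠ 0 := by
    rw [degree_eq_natDegree (monic_shortCubic s t).ne_zero, natDegree_shortCubic]
    norm_num
  obtain ⟨x₀, hx₀⟩ := IsAlgClosed.exists_root _ hdeg
  rw [IsRoot.def, eval_shortCubic] at hx₀
  obtain ⟨m, hm⟩ := hprime.odd_of_ne_two (by omega)
  have hodd : ¬ Even p := by
    rw [Nat.not_even_iff_odd]
    exact ⟨m, hm⟩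
  have h1 := map_divSeq_odd_eq_one hs ht hΔ hx₀ m
  rw [← hm, divSeq, if_neg hodd, mul_one] at h1
  rw [← h1]
  have hroot : ∀ r ∈ ((shortW s t).preΨ' p).roots, v r = v x₁ := fun r hr ↦
    map_root_preΨ' hp5 hprime hs ht hΔ hP₁ hx₁ (isRoot_of_mem_roots hr)
  refine Valuation.map_eval_eq_of_roots hroot hx ?_
  exact (map_root_shortCubic_le_one hs ht hx₀).trans_lt hx₁

omit hP₁ hx₁ hs ht hΔ [DecidableEq k] [IsAlgClosed k] [LinearOrderedCommGroupWithZero Γ] hp5 in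
lemma natDegree_ΨSq_char_le : ((shortW s t).ΨSq p).natDegree ≤ p ^ 2 - 2 := by
  have h1 := (shortW s t).natDegree_ΨSq_le p
  have h2 := (shortW s t).coeff_ΨSq p
  rw [Int.natAbs_natCast] at h1 h2
  rw [Int.cast_natCast, CharP.cast_eq_zero k p, zero_pow two_ne_zero] at h2
  have h4 : 2 ^ 2 ≤ p ^ 2 := Nat.pow_le_pow_left hprime.two_le 2
  rcases h1.lt_or_eq with h3 | h3
  · omega
  · rw [← h3, coeff_natDegree, leadingCoeff_eq_zero] at h2
    rw [h2, natDegree_zero]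
    omega

omit hP₁ hx₁ hs ht hΔ [DecidableEq k] [IsAlgClosed k] [LinearOrderedCommGroupWithZero Γ] hp5 in
lemma natDegree_shortW_Φ_sub (x : k) :
    ((shortW s t).Φ p - C x * (shortW s t).ΨSq p).natDegree = p ^ 2 := by
  have hdΦ : ((shortW s t).Φ p).natDegree = p ^ 2 := by
    rw [WeierstrassCurve.natDegree_Φ, Int.natAbs_natCast]
  have hdΨ := natDegree_ΨSq_char_le hprime (s := s) (t := t)
  have h4 : 2 ^ 2 ≤ p ^ 2 := Nat.pow_le_pow_left hprime.two_le 2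
  rw [natDegree_sub_eq_left_of_natDegree_lt, hdΦ]
  rw [hdΦ]
  exact (natDegree_C_mul_le _ _).trans_lt (by omega)

omit hP₁ hx₁ hs ht hΔ [DecidableEq k] [IsAlgClosed k] [LinearOrderedCommGroupWithZero Γ] hp5 in
lemma monic_shortW_Φ_sub (x : k) : ((shortW s t).Φ p - C x * (shortW s t).ΨSq p).Monic := by
  have hdΨ := natDegree_ΨSq_char_le hprime (s := s) (t := t)
  have h4 : 2 ^ 2 ≤ p ^ 2 := Nat.pow_le_pow_left hprime.two_le 2
  have h1 := (shortW s t).leadingCoeff_Φ p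
  rw [leadingCoeff, WeierstrassCurve.natDegree_Φ, Int.natAbs_natCast] at h1
  rw [Monic, leadingCoeff, natDegree_shortW_Φ_sub hprime, coeff_sub, h1, coeff_C_mul,
    coeff_eq_zero_of_natDegree_lt (by omega), mul_zero, sub_zero]

/-- The points close to infinity with a given `p`-th multiple close to infinity. -/
theorem exists_nsmul_eq_of_eval_Φ_eq {x y : k} {h : (shortW s t).toAffine.Nonsingular x y}
    (hx : 1 < v x) (hxx₁ : v x ≤ v x₁) {x' : k}
    (hx' : ((shortW s t).Φ p).eval x' = x * ((shortW s t).ΨSq p).eval x') :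
    ∃ (y' : k) (h' : (shortW s t).toAffine.Nonsingular x' y'),
      p • Point.some x' y' h' = Point.some x y h ∧ 1 < v x' ∧ v x' ≤ v x₁ ∧
      v x' ^ p ^ 2 = v x := by
  have hΔ0 := disc_ne_zero_of_map_eq_one hΔ
  have hdΨ := natDegree_ΨSq_char_le hprime (s := s) (t := t)
  have h4 : 2 ^ 2 ≤ p ^ 2 := Nat.pow_le_pow_left hprime.two_le 2
  have hodd : ¬ Even p := by
    rw [Nat.not_even_iff_odd]
    exact hprime.odd_of_ne_two (by omega)
  have hΨ : (shortW s t).ΨSq p = (shortW s t).preΨ' p ^ 2 := by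
    rw [WeierstrassCurve.ΨSq_ofNat, if_neg hodd, mul_one]
  have hv := congrArg v hx'
  rw [map_mul] at hv
  -- For integral x' the polynomial ΨSq_p has value 1, so Φ_p(x') = x ΨSq_p(x') would not be
  -- integral.
  have h1 : 1 < v x' := by
    by_contra! h1
    have h2 := Valuation.map_eval_le_one (coeff_Φ_mem v.integer hs ht p) h1
    rw [hv, hΨ, eval_pow, map_pow, map_eval_preΨ'_eq_one hp5 hprime hs ht hΔ hP₁ hx₁
      (h1.trans_lt hx₁), one_pow, mul_one] at h2
    exact h2.not_gt hx
  have h1' := (zero_lt_one.trans h1).ne'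
  rw [map_eval_Φ_eq_pow hs ht p h1] at hv
  -- ΨSq_p has degree at most p² - 2, its coefficient p² being zero. Hence v(x')² ≤ v(x) ≤ v(x₁),
  -- which puts x' where ΨSq_p has value 1.
  have h2 : v x' < v x₁ := by
    have h3 := Valuation.map_eval_le_pow (coeff_ΨSq_mem v.integer hs ht p) hdΨ h1.le
    have h5 : v x' ^ 2 ≤ v x := by
      have : v x' ^ 2 * v x' ^ (p ^ 2 - 2) ≤ v x * v x' ^ (p ^ 2 - 2) := by
        rw [← pow_add, show 2 + (p ^ 2 - 2) = p ^ 2 by omega, hv]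
        exact mul_le_mul_right h3 _
      exact le_of_mul_le_mul_right this (pow_pos (zero_lt_one.trans h1) _)
    refine lt_of_lt_of_le ?_ (h5.trans hxx₁)
    rw [sq]
    exact lt_mul_of_one_lt_left (zero_lt_one.trans h1) h1
  have hu := map_eval_preΨ'_eq_one hp5 hprime hs ht hΔ hP₁ hx₁ h2
  have hvx : v x' ^ p ^ 2 = v x := by
    rw [hv, hΨ, eval_pow, map_pow, hu, one_pow, mul_one]
  obtain ⟨y', hy'⟩ := IsAlgClosed.exists_pow_nat_eq (x' ^ 3 + s * x' + t) two_pos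
  have hns := shortW_nonsingular (two_ne_zero_of_five_le hp5) hΔ0 hy'
  have hu0 : ((shortW s t).preΨ' p).eval x' ≠ 0 := by
    intro h0
    rw [h0, map_zero] at hu
    exact zero_ne_one hu
  have hne : ∀ j, 0 < j → j < p + 1 → j • Point.some x' y' hns ≠ 0 := by
    intro j h0 hj
    rcases Nat.lt_or_ge j p with hjp | hjp
    · exact nsmul_ne_zero_of_one_lt hprime hs ht h1 h0 hjp
    · obtain rfl : j = p := by omega
      rwa [Ne, char_nsmul_eq_zero_iff hp5 hΔ0 hprime]
  have h3 := xCoord_nsmul_mul_divSeq_sq hne hprime.pos (by omega)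
  rw [hx', hΨ, eval_pow] at h3
  have h5 := mul_right_cancel₀ (pow_ne_zero 2 hu0) h3
  rcases eq_or_eq_neg_of_xCoord_eq (B := Point.some x y h) (hne p hprime.pos (by omega))
    (Point.some_ne_zero h) h5 with h6 | h6
  · exact ⟨y', hns, h6, h1, h2.le, hvx⟩
  -- The abscissa fixes the p-th multiple only up to sign, corrected by changing the sign of y'.
  · refine ⟨-y', shortW_nonsingular (two_ne_zero_of_five_le hp5) hΔ0
      (by rw [neg_sq, hy']), ?_, h1, h2.le, hvx⟩
    have h7 : Point.some x' (-y') (shortW_nonsingular (two_ne_zero_of_five_le hp5) hΔ0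
      (by rw [neg_sq, hy'])) = -Point.some x' y' hns := by
      rw [Point.neg_some, Point.some.injEq, shortW_negY]
      exact ⟨rfl, rfl⟩
    rw [h7, smul_neg, h6, neg_neg]

/-- Division by `p` of a point close to infinity. -/
theorem exists_nsmul_eq_of_one_lt {x y : k} {h : (shortW s t).toAffine.Nonsingular x y}
    (hx : 1 < v x) (hxx₁ : v x ≤ v x₁) :
    ∃ (x' y' : k) (h' : (shortW s t).toAffine.Nonsingular x' y'),
      p • Point.some x' y' h' = Point.some x y h ∧ 1 < v x' ∧ v x' ≤ v x₁ ∧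
      v x' ^ p ^ 2 = v x ∧ ((shortW s t).Φ p).eval x' = x * ((shortW s t).ΨSq p).eval x' := by
  have hdeg : ((shortW s t).Φ p - C x * (shortW s t).ΨSq p).degree ≠ 0 := by
    intro h0
    have := natDegree_shortW_Φ_sub hprime (s := s) (t := t) x
    rw [natDegree_eq_zero_iff_degree_le_zero.2 h0.le] at this
    exact pow_ne_zero 2 hprime.ne_zero this.symm
  obtain ⟨x', hx'⟩ := IsAlgClosed.exists_root _ hdeg
  rw [IsRoot.def, eval_sub, eval_mul, eval_C, sub_eq_zero] at hx'
  obtain ⟨y', h', h1, h2, h3, h4⟩ :=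
    exists_nsmul_eq_of_eval_Φ_eq hp5 hprime hs ht hΔ hP₁ hx₁ hx hxx₁ hx' (h := h)
  exact ⟨x', y', h', h1, h2, h3, h4, hx'⟩

/-- The number of distinct `x`-coordinates of points with a given `p`-th multiple. -/
theorem card_roots_toFinset_Φ_sub {x y x' y' : k} {h : (shortW s t).toAffine.Nonsingular x y}
    {h' : (shortW s t).toAffine.Nonsingular x' y'} (hx : 1 < v x) (hxx₁ : v x ≤ v x₁)
    (hPQ : p • Point.some x' y' h' = Point.some x y h) :
    ((shortW s t).Φ p - C x * (shortW s t).ΨSq p).roots.toFinset.card = p := by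
  have hΔ0 := disc_ne_zero_of_map_eq_one hΔ
  have hne := (monic_shortW_Φ_sub hprime (s := s) (t := t) x).ne_zero
  set Q := Point.some x' y' h' with hQ
  set P₁ := Point.some x₁ y₁ h₁ with hP₁'
  have hord : addOrderOf P₁ = p := addOrderOf_eq_prime (hp := ⟨hprime⟩) hP₁ (Point.some_ne_zero h₁)
  have hmul : ∀ i : ℕ, p • (Q + i • P₁) = Point.some x y h := by
    intro i
    rw [smul_add, hPQ, smul_comm, hP₁, smul_zero, add_zero]
  have hA : ∀ A, p • A = Point.some x y h → ∀ j, 0 < j → j < p + 1 → j • A ≠ 0 := by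
    intro A hA j h0 hj h1
    rcases Nat.lt_or_ge j p with hjp | hjp
    · apply nsmul_ne_zero_of_one_lt hprime hs ht hx (h := h) h0 hjp
      rw [← hA, smul_comm, h1, smul_zero]
    · obtain rfl : j = p := by omega
      rw [hA] at h1
      exact Point.some_ne_zero h h1
  -- The p-th parts of (x, y) form the coset Q + ⟨P₁⟩. Their abscissae are distinct: a coincidence Q
  -- + iP₁ = -(Q + jP₁) would give 2(x, y) = 0 after multiplication by p.
  have himage : ((shortW s t).Φ p - C x * (shortW s t).ΨSq p).roots.toFinset =
      (Finset.range p).image fun i ↦ xCoord (Q + i • P₁) := by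
    ext r
    rw [Multiset.mem_toFinset, mem_roots hne, IsRoot.def, eval_sub, eval_mul, eval_C, sub_eq_zero,
      Finset.mem_image]
    constructor
    · intro hr
      obtain ⟨z, hz, h1, -⟩ :=
        exists_nsmul_eq_of_eval_Φ_eq hp5 hprime hs ht hΔ hP₁ hx₁ hx hxx₁ hr (h := h)
      have h2 : p • (Point.some r z hz - Q) = 0 := by rw [smul_sub, h1, hPQ, sub_self]
      have h3 := mem_zmultiples_of_char_nsmul_eq_zero hp5 hprime hΔ0 (Point.some_ne_zero h₁) hP₁ h2
      obtain ⟨j, hj⟩ := AddSubgroup.mem_zmultiples_iff.1 h3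
      have h4 : j % (p : ℤ) = ((j % (p : ℤ)).toNat : ℤ) :=
        (Int.toNat_of_nonneg (Int.emod_nonneg _ (by exact_mod_cast hprime.ne_zero))).symm
      have h5 : j % (p : ℤ) < p := Int.emod_lt_of_pos _ (by exact_mod_cast hprime.pos)
      rw [← mod_addOrderOf_zsmul, ← hP₁', hord, h4, natCast_zsmul] at hj
      refine ⟨(j % (p : ℤ)).toNat, Finset.mem_range.2 (by omega), ?_⟩
      rw [hj, add_sub_cancel, xCoord_some]
    · rintro ⟨i, -, rfl⟩
      have hA0 : Q + i • P₁ ≠ 0 := by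
        have := hA _ (hmul i) 1 one_pos (by omega)
        rwa [one_nsmul] at this
      obtain ⟨z, hz, hB⟩ := exists_eq_some_xCoord hA0
      have h1 := hA _ (hmul i)
      have h2 := hmul i
      rw [hB] at h1 h2
      have h3 := xCoord_nsmul_mul_divSeq_sq h1 hprime.pos (by omega)
      rw [h2, xCoord_some] at h3
      exact h3.symm
  rw [himage, Finset.card_image_of_injOn, Finset.card_range]
  intro i hi j hj hij
  have hi' := hA _ (hmul i) 1 one_pos (by omega)
  have hj' := hA _ (hmul j) 1 one_pos (by omega)
  rw [one_nsmul] at hi' hj'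
  rw [Finset.coe_range, Set.mem_Iio] at hi hj
  rcases eq_or_eq_neg_of_xCoord_eq hi' hj' hij with h1 | h1
  · rw [add_right_inj] at h1
    exact nsmul_injOn_Iio_addOrderOf (by rwa [hord]) (by rwa [hord]) h1
  · exfalso
    have h2 := congrArg (p • ·) h1
    simp only [smul_neg, hmul] at h2
    refine nsmul_ne_zero_of_one_lt hprime hs ht hx (h := h) two_pos (by omega) ?_
    rw [two_nsmul]
    nth_rw 1 [h2]
    exact neg_add_cancel _

end GoodReduction

/-! ### The eigenfunction at a place of supersingular reduction -/

section Eigenfunction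

variable {k : Type*} [Field k] {p m : ℕ} [CharP k p] {s t : k}

lemma Subring.inv_natCast_mem (S : Subring k) (hprime : p.Prime) {n : ℕ} (h0 : 0 < n) (hn : n < p) :
    (n : k)⁻¹ ∈ S := by
  have : Fact p.Prime := ⟨hprime⟩
  have h1 : ((n : ZMod p)) ≠ 0 := natCast_ne_zero_of_lt (p := p) h0 hn
  have h2 : ((n : ZMod p)) ^ (p - 1) = 1 := ZMod.pow_card_sub_one_eq_one h1
  have h3 := congrArg (ZMod.castHom (dvd_refl p) k) h2
  rw [map_pow, map_natCast, map_one] at h3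
  have h4 : (n : k) ^ (p - 2) * n = 1 := by
    rw [← pow_succ, show p - 2 + 1 = p - 1 by have := hprime.two_le; omega, h3]
  rw [← eq_inv_of_mul_eq_one_left h4]
  exact pow_mem (natCast_mem S n) _

/-- The eigenvalue equation gives each coefficient from the three above it, dividing only by
2(i+2)(2i+3), prime to p for i < m - 1. It serves both for valuation rings and for subfields. -/
lemma coeff_mem_of_evenOp_eigenvector (hp : p = 2 * m + 1) (hprime : p.Prime) (S : Subring k)
    (hs : s ∈ S) (ht : t ∈ S) {c : k} (hc : c ∈ S) {b : k[X]} (hbm : b.Monic)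
    (hbd : b.natDegree = m - 1) (hb : evenOp s t b = C c * b) (i : ℕ) : b.coeff i ∈ S := by
  suffices h : ∀ j i, m - 1 ≤ i + j → b.coeff i ∈ S from h (m - 1) i (by omega)
  intro j
  have base : ∀ i, m - 1 ≤ i → b.coeff i ∈ S := by
    intro i hi
    rcases hi.eq_or_lt with rfl | hi
    · rw [← hbd, coeff_natDegree, hbm.leadingCoeff]
      exact one_mem S
    · rw [coeff_eq_zero_of_natDegree_lt (by omega)]
      exact zero_mem S
  induction j with
  | zero => exact base
  | succ j ih =>
    intro i hi
    rcases Nat.lt_or_ge i (m - 1) with h1 | h1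
    · have e := congrArg (fun q ↦ q.coeff (i + 1)) hb
      simp only [coeff_evenOp, coeff_C_mul] at e
      have n1 := natCast_ne_zero_of_lt (k := k) (p := p) (i := 2 * (i + 2)) (by omega) (by omega)
      have n2 := natCast_ne_zero_of_lt (k := k) (p := p) (i := 2 * i + 3) (by omega) (by omega)
      have e' : b.coeff i = ((2 * i + 3 : ℕ) : k)⁻¹ * (((2 * (i + 2) : ℕ) : k)⁻¹ *
          (c * b.coeff (i + 1)) - s * ((2 * i + 5 : ℕ) : k) * b.coeff (i + 2) -
          2 * t * ((i + 3 : ℕ) : k) * b.coeff (i + 3)) := by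
        rw [← e, eq_inv_mul_iff_mul_eq₀ n2]
        push_cast at n1 ⊢
        rw [inv_mul_cancel_left₀ n1]
        ring
      rw [e']
      exact mul_mem (S.inv_natCast_mem hprime (by omega) (by omega)) <| sub_mem (sub_mem
        (mul_mem (S.inv_natCast_mem hprime (by omega) (by omega)) (mul_mem hc (ih _ (by omega))))
        (mul_mem (mul_mem hs (natCast_mem S _)) (ih _ (by omega))))
        (mul_mem (mul_mem (mul_mem (ofNat_mem S 2) ht) (natCast_mem S _)) (ih _ (by omega)))
    · exact base i h1

lemma exists_map_subtype_eq {R : Type*} [CommRing R] (S : Subring R) {b : R[X]}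
    (hb : ∀ i, b.coeff i ∈ S) : ∃ B : S[X], B.map S.subtype = b := by
  have : b ∈ lifts S.subtype := by
    rw [lifts_iff_coeff_lifts]
    intro i
    simpa using hb i
  exact (mem_lifts b).1 this

lemma eval_halfOp_mem (S : Subring k) (hs : s ∈ S) (ht : t ∈ S) {b : k[X]}
    (hb : ∀ i, b.coeff i ∈ S) {x : k} (hx : x ∈ S) :
    b.eval x ∈ S ∧ (halfOp s t b).eval x ∈ S := by
  obtain ⟨B, rfl⟩ := exists_map_subtype_eq S hb
  constructor
  · change (B.map S.subtype).eval (S.subtype ⟨x, hx⟩) ∈ S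
    rw [eval_map_apply]
    exact Subtype.prop _
  · have h1 : halfOp s t (B.map S.subtype) = (halfOp (⟨s, hs⟩ : S) ⟨t, ht⟩ B).map S.subtype :=
      (halfOp_map S.subtype ⟨s, hs⟩ ⟨t, ht⟩ B).symm
    rw [h1]
    change ((halfOp (⟨s, hs⟩ : S) ⟨t, ht⟩ B).map S.subtype).eval (S.subtype ⟨x, hx⟩) ∈ S
    rw [eval_map_apply]
    exact Subtype.prop _

variable {Γ : Type*} [LinearOrderedCommGroupWithZero Γ] {v : Valuation k Γ}

/-- At a place of good supersingular reduction, the eigenfunction reduces to a function whose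
image under `halfOp` is a nonzero constant. -/
lemma map_coeff_zero_halfOp_eq_one (hp : p = 2 * m + 1) (hp5 : 5 ≤ p) (hprime : p.Prime)
    (hs : v s ≤ 1) (ht : v t ≤ 1) (hΔ : v (4 * s ^ 3 + 27 * t ^ 2) = 1) {c : k} (hc : v c < 1)
    {b : k[X]} (hbm : b.Monic) (hbd : b.natDegree = m - 1) (hb : evenOp s t b = C c * b) :
    v ((halfOp s t b).coeff 0) = 1 := by
  set V := v.valuationSubring with hV
  let ι : V →+* k := V.subtype
  have hι : Function.Injective ι := Subtype.val_injective
  have hunit : ∀ a : V, IsUnit a ↔ v (ι a) = 1 := by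
    intro a
    constructor
    · rintro ⟨u, rfl⟩
      have h1 : v (ι u) ≤ 1 := u.1.2
      have h2 : v (ι ↑u⁻¹) ≤ 1 := (↑u⁻¹ : V).2
      have h3 : v (ι u) * v (ι ↑u⁻¹) = 1 := by
        rw [← map_mul, ← map_mul, Units.mul_inv, map_one, map_one]
      refine le_antisymm h1 ?_
      rw [← h3]
      exact mul_le_of_le_one_right' h2
    · intro h
      have h0 : ι a ≠ 0 := by
        intro h0
        rw [h0, map_zero] at h
        exact zero_ne_one h
      refine IsUnit.of_mul_eq_one ⟨(ι a)⁻¹, ?_⟩ (Subtype.ext (mul_inv_cancel₀ h0))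
      change v (ι a)⁻¹ ≤ 1
      rw [map_inv₀, h, inv_one]
  obtain ⟨B, hB⟩ := exists_map_subtype_eq V.toSubring
    (coeff_mem_of_evenOp_eigenvector hp hprime V.toSubring hs ht hc.le hbm hbd hb)
  change B.map ι = b at hB
  set s' : V := ⟨s, hs⟩ with hs'
  set t' : V := ⟨t, ht⟩ with ht'
  set c' : V := ⟨c, hc.le⟩ with hc'
  have hhalf : (halfOp s' t' B).map ι = halfOp s t b := by rw [halfOp_map, hB]; rfl
  have heven : evenOp s' t' B = C c' * B := by
    apply map_injective ι hι
    rw [Polynomial.map_mul, map_C, hB, show ι c' = c from rfl, ← hb, evenOp_apply, evenOp_apply,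
      Polynomial.map_mul, ← derivative_map, hhalf, Polynomial.map_ofNat]
  let res := IsLocalRing.residue V
  have hchar : CharP (IsLocalRing.ResidueField V) p := by
    rw [CharP.charP_iff_prime_eq_zero hprime]
    have : ((p : ℕ) : V) = 0 := by
      apply hι
      rw [map_natCast, CharP.cast_eq_zero, map_zero]
    rw [← map_natCast res, this, map_zero]
  have hΔ' : 4 * res s' ^ 3 + 27 * res t' ^ 2 ≠ 0 := by
    have h1 : IsUnit (4 * s' ^ 3 + 27 * t' ^ 2) := by
      rw [hunit, map_add, map_mul, map_mul, map_pow, map_pow, map_ofNat, map_ofNat]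
      exact hΔ
    have h2 := (h1.map res).ne_zero
    rwa [map_add, map_mul, map_mul, map_pow, map_pow, map_ofNat, map_ofNat] at h2
  have hBm : B.Monic := monic_of_injective hι (by rw [hB]; exact hbm)
  have hBd : B.natDegree = m - 1 := by rw [← hbd, ← hB, natDegree_map_eq_of_injective hι]
  have hB'm := hBm.map res
  have hB'd : (B.map res).natDegree = m - 1 := by rw [hBm.natDegree_map, hBd]
  have hc0 : res c' = 0 := by
    rw [IsLocalRing.residue_eq_zero_iff, IsLocalRing.mem_maximalIdeal, mem_nonunits_iff, hunit]
    exact hc.ne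
  have heven' : evenOp (res s') (res t') (B.map res) = 0 := by
    rw [evenOp_apply, ← halfOp_map, derivative_map, ← Polynomial.map_ofNat res,
      ← Polynomial.map_mul, ← evenOp_apply, heven, Polynomial.map_mul, map_C, hc0, C_0, zero_mul]
  rw [← hhalf, coeff_map, ← hunit]
  by_contra hnu
  have hr0 : res ((halfOp s' t' B).coeff 0) = 0 := by
    rwa [IsLocalRing.residue_eq_zero_iff, IsLocalRing.mem_maximalIdeal, mem_nonunits_iff]
  -- The reduced eigenvalue is 0, so the reduction of `halfOp` B has zero derivative and degree at
  -- most m < p. If its constant term were also zero, it would vanish and so would the monic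
  -- reduction of B.
  refine hB'm.ne_zero (eq_zero_of_halfOp_eq_zero hp hp5 hΔ' ?_ (by rw [hB'd]; omega))
  have hd := natDegree_halfOp_le (s := res s') (t := res t') hp hp5 hB'd.le
  ext i
  rw [coeff_zero]
  rcases Nat.eq_zero_or_pos i with rfl | hi
  · rw [← halfOp_map, coeff_map, hr0]
  · rcases Nat.lt_or_ge m i with hm | hm
    · exact coeff_eq_zero_of_natDegree_lt (by omega)
    · obtain ⟨j, rfl⟩ : ∃ j, i = j + 1 := ⟨i - 1, by omega⟩
      have e := congrArg (fun q ↦ q.coeff j) heven'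
      simp only [evenOp_apply, coeff_zero] at e
      rw [← map_ofNat C 2, coeff_C_mul, coeff_derivative] at e
      have n1 : ((j + 1 : ℕ) : IsLocalRing.ResidueField V) ≠ 0 :=
        natCast_ne_zero_of_lt (p := p) (by omega) (by omega)
      have n2 : (2 : IsLocalRing.ResidueField V) ≠ 0 := two_ne_zero_of_five_le hp5
      push_cast at n1
      exact (mul_eq_zero.1 ((mul_eq_zero.1 e).resolve_left n2)).resolve_right n1

/-- The `p`-torsion point of large absolute value at a zero of the Hasse invariant. -/
theorem exists_torsion_of_map_hasseCoeff_lt_one [IsAlgClosed k] [DecidableEq k]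
    (hp : p = 2 * m + 1) (hp5 : 5 ≤ p) (hprime : p.Prime)
    (hs : v s ≤ 1) (ht : v t ≤ 1) (hΔ : v (4 * s ^ 3 + 27 * t ^ 2) = 1)
    (hH0 : hasseCoeff m s t ≠ 0) (hH : v (hasseCoeff m s t) < 1) :
    ∃ (c x y : k) (h : (shortW s t).toAffine.Nonsingular x y),
      p • Point.some x y h = 0 ∧ 1 < v x ∧ v x ^ (p * m) * v (hasseCoeff m s t) = 1 ∧
      c ^ (p - 1) = -2 * hasseCoeff m s t *
        ∏ i ∈ Finset.range (m - 1), (2 * (i + 2) * (2 * i + 3) : k) ∧ c ≠ 0 ∧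
      ∀ M : Subfield k, s ∈ M → t ∈ M → c ∈ M → x ^ p ∈ M ∧ (x ∈ M → y ∈ M) := by
  obtain ⟨c2, b, hbm, hbd, hb⟩ := exists_evenOp_eigenvector hp hp5 s t
  obtain ⟨θ, hθ, -⟩ := exists_iterate_invDer_eq s t hp hp5 hprime
  have h1 := eigenvalue_pow_eq hp hp5 hθ hbm.ne_zero hbd.le hb
  rw [iterate_invDer_const_eq s t hp hp5 hθ] at h1
  have hm : m ≠ 0 := by omega
  have hvc : v c2 ^ m = v (hasseCoeff m s t) := by
    rw [← map_pow, h1, map_mul, map_mul, Valuation.map_neg, map_prod, Finset.prod_eq_one, mul_one,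
      show (2 : k) = ((2 : ℕ) : k) by norm_num, Valuation.map_natCast_eq_one hprime two_pos
        (by omega), one_mul]
    intro i hi
    rw [Finset.mem_range] at hi
    have e : (2 * (i + 2) * (2 * i + 3) : k) = ((2 * (i + 2) : ℕ) : k) * ((2 * i + 3 : ℕ) : k) := by
      push_cast; ring
    rw [e, map_mul, Valuation.map_natCast_eq_one hprime (by omega) (by omega),
      Valuation.map_natCast_eq_one hprime (by omega) (by omega), one_mul]
  have hc2 : v c2 < 1 := (pow_lt_one_iff_of_nonneg zero_le hm).1 (hvc ▸ hH)
  have hc20 : c2 ≠ 0 := by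
    rintro rfl
    rw [map_zero, zero_pow hm, eq_comm, v.zero_iff] at hvc
    exact hH0 hvc
  obtain ⟨c, hc⟩ := IsAlgClosed.exists_pow_nat_eq c2 two_pos
  have hc0 : c ≠ 0 := by
    rintro rfl
    exact hc20 (by rw [← hc, zero_pow two_ne_zero])
  have hh := map_coeff_zero_halfOp_eq_one hp hp5 hprime hs ht hΔ hc2 hbm hbd hb
  have hbint := coeff_mem_of_evenOp_eigenvector hp hprime v.integer hs ht hc2.le hbm hbd hb
  set u := (c⁻¹ * (halfOp s t b).coeff 0) ^ 2 - b.coeff 0 ^ 2 * t with hu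
  have hcu : c2 * u = (halfOp s t b).coeff 0 ^ 2 - c2 * (b.coeff 0 ^ 2 * t) := by
    rw [hu, ← hc]
    field_simp
  -- After multiplication by c2 = c², the pole term of u becomes a unit and the rest stays small, so
  -- v(u) is the inverse of v(c2). Since x^p = u and v(c2)^m = v(H), this fixes v(x).
  have hvu : v c2 * v u = 1 := by
    rw [← map_mul, hcu, Valuation.map_sub_eq_of_lt_left, map_pow, hh, one_pow]
    rw [map_pow, hh, one_pow, map_mul]
    have : v (b.coeff 0 ^ 2 * t) ≤ 1 := mul_mem (pow_mem (hbint 0) 2) ht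
    exact (mul_le_of_le_one_right' this).trans_lt hc2
  obtain ⟨x, hx⟩ := IsAlgClosed.exists_pow_nat_eq u hprime.pos
  have hvx : v x ^ (p * m) * v (hasseCoeff m s t) = 1 := by
    rw [pow_mul, ← map_pow, hx, ← hvc, ← mul_pow, mul_comm, hvu, one_pow]
  have hx1 : 1 < v x := by
    by_contra! h0
    exact ((mul_le_of_le_one_left' (pow_le_one' h0 (p * m))).trans_lt hH).ne hvx
  have hfx : x ^ 3 + s * x + t ≠ 0 := fun h0 ↦
    hx1.not_ge (map_root_shortCubic_le_one hs ht h0)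
  rw [← hc] at hb
  obtain ⟨y, h, hP, hbx, hy⟩ := exists_torsion_of_eigenfunction hp hp5 hprime
    (disc_ne_zero_of_map_eq_one hΔ) hc0 hbm hbd hb hx hfx
  refine ⟨c, x, y, h, hP, hx1, hvx, ?_, hc0, fun M hsM htM hcM ↦ ?_⟩
  · rw [show p - 1 = 2 * m by omega, pow_mul, hc, h1]
  · have hbM := coeff_mem_of_evenOp_eigenvector hp hprime M.toSubring hsM htM
      (pow_mem hcM 2) hbm hbd hb
    have h0 := eval_halfOp_mem M.toSubring hsM htM hbM (zero_mem _)
    rw [← coeff_zero_eq_eval_zero, ← coeff_zero_eq_eval_zero] at h0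
    refine ⟨?_, fun hxM ↦ ?_⟩
    · rw [hx, hu]
      exact sub_mem (pow_mem (mul_mem (inv_mem hcM) h0.2) 2) (mul_mem (pow_mem h0.1 2) htM)
    · have h2 := eval_halfOp_mem M.toSubring hsM htM hbM hxM
      rw [hy]
      exact div_mem (neg_mem (mul_mem (inv_mem hcM) h2.2)) h2.1

end Eigenfunction

/-! ### Derivatives of the Hasse invariant in s and t -/

section HasseDerivative

variable {A : Type*} [CommRing A]

/-- The derivative of a power of `x³ + s x + t` with respect to its coefficients. -/
lemma derivation_coeff_shortCubic_pow (D : Derivation ℤ A A) {s t a b : A} (hs : D s = a) (ht : D t = b)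
    (n i : ℕ) :
    D ((shortCubic s t ^ n).coeff i) =
      n * (shortCubic s t ^ (n - 1) * (C a * X + C b)).coeff i := by
  let : Differential A := ⟨D⟩
  have h1 : Differential.mapCoeffs (shortCubic s t) = C a * X + C b := by
    have hs : Differential.deriv s = a := hs
    have ht : Differential.deriv t = b := ht
    simp [shortCubic, Derivation.leibniz, Derivation.leibniz_pow, hs, ht]
  have h2 : D ((shortCubic s t ^ n).coeff i) =
      (Differential.mapCoeffs (shortCubic s t ^ n)).coeff i := rfl
  rw [h2, Derivation.leibniz_pow, h1, nsmul_eq_mul, smul_eq_mul, ← map_natCast C, coeff_C_mul]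

end HasseDerivative

/-! ### A simple prime factor of the Hasse invariant -/

section HassePrime

/-- With s ≠ 0 the cubic is nodal with double root -3t/(2s), so `hasseCoeff_nodal` applies. -/
lemma hasseCoeff_ne_zero_of_disc_eq_zero {k : Type*} [Field k] {p m : ℕ} [CharP k p]
    (hp : p = 2 * m + 1) (hp5 : 5 ≤ p) (hprime : p.Prime) {s t : k} (hs0 : s ≠ 0)
    (e : 4 * s ^ 3 + 27 * t ^ 2 = 0) : hasseCoeff m s t ≠ 0 := by
  have n2 : (2 : k) ≠ 0 := two_ne_zero_of_five_le hp5
  have n3 : (3 : k) ≠ 0 := three_ne_zero_of_five_le hp5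
  have ht0 : t ≠ 0 := by
    rintro rfl
    exact mul_ne_zero (pow_ne_zero 2 n2) (pow_ne_zero 3 hs0) (by linear_combination e)
  have h1 := hasseCoeff_nodal (k := k) hp hprime (-3 * t / (2 * s))
  have e1 : -3 * (-3 * t / (2 * s)) ^ 2 = s := by
    field_simp
    linear_combination -e
  have e2 : 2 * (-3 * t / (2 * s)) ^ 3 = t := by
    field_simp
    linear_combination -e
  rw [e1, e2] at h1
  rw [h1]
  exact pow_ne_zero m
    (mul_ne_zero n3 (div_ne_zero (mul_ne_zero (neg_ne_zero.2 n3) ht0) (mul_ne_zero n2 hs0)))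

variable (K : Type*) [Field K] {p m : ℕ} [CharP K p]

/-- The Hasse invariant of the generic curve `y² = x³ + s x + t`. -/
noncomputable def genericHasse (m : ℕ) : MvPolynomial (Fin 2) K :=
  hasseCoeff m (MvPolynomial.X 0) (MvPolynomial.X 1)

/-- The discriminant of the generic curve, up to a unit. -/
noncomputable def genericDisc : MvPolynomial (Fin 2) K :=
  4 * MvPolynomial.X 0 ^ 3 + 27 * MvPolynomial.X 1 ^ 2

lemma pderiv_one_genericHasse (m : ℕ) : MvPolynomial.pderiv 1 (genericHasse K m) =
    (m : MvPolynomial (Fin 2) K) * (shortCubic (MvPolynomial.X 0) (MvPolynomial.X 1) ^ (m - 1)).coeff (2 * m) := by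
  have := derivation_coeff_shortCubic_pow
    ((MvPolynomial.pderiv (R := K) (1 : Fin 2)).restrictScalars ℤ) (s := MvPolynomial.X 0)
    (t := MvPolynomial.X 1) (MvPolynomial.pderiv_X_of_ne (by decide)) (MvPolynomial.pderiv_X_self 1)
    m (2 * m)
  rwa [C_0, zero_mul, zero_add, C_1, mul_one] at this

lemma pderiv_zero_genericHasse {m : ℕ} (hm : 0 < m) : MvPolynomial.pderiv 0 (genericHasse K m) =
    (m : MvPolynomial (Fin 2) K) * (shortCubic (MvPolynomial.X 0) (MvPolynomial.X 1) ^ (m - 1)).coeff (2 * m - 1) := by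
  have := derivation_coeff_shortCubic_pow
    ((MvPolynomial.pderiv (R := K) (0 : Fin 2)).restrictScalars ℤ) (s := MvPolynomial.X 0)
    (t := MvPolynomial.X 1) (MvPolynomial.pderiv_X_self 0) (MvPolynomial.pderiv_X_of_ne (by decide))
    m (2 * m - 1 + 1)
  rwa [C_0, add_zero, C_1, one_mul, coeff_mul_X, show 2 * m - 1 + 1 = 2 * m by omega] at this

omit [CharP K p] in
/-- The generic Hasse invariant and its partial derivatives do not vanish simultaneously away from
the discriminant locus. -/
lemma genericHasse_simple (hp : p = 2 * m + 1) (hp5 : 5 ≤ p) {k : Type*} [Field k] [CharP k p]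
    (φ : MvPolynomial (Fin 2) K →+* k) (hΔ : φ (genericDisc K) ≠ 0) (h0 : φ (genericHasse K m) = 0)
    (h1 : ∀ i, φ (MvPolynomial.pderiv i (genericHasse K m)) = 0) : False := by
  have hm : (m : k) ≠ 0 := natCast_ne_zero_of_lt (p := p) (by omega) (by omega)
  have e1 := h1 1
  have e2 := h1 0
  rw [pderiv_one_genericHasse, map_mul, map_natCast, ← coeff_map, Polynomial.map_pow,
    shortCubic_map] at e1
  rw [pderiv_zero_genericHasse K (by omega), map_mul, map_natCast, ← coeff_map, Polynomial.map_pow,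
    shortCubic_map] at e2
  rw [genericHasse, hasseCoeff_map] at h0
  refine hasseCoeff_simple hp hp5 ?_ h0 ((mul_eq_zero.1 e1).resolve_left hm)
    ((mul_eq_zero.1 e2).resolve_left hm)
  rwa [genericDisc, map_add, map_mul, map_mul, map_pow, map_pow, map_ofNat, map_ofNat] at hΔ

/-- The generic Hasse invariant has a simple prime factor, which does not divide the
discriminant. -/
theorem exists_prime_dvd_genericHasse (hp : p = 2 * m + 1) (hp5 : 5 ≤ p) (hprime : p.Prime) :
    genericHasse K m ≠ 0 ∧ ∃ π : MvPolynomial (Fin 2) K, Prime π ∧ π ∣ genericHasse K m ∧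
      ¬ π ^ 2 ∣ genericHasse K m ∧ ¬ π ∣ genericDisc K := by
  have hΔ0 : genericDisc K ≠ 0 := by
    intro h0
    have := congrArg (MvPolynomial.eval ![1, 0]) h0
    simp [genericDisc] at this
    have h2 : (2 : K) ≠ 0 := two_ne_zero_of_five_le hp5
    exact pow_ne_zero 2 h2 (by linear_combination this)
  have hH0 : genericHasse K m ≠ 0 := by
    intro h0
    -- If H were zero its partial derivatives would vanish too, against simplicity at the generic
    -- point.
    have : CharP (RatFunc₂ K) p := charP_of_injective_algebraMap
      (algebraMap K (RatFunc₂ K)).injective p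
    refine genericHasse_simple K hp hp5 (algebraMap _ (RatFunc₂ K)) ?_ (by rw [h0, map_zero])
      (fun i ↦ by rw [h0, map_zero, map_zero])
    rwa [Ne, FaithfulSMul.algebraMap_eq_zero_iff]
  refine ⟨hH0, ?_⟩
  have hnu : ¬ IsUnit (genericHasse K m) := by
    intro hu
    have h1 := hu.map (MvPolynomial.constantCoeff (σ := Fin 2) (R := K))
    rw [genericHasse, hasseCoeff_map, MvPolynomial.constantCoeff_X, MvPolynomial.constantCoeff_X,
      hasseCoeff] at h1
    have h2 : (shortCubic (0 : K) 0 ^ m).coeff (2 * m) = 0 := by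
      rw [shortCubic, C_0, zero_mul, add_zero, add_zero, ← pow_mul, coeff_X_pow,
        if_neg (by omega)]
    rw [h2] at h1
    exact not_isUnit_zero h1
  obtain ⟨π, hπ, hdvd⟩ := WfDvdMonoid.exists_irreducible_factor hnu hH0
  have hπp := hπ.prime
  let I : Ideal (MvPolynomial (Fin 2) K) := Ideal.span {π}
  have hI : I.IsPrime := (Ideal.span_singleton_prime hπp.ne_zero).2 hπp
  -- The residue field at π: vanishing in κ is divisibility by π.
  let κ := FractionRing (MvPolynomial (Fin 2) K ⧸ I)
  let φ : MvPolynomial (Fin 2) K →+* κ := (algebraMap _ κ).comp (Ideal.Quotient.mk I)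
  have hφ : ∀ a, φ a = 0 ↔ π ∣ a := by
    intro a
    rw [RingHom.comp_apply, FaithfulSMul.algebraMap_eq_zero_iff, Ideal.Quotient.eq_zero_iff_mem,
      Ideal.mem_span_singleton]
  have hchar : CharP κ p := by
    refine charP_of_injective_ringHom (f := φ.comp MvPolynomial.C) (RingHom.injective _) p
  have hφH := (hφ _).2 hdvd
  have hπΔ : ¬ π ∣ genericDisc K := by
    rw [← hφ]
    intro h0
    set s := φ (MvPolynomial.X 0) with hs
    set t := φ (MvPolynomial.X 1) with ht
    have e : 4 * s ^ 3 + 27 * t ^ 2 = 0 := by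
      rwa [genericDisc, map_add, map_mul, map_mul, map_pow, map_pow, map_ofNat, map_ofNat] at h0
    rw [genericHasse, hasseCoeff_map] at hφH
    have n3 : (3 : κ) ≠ 0 := three_ne_zero_of_five_le hp5
    -- A common factor of H and the discriminant must have s = 0, hence t = 0 in κ, and then π would
    -- divide both variables.
    by_cases hs0 : s = 0
    · have ht0 : t = 0 := by
        rw [hs0] at e
        have : (27 : κ) ≠ 0 := by
          have := pow_ne_zero 3 n3
          norm_num at this
          exact this
        simpa [this] using e
      have d0 := (hφ _).1 hs0
      have d1 := (hφ _).1 ht0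
      have h1 : Irreducible (MvPolynomial.X 0 : MvPolynomial (Fin 2) K) :=
        MvPolynomial.irreducible_of_totalDegree_eq_one (by simp) (by
          intro a ha
          have := ha (Finsupp.single 0 1)
          simpa using this)
      have h2 := (hπ.dvd_symm h1 d0).trans d1
      rw [MvPolynomial.X_dvd_X] at h2
      exact absurd h2 (by decide)
    · exact hasseCoeff_ne_zero_of_disc_eq_zero hp hp5 hprime hs0 e hφH
  refine ⟨π, hπp, hdvd, fun h2 ↦ ?_, hπΔ⟩
  -- If π² divided H, then H and both partial derivatives would vanish in κ.
  refine genericHasse_simple K hp hp5 φ (by rwa [Ne, hφ]) hφH fun i ↦ ?_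
  obtain ⟨a, ha⟩ := h2
  rw [ha, MvPolynomial.pderiv_mul, MvPolynomial.pderiv_pow, hφ]
  refine dvd_add ?_ ?_
  · exact ⟨2 * MvPolynomial.pderiv i π * a, by ring⟩
  · exact ⟨π * MvPolynomial.pderiv i a, by ring⟩

end HassePrime

/-! ### Places above a prime element -/

section Place

variable {R L : Type*} [CommRing R] [Field L] [Algebra R L] [FaithfulSMul R L]

/-- A prime element of a domain gives rise to a place of every extension field. -/
theorem exists_valuationSubring_of_prime {π : R} (hπ : Prime π) :
    ∃ V : ValuationSubring L, (∀ a, V.valuation (algebraMap R L a) ≤ 1) ∧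
      V.valuation (algebraMap R L π) < 1 ∧
      ∀ a, ¬ π ∣ a → V.valuation (algebraMap R L a) = 1 := by
  let P : Ideal R := Ideal.span {π}
  have hP : P.IsPrime := (Ideal.span_singleton_prime hπ.ne_zero).2 hπ
  have hmem : ∀ a, a ∈ P ↔ π ∣ a := fun a ↦ Ideal.mem_span_singleton
  have hunit : ∀ a : P.primeCompl, IsUnit (algebraMap R L a) := by
    rintro ⟨a, ha⟩
    rw [isUnit_iff_ne_zero, Ne, FaithfulSMul.algebraMap_eq_zero_iff]
    rintro rfl
    exact ha (zero_mem P)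
  let f : Localization.AtPrime P →+* L := IsLocalization.lift (M := P.primeCompl) hunit
  have hf : ∀ a, f (algebraMap R _ a) = algebraMap R L a := fun a ↦ IsLocalization.lift_eq hunit a
  -- A valuation ring of L dominating the local ring at (π); domination keeps π a nonunit.
  obtain ⟨V, hV, hloc⟩ := (LocalSubring.range f).exists_le_valuationSubring
  have hfV : ∀ z, f z ∈ V := fun z ↦ hV ⟨z, rfl⟩
  have hle : ∀ a, V.valuation (algebraMap R L a) ≤ 1 := by
    intro a
    rw [V.valuation_le_one_iff, ← hf]
    exact hfV _
  refine ⟨V, hle, lt_of_le_of_ne (hle π) fun h1 ↦ ?_, fun a ha ↦ ?_⟩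
  · have hπ0 : algebraMap R L π ≠ 0 := by
      rw [Ne, FaithfulSMul.algebraMap_eq_zero_iff]
      exact hπ.ne_zero
    have hinv : (algebraMap R L π)⁻¹ ∈ V := by
      rw [← V.valuation_le_one_iff, map_inv₀, h1, inv_one]
    let w : (LocalSubring.range f).toSubring := ⟨algebraMap R L π, algebraMap R _ π, hf π⟩
    have hw : IsUnit (Subring.inclusion hV w) :=
      IsUnit.of_mul_eq_one (⟨_, hinv⟩ : V.toSubring) (Subtype.ext (mul_inv_cancel₀ hπ0))
    obtain ⟨⟨-, z, rfl⟩, hz⟩ := (hloc.map_nonunit w hw).exists_right_inv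
    have hz' : algebraMap R L π * f z = 1 := congrArg Subtype.val hz
    obtain ⟨r, s, rfl⟩ := IsLocalization.exists_mk'_eq P.primeCompl z
    have h2 : algebraMap R L s * f (IsLocalization.mk' _ r s) = algebraMap R L r := by
      rw [← hf, ← hf, ← map_mul, IsLocalization.mk'_spec']
    apply s.2
    change (s : R) ∈ P
    rw [hmem]
    refine ⟨r, FaithfulSMul.algebraMap_injective R L ?_⟩
    rw [map_mul, ← h2]
    linear_combination -algebraMap R L s * hz'
  · have ha' : a ∈ P.primeCompl := fun h ↦ ha ((hmem a).1 h)
    refine le_antisymm (hle a) ?_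
    have h0 : algebraMap R L a ≠ 0 := (hunit ⟨a, ha'⟩).ne_zero
    have h1 : f (IsLocalization.mk' _ 1 ⟨a, ha'⟩) = (algebraMap R L a)⁻¹ := by
      refine eq_inv_of_mul_eq_one_left ?_
      rw [← hf, ← map_mul]
      have := IsLocalization.mk'_spec (Localization.AtPrime P) (1 : R) (⟨a, ha'⟩ : P.primeCompl)
      rw [this, map_one, map_one]
    have h2 := hfV (IsLocalization.mk' _ 1 ⟨a, ha'⟩)
    rw [h1, ← V.valuation_le_one_iff, map_inv₀] at h2
    have h3 : V.valuation (algebraMap R L a) ≠ 0 := (V.valuation.ne_zero_iff).2 h0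
    exact (inv_le_one₀ (zero_lt_iff.2 h3)).1 h2

variable [IsDomain R] [UniqueFactorizationMonoid R] {Γ : Type*} [LinearOrderedCommGroupWithZero Γ]
  {v : Valuation L Γ} {π : R}

/-- The values of a valuation which is trivial away from the prime `π`. -/
lemma exists_map_eq_zpow (hπ : Prime π)
    (h1 : ∀ a, ¬ π ∣ a → v (algebraMap R L a) = 1)
    {F : Type*} [Field F] [Algebra R F] [IsFractionRing R F] [Algebra F L] [IsScalarTower R F L]
    {a : F} (ha : a ≠ 0) : ∃ e : ℤ, v (algebraMap F L a) = v (algebraMap R L π) ^ e := by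
  have key : ∀ r : R, r ≠ 0 → ∃ e : ℕ, v (algebraMap R L r) = v (algebraMap R L π) ^ e := by
    intro r hr
    obtain ⟨c, hc, hd⟩ := (FiniteMultiplicity.of_prime_left hπ hr).exists_eq_pow_mul_and_not_dvd
    refine ⟨multiplicity π r, ?_⟩
    conv_lhs => rw [hc]
    rw [map_mul, map_pow, map_mul, map_pow, h1 c hd, mul_one]
  obtain ⟨r, s, hs, rfl⟩ := IsFractionRing.div_surjective (A := R) a
  have hs0 : s ≠ 0 := nonZeroDivisors.ne_zero hs
  have hr0 : r ≠ 0 := by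
    rintro rfl
    rw [map_zero, zero_div] at ha
    exact ha rfl
  obtain ⟨e, he⟩ := key r hr0
  obtain ⟨f, hf⟩ := key s hs0
  have hπ0 : v (algebraMap R L π) ≠ 0 := by
    rw [v.ne_zero_iff, Ne, FaithfulSMul.algebraMap_eq_zero_iff]
    exact hπ.ne_zero
  refine ⟨e - f, ?_⟩
  rw [map_div₀, map_div₀, ← IsScalarTower.algebraMap_apply, ← IsScalarTower.algebraMap_apply, he,
    hf, zpow_sub₀ hπ0, zpow_natCast, zpow_natCast]

end Place

/-! ### Ramification and degree -/

section DegreeBound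

/-- Ramification bounds the degree from below. -/
theorem le_finrank_of_map_pow_eq {F L Γ : Type*} [Field F] [Field L] [Algebra F L]
    [LinearOrderedCommGroupWithZero Γ] {v : Valuation L Γ} {γ : Γ} (hγ0 : γ ≠ 0) (hγ : γ < 1)
    (hv : ∀ a : F, a ≠ 0 → ∃ e : ℤ, v (algebraMap F L a) = γ ^ e) (E : IntermediateField F L)
    [FiniteDimensional F E] {z : L} (hz : z ∈ E) {N : ℕ} (hzN : v z ^ N = γ) :
    N ≤ Module.finrank F E := by
  by_contra! hlt
  have hdeg := minpoly.natDegree_le (A := F) (⟨z, hz⟩ : E)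
  have hmin : minpoly F (⟨z, hz⟩ : E) = minpoly F z :=
    minpoly.algebraMap_eq (algebraMap E L).injective (⟨z, hz⟩ : E) |>.symm
  rw [hmin] at hdeg
  have hint : IsIntegral F z := by
    have := (Algebra.IsIntegral.isIntegral (R := F) (⟨z, hz⟩ : E)).map E.val
    exact this
  have hne := minpoly.ne_zero hint
  have hsum := minpoly.aeval F z
  set g := minpoly F z with hg
  rw [aeval_eq_sum_range' (n := N) (by omega)] at hsum
  have hz0 : v z ≠ 0 := by
    intro h0
    rcases Nat.eq_zero_or_pos N with rfl | hN
    · omega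
    · rw [h0, zero_pow hN.ne'] at hzN
      exact hγ0 hzN.symm
  obtain ⟨j, hj, hmax⟩ := Finset.exists_max_image (Finset.range N)
    (fun i ↦ v (g.coeff i • z ^ i)) ⟨0, Finset.mem_range.2 (by omega)⟩
  -- The exponents differ modulo N for i < N, so nonzero terms of a polynomial of degree below N
  -- have distinct valuations and cannot cancel.
  have hterm : ∀ i, g.coeff i ≠ 0 → ∃ e : ℤ, v (g.coeff i • z ^ i) ^ N = γ ^ (e * N + i) := by
    intro i hi
    obtain ⟨e, he⟩ := hv _ hi
    refine ⟨e, ?_⟩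
    rw [Algebra.smul_def, map_mul, map_pow, he, mul_pow, ← pow_mul, mul_comm i, pow_mul, hzN,
      zpow_add₀ hγ0, zpow_mul, zpow_natCast, zpow_natCast]
  have hj0 : v (g.coeff j • z ^ j) ≠ 0 := by
    intro h0
    obtain ⟨i, hi⟩ : ∃ i, g.coeff i ≠ 0 :=
      ⟨g.natDegree, by rw [coeff_natDegree]; exact leadingCoeff_ne_zero.2 hne⟩
    have hiN : i ∈ Finset.range N := Finset.mem_range.2 <|
      (le_natDegree_of_ne_zero hi).trans_lt (by omega)
    have h1 := hmax i hiN
    rw [h0, le_zero_iff] at h1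
    obtain ⟨e, he⟩ := hterm i hi
    rw [h1, zero_pow (by omega)] at he
    exact zpow_ne_zero _ hγ0 he.symm
  have hjc : g.coeff j ≠ 0 := by
    intro h0
    rw [h0, zero_smul, map_zero] at hj0
    exact hj0 rfl
  have := v.map_sum_eq_of_lt hj (f := fun i ↦ g.coeff i • z ^ i) fun i hi ↦ by
    rw [Finset.mem_sdiff, Finset.mem_singleton] at hi
    refine lt_of_le_of_ne (hmax i hi.1) fun heq ↦ hi.2 ?_
    have hic : g.coeff i ≠ 0 := by
      intro h0
      rw [h0, zero_smul, map_zero] at heq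
      exact hj0 heq.symm
    obtain ⟨e, he⟩ := hterm i hic
    obtain ⟨f, hf⟩ := hterm j hjc
    rw [heq, hf] at he
    have h2 := zpow_right_injective₀ (zero_lt_iff.2 hγ0) hγ.ne he
    have hiN := Finset.mem_range.1 hi.1
    have hjN := Finset.mem_range.1 hj
    have h3 : (j : ℤ) % N = i % N := by
      have := congrArg (· % (N : ℤ)) h2
      simpa [Int.add_mul_emod_self_right, add_comm] using this
    rw [Int.emod_eq_of_lt (by omega) (by omega), Int.emod_eq_of_lt (by omega) (by omega)] at h3
    exact_mod_cast h3.symm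
  rw [hsum, map_zero] at this
  exact hj0 this.symm

end DegreeBound

/-! ### Separable and total degrees of simple extensions -/

section FieldDegrees

open IntermediateField

variable {F L : Type*} [Field F] [Field L] [Algebra F L]

lemma minpoly_natDegree_le_of_aeval_eq_zero {x : L} {g : F[X]} (hg : g ≠ 0) (h : aeval x g = 0) :
    (minpoly F x).natDegree ≤ g.natDegree :=
  natDegree_le_of_dvd (minpoly.dvd F x h) hg

lemma isSeparable_adjoin_root_of_pow_eq {n : ℕ} (hn : (n : F) ≠ 0) {θ : F} (hθ : θ ≠ 0) {c : L}
    (hc : c ^ n = algebraMap F L θ) :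
    FiniteDimensional F F⟮c⟯ ∧ Module.finrank F F⟮c⟯ ≤ n ∧ Algebra.IsSeparable F F⟮c⟯ := by
  have hn0 : n ≠ 0 := by rintro rfl; simp at hn
  have hg0 : (X ^ n - C θ : F[X]) ≠ 0 := X_pow_sub_C_ne_zero (by omega) θ
  have hgc : aeval c (X ^ n - C θ) = 0 := by simp [hc]
  have hci : IsIntegral F c := ⟨_, monic_X_pow_sub_C θ hn0, hgc⟩
  refine ⟨adjoin.finiteDimensional hci, ?_, ?_⟩
  · rw [adjoin.finrank hci]
    refine (minpoly_natDegree_le_of_aeval_eq_zero hg0 hgc).trans ?_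
    rw [natDegree_X_pow_sub_C]
  · rw [isSeparable_adjoin_simple_iff_isSeparable]
    exact (separable_X_pow_sub_C θ hn hθ).of_dvd (minpoly.dvd F c hgc)

lemma isPurelyInseparable_adjoin_root_of_pow_eq {p : ℕ} [CharP F p] (hprime : p.Prime) {θ : F}
    {x : L} (hx : x ^ p = algebraMap F L θ) :
    FiniteDimensional F F⟮x⟯ ∧ Module.finrank F F⟮x⟯ ≤ p ∧ IsPurelyInseparable F F⟮x⟯ := by
  have hg0 : (X ^ p - C θ : F[X]) ≠ 0 := X_pow_sub_C_ne_zero hprime.pos θ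
  have hgx : aeval x (X ^ p - C θ) = 0 := by simp [hx]
  have hxi : IsIntegral F x := ⟨_, monic_X_pow_sub_C θ hprime.ne_zero, hgx⟩
  refine ⟨adjoin.finiteDimensional hxi, ?_, ?_⟩
  · rw [adjoin.finrank hxi]
    refine (minpoly_natDegree_le_of_aeval_eq_zero hg0 hgx).trans ?_
    rw [natDegree_X_pow_sub_C]
  · have : ExpChar F p := .prime hprime
    rw [isPurelyInseparable_adjoin_simple_iff_pow_mem F L p]
    exact ⟨1, θ, by rw [pow_one, hx]⟩

/-- The degrees of a finite extension which is filled by a separable extension followed by a purely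
inseparable one. -/
lemma finrank_and_finSepDegree_of_le {A B C : Type*} [Field A] [Field B] [Field C] [Algebra A B]
    [Algebra B C] [Algebra A C] [IsScalarTower A B C] [FiniteDimensional A B]
    [FiniteDimensional B C] [Algebra.IsSeparable A B] [IsPurelyInseparable B C] {m n : ℕ}
    (hn0 : 0 < n) (hm : Module.finrank A B ≤ m) (hn : Module.finrank B C ≤ n)
    (hd : n * m ≤ Module.finrank A C) :
    Module.finrank A C = n * m ∧ Field.finSepDegree A C = m := by
  have hmul := Module.finrank_mul_finrank A B C
  have hprod : Module.finrank A C ≤ n * m := by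
    rw [← hmul, mul_comm n]
    exact Nat.mul_le_mul hm hn
  refine ⟨le_antisymm hprod hd, ?_⟩
  rw [← Field.finSepDegree_mul_finSepDegree_of_isAlgebraic A B C,
    IsPurelyInseparable.finSepDegree_eq_one B C, mul_one,
    Field.finSepDegree_eq_finrank_of_isSeparable A B]
  refine le_antisymm hm ?_
  rw [← hmul, mul_comm n] at hd
  exact Nat.le_of_mul_le_mul_right (hd.trans (Nat.mul_le_mul_left _ hn)) hn0

/-- The degrees of a field generated by a `(p - 1)`-st root and a `p`-th root. -/
theorem finrank_and_finSepDegree_of_pow_mem_adjoin {p : ℕ} [CharP F p] (hprime : p.Prime) {θ : F}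
    (hθ : θ ≠ 0) {c x : L} (hc : c ^ (p - 1) = algebraMap F L θ) (hx : x ^ p ∈ F⟮c⟯)
    {E : IntermediateField F L} (hE : E ≤ (F⟮c⟯⟮x⟯).restrictScalars F)
    (hd : FiniteDimensional F E → p * (p - 1) ≤ Module.finrank F E) :
    FiniteDimensional F E ∧ Module.finrank F E = p * (p - 1) ∧ Field.finSepDegree F E = p - 1 := by
  have hp2 := hprime.two_le
  obtain ⟨h1, h2, h3⟩ := isSeparable_adjoin_root_of_pow_eq
    (natCast_ne_zero_of_lt (p := p) (i := p - 1) (by omega) (by omega)) hθ hc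
  generalize F⟮c⟯ = M at *
  have : CharP M p := charP_of_injective_algebraMap (algebraMap F M).injective p
  obtain ⟨h4, h5, h6⟩ := isPurelyInseparable_adjoin_root_of_pow_eq (F := M) (x := x)
    (θ := ⟨x ^ p, hx⟩) hprime rfl
  generalize M⟮x⟯ = N at *
  have hfin : FiniteDimensional F N := FiniteDimensional.trans F M N
  have hfin' : FiniteDimensional F (N.restrictScalars F) := hfin
  have hEfin : FiniteDimensional F E :=
    FiniteDimensional.of_injective (inclusion hE).toLinearMap (inclusion hE).injective
  have hd := hd hEfin
  have hle : Module.finrank F E ≤ Module.finrank F N := finrank_le_of_le_right hE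
  obtain ⟨h7, h8⟩ := finrank_and_finSepDegree_of_le (A := F) (B := M) (C := N) hprime.pos h2 h5
    (hd.trans hle)
  have hEq : E = N.restrictScalars F := eq_of_le_of_finrank_le hE (by
    change Module.finrank F N ≤ _
    rwa [h7])
  refine ⟨hEfin, le_antisymm (hle.trans h7.le) hd, ?_⟩
  rw [hEq]
  exact h8

lemma minpoly_eq_of_natDegree_le_finrank {x : L} {g : F[X]} (hg : g.Monic) (hx : aeval x g = 0)
    (hd : g.natDegree ≤ Module.finrank F F⟮x⟯) : minpoly F x = g := by
  have hxi : IsIntegral F x := ⟨g, hg, hx⟩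
  rw [adjoin.finrank hxi] at hd
  exact eq_of_dvd_of_natDegree_le_of_leadingCoeff (minpoly.dvd F x hx) hd
    (by rw [(minpoly.monic hxi).leadingCoeff, hg.leadingCoeff])

/-- The degrees of a simple extension whose degree is the largest possible. -/
theorem finrank_and_finSepDegree_adjoin_root [IsAlgClosed L] [DecidableEq L]
    {E E' : IntermediateField F L} [FiniteDimensional F E] {x : L} (hE' : E' = (E⟮x⟯).restrictScalars F)
    {g : E[X]} (hg : g.Monic) (hx : aeval x g = 0)
    (hd : FiniteDimensional F E' → Module.finrank F E * g.natDegree ≤ Module.finrank F E') :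
    FiniteDimensional F E' ∧ Module.finrank F E' = Module.finrank F E * g.natDegree ∧
      Field.finSepDegree F E' =
        Field.finSepDegree F E * (g.map (algebraMap E L)).roots.toFinset.card := by
  subst hE'
  have hxi : IsIntegral E x := ⟨g, hg, hx⟩
  have h1 : FiniteDimensional E E⟮x⟯ := adjoin.finiteDimensional hxi
  have h2 := adjoin.finrank hxi
  have h3 := finSepDegree_adjoin_simple_eq_natSepDegree E L hxi.isAlgebraic
  have h4 := minpoly_eq_of_natDegree_le_finrank hg hx
  generalize E⟮x⟯ = N at *
  have hfin : FiniteDimensional F N := FiniteDimensional.trans F E N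
  have : Module.Free E N := Module.Free.of_divisionRing E N
  have hmul := Module.finrank_mul_finrank F E N
  have hd : Module.finrank F E * g.natDegree ≤ Module.finrank F N := hd hfin
  -- The lower bound on the degree forces g to be the minimal polynomial; its distinct roots then
  -- count the separable degree.
  have hmin := h4 (by
    rw [← hmul] at hd
    exact Nat.le_of_mul_le_mul_left hd Module.finrank_pos)
  refine ⟨hfin, ?_, ?_⟩
  · change Module.finrank F N = _
    rw [← hmul, h2, hmin]
  · change Field.finSepDegree F N = _
    rw [← Field.finSepDegree_mul_finSepDegree_of_isAlgebraic F E N, h3, hmin,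
      natSepDegree_eq_of_isAlgClosed L, aroots_def]

end FieldDegrees

/-! ### The tower of torsion fields at the chosen place -/

section TorsionTower

open IntermediateField

/-- The coordinates of the points killed by `N` on the curve `y² = x³ + s x + t`. -/
def torsionCoordinates {L : Type*} [Field L] [DecidableEq L] (s t : L) (N : ℕ) : Set L :=
  {z | ∃ (x y : L) (h : (shortW s t).toAffine.Nonsingular x y),
    N • Point.some x y h = 0 ∧ (z = x ∨ z = y)}

variable {L Γ : Type*} [Field L] [DecidableEq L] [LinearOrderedCommGroupWithZero Γ]
  {v : Valuation L Γ} {p m : ℕ} [CharP L p] {s t : L}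

/-- A sequence of points, each of which is a `p`-th part of the preceding one, which converges to
the boundary of the residue disc of the origin. -/
theorem exists_nsmul_sequence [IsAlgClosed L] (hp5 : 5 ≤ p) (hprime : p.Prime) (hs : v s ≤ 1)
    (ht : v t ≤ 1) (hΔ : v (4 * s ^ 3 + 27 * t ^ 2) = 1) {x₁ y₁ : L}
    {h₁ : (shortW s t).toAffine.Nonsingular x₁ y₁} (hP₁ : p • Point.some x₁ y₁ h₁ = 0)
    (hx₁ : 1 < v x₁) :
    ∃ (x y : ℕ → L) (h : ∀ n, (shortW s t).toAffine.Nonsingular (x n) (y n)),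
      x 0 = x₁ ∧ y 0 = y₁ ∧
      ∀ n, p • Point.some _ _ (h (n + 1)) = Point.some _ _ (h n) ∧ 1 < v (x n) ∧ v (x n) ≤ v x₁ ∧
        v (x (n + 1)) ^ p ^ 2 = v (x n) ∧
        ((shortW s t).Φ p).eval (x (n + 1)) = x n * ((shortW s t).ΨSq p).eval (x (n + 1)) := by
  let S := {q : L × L // (shortW s t).toAffine.Nonsingular q.1 q.2 ∧ 1 < v q.1 ∧ v q.1 ≤ v x₁}
  have key : ∀ q : S, ∃ q' : S, p • Point.some _ _ q'.2.1 = Point.some _ _ q.2.1 ∧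
      v q'.1.1 ^ p ^ 2 = v q.1.1 ∧
      ((shortW s t).Φ p).eval q'.1.1 = q.1.1 * ((shortW s t).ΨSq p).eval q'.1.1 := by
    rintro ⟨⟨x, y⟩, h, hx, hxx₁⟩
    obtain ⟨x', y', h', e1, e2, e3, e4, e5⟩ :=
      exists_nsmul_eq_of_one_lt hp5 hprime hs ht hΔ hP₁ hx₁ (h := h) hx hxx₁
    exact ⟨⟨(x', y'), h', e2, e3⟩, e1, e4, e5⟩
  choose f hf1 hf2 hf3 using key
  let q : ℕ → S := fun n ↦ f^[n] ⟨(x₁, y₁), h₁, hx₁, le_rfl⟩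
  have hq : ∀ n, q (n + 1) = f (q n) := fun n ↦ Function.iterate_succ_apply' f n _
  refine ⟨fun n ↦ (q n).1.1, fun n ↦ (q n).1.2, fun n ↦ (q n).2.1, rfl, rfl, fun n ↦ ?_⟩
  have h1 := hf1 (q n)
  have h2 := hf2 (q n)
  have h3 := hf3 (q n)
  rw [← hq] at h1 h2 h3
  exact ⟨h1, (q n).2.2.1, (q n).2.2.2, h2, h3⟩

lemma y_ne_zero_of_one_lt (hp5 : 5 ≤ p) (hprime : p.Prime) (hs : v s ≤ 1) (ht : v t ≤ 1) {x y : L}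
    (h : (shortW s t).toAffine.Nonsingular x y) (hx : 1 < v x) : y ≠ 0 := by
  rintro rfl
  exact nsmul_ne_zero_of_one_lt hprime hs ht hx two_pos (by omega)
    (two_nsmul_eq_zero_iff (h := h).2 (mul_zero 2))

omit [DecidableEq L] in
lemma map_y_sq (hs : v s ≤ 1) (ht : v t ≤ 1) {x y : L}
    (h : (shortW s t).toAffine.Nonsingular x y) (hx : 1 < v x) : v y ^ 2 = v x ^ 3 := by
  have h2 := Valuation.map_eval_eq_pow (d := 3) (coeff_shortCubic_mem v.integer hs ht)
    (natDegree_shortCubic s t).le (by rw [← natDegree_shortCubic s t, coeff_natDegree,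
      (monic_shortCubic s t).leadingCoeff, map_one]) hx
  rw [← h2, eval_shortCubic, ← shortW_equation_iff.1 h.1, map_pow]

omit [DecidableEq L] in
-- x/y is the local parameter at the origin: v(y)² = v(x)³ gives v(x/y)² = v(x)⁻¹. It halves the
-- exponent of x and thereby recovers the full ramification p - 1 = 2m.
lemma map_div_pow_mul (hs : v s ≤ 1) (ht : v t ≤ 1) {x y : L}
    (h : (shortW s t).toAffine.Nonsingular x y) (hx : 1 < v x) (N : ℕ) :
    v (x / y) ^ (2 * N) * v x ^ N = 1 := by
  have hx0 : v x ≠ 0 := (zero_lt_one.trans hx).ne'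
  rw [pow_mul, ← mul_pow, map_div₀, div_pow, map_y_sq hs ht h hx, div_mul_eq_mul_div, ← pow_succ,
    div_self (pow_ne_zero 3 hx0), one_pow]

variable {F : Type*} [Field F] [Algebra F L]

lemma adjoin_torsionCoordinates_eq {P : ℕ → L × L}
    {h : ∀ n, (shortW s t).toAffine.Nonsingular (P n).1 (P n).2}
    {s₀ : F} (hs₀ : algebraMap F L s₀ = s) [IsAlgClosed L] (hp5 : 5 ≤ p) (hprime : p.Prime)
    (hΔ : 4 * s ^ 3 + 27 * t ^ 2 ≠ 0)
    (h0 : p • Point.some _ _ (h 0) = 0)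
    (hP : ∀ n, p • Point.some _ _ (h (n + 1)) = Point.some _ _ (h n)) (n : ℕ) :
    adjoin F (torsionCoordinates s t (p ^ (n + 1))) = adjoin F {(P n).1, (P n).2} := by
  apply le_antisymm
  · rw [adjoin_le_iff]
    rintro z ⟨x, y, h', hN, hz⟩
    have h2 := mem_zmultiples_of_pow_nsmul_eq_zero (P := fun n ↦ Point.some _ _ (h n))
      (fun Q hQ ↦ mem_zmultiples_of_char_nsmul_eq_zero hp5 hprime hΔ (Point.some_ne_zero _) h0 hQ)
      hP n _ hN
    have h3 := coordinates_mem_of_mem_zmultiples (M := (adjoin F {(P n).1, (P n).2}).toSubfield)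
      (hs₀ ▸ (adjoin F {(P n).1, (P n).2}).algebraMap_mem s₀)
      (subset_adjoin F _ (by simp)) (subset_adjoin F _ (by simp)) h2
    rcases hz with rfl | rfl
    exacts [h3.1, h3.2]
  · have hN : ∀ n, p ^ (n + 1) • Point.some _ _ (h n) = 0 := by
      intro n
      induction n with
      | zero => rw [zero_add, pow_one, h0]
      | succ n ih => rw [pow_succ, mul_nsmul', hP, ih]
    rw [adjoin_le_iff, Set.insert_subset_iff, Set.singleton_subset_iff]
    exact ⟨subset_adjoin F _ ⟨_, _, h n, hN n, .inl rfl⟩,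
      subset_adjoin F _ ⟨_, _, h n, hN n, .inr rfl⟩⟩

/-- Only x' has to be adjoined: y' is recovered from x' and y by `y_mem_of_nsmul_eq`, while x and y
are rational in x' and y'. -/
lemma adjoin_coordinates_eq_restrictScalars {s₀ t₀ : F} (hs₀ : algebraMap F L s₀ = s)
    (ht₀ : algebraMap F L t₀ = t) {x y x' y' : L} {h : (shortW s t).toAffine.Nonsingular x y}
    {h' : (shortW s t).toAffine.Nonsingular x' y'} {n : ℕ}
    (hn : n • Point.some x' y' h' = Point.some x y h) (hy0 : y ≠ 0) :
    adjoin F {x', y'} = ((adjoin F {x, y})⟮x'⟯).restrictScalars F := by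
  set E := adjoin F {x, y} with hE
  apply le_antisymm
  · rw [adjoin_le_iff, Set.insert_subset_iff, Set.singleton_subset_iff]
    have hx' : x' ∈ E⟮x'⟯ := mem_adjoin_simple_self E x'
    have hy : y ∈ E⟮x'⟯ := (E⟮x'⟯).algebraMap_mem ⟨y, subset_adjoin F _ (by simp)⟩
    have hF : ∀ a : F, algebraMap F L a ∈ E⟮x'⟯ := fun a ↦
      (E⟮x'⟯).algebraMap_mem (algebraMap F E a)
    exact ⟨hx', y_mem_of_nsmul_eq (M := (E⟮x'⟯).toSubfield) (hs₀ ▸ hF s₀) (ht₀ ▸ hF t₀) hn hy0 hy hx'⟩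
  · have hx' : x' ∈ adjoin F {x', y'} := subset_adjoin F _ (by simp)
    have hEle : E ≤ adjoin F {x', y'} := by
      have hm : Point.some x y h ∈ AddSubgroup.zmultiples (Point.some x' y' h') :=
        hn ▸ AddSubgroup.nsmul_mem _ (AddSubgroup.mem_zmultiples _) n
      have := coordinates_mem_of_mem_zmultiples (M := (adjoin F {x', y'}).toSubfield)
        (hs₀ ▸ (adjoin F {x', y'}).algebraMap_mem s₀) hx' (subset_adjoin F _ (by simp)) hm
      rw [hE, adjoin_le_iff, Set.insert_subset_iff, Set.singleton_subset_iff]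
      exact this
    have h1 : E⟮x'⟯ ≤ extendScalars hEle := by
      rw [adjoin_simple_le_iff]
      exact hx'
    exact h1

/-- The degrees of the field generated by the points of order a power of the characteristic, over a
field with a discrete place at which the reduction is good and the Hasse invariant is a
uniformiser. -/
theorem finrank_and_finSepDegree_torsionCoordinates [CharP F p] [IsAlgClosed L]
    (hp : p = 2 * m + 1) (hp5 : 5 ≤ p) (hprime : p.Prime)
    {s₀ t₀ : F} (hs₀ : algebraMap F L s₀ = s) (ht₀ : algebraMap F L t₀ = t)
    (hs : v s ≤ 1) (ht : v t ≤ 1) (hΔ : v (4 * s ^ 3 + 27 * t ^ 2) = 1)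
    (hH0 : hasseCoeff m s t ≠ 0) (hH : v (hasseCoeff m s t) < 1)
    (hv : ∀ a : F, a ≠ 0 → ∃ e : ℤ, v (algebraMap F L a) = v (hasseCoeff m s t) ^ e) (n : ℕ) :
    Module.finrank F (adjoin F (torsionCoordinates s t (p ^ (n + 1)))) =
        p ^ (2 * n + 1) * (p - 1) ∧
      Field.finSepDegree F (adjoin F (torsionCoordinates s t (p ^ (n + 1)))) = p ^ n * (p - 1) := by
  obtain ⟨c, x₁, y₁, h₁, hP₁, hx₁, hvx₁, hc, hc0, hM⟩ :=
    exists_torsion_of_map_hasseCoeff_lt_one hp hp5 hprime hs ht hΔ hH0 hH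
  obtain ⟨x, y, h, hx0, hy0, hxy⟩ := exists_nsmul_sequence hp5 hprime hs ht hΔ hP₁ hx₁
  subst hx0 hy0
  have hy (n) := y_ne_zero_of_one_lt hp5 hprime hs ht (h n) (hxy n).2.1
  rw [adjoin_torsionCoordinates_eq (P := fun n ↦ (x n, y n)) (h := h) hs₀ hp5 hprime
    (disc_ne_zero_of_map_eq_one hΔ) hP₁ (fun n ↦ (hxy n).1)]
  have hvx : ∀ n, v (x n) ^ p ^ (2 * n) = v (x 0) := by
    intro n
    induction n with
    | zero => simp
    | succ n ih =>
      rw [mul_add, mul_one, add_comm (2 * n), pow_add, pow_mul, (hxy n).2.2.2.1, ih]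
  have hvz : ∀ n, v (x n / y n) ^ (p ^ (2 * n + 1) * (p - 1)) = v (hasseCoeff m s t) := by
    intro n
    have e1 := map_div_pow_mul hs ht (h n) (hxy n).2.1 (p ^ (2 * n) * (p * m))
    rw [pow_mul (v (x n)), hvx, ← hvx₁] at e1
    have e2 := mul_left_cancel₀
      (pow_ne_zero (p * m) (zero_lt_one.trans hx₁).ne') ((mul_comm _ _).trans e1)
    rw [← e2]
    congr 1
    rw [hp, Nat.add_sub_cancel, pow_succ]
    ring
  have hlow : ∀ n, FiniteDimensional F (adjoin F {x n, y n}) →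
      p ^ (2 * n + 1) * (p - 1) ≤ Module.finrank F (adjoin F {x n, y n}) := by
    intro n hfin
    exact le_finrank_of_map_pow_eq ((map_ne_zero v).2 hH0) hH hv _
      (div_mem (subset_adjoin F _ (by simp)) (subset_adjoin F _ (by simp))) (hvz n)
  suffices hmain : FiniteDimensional F (adjoin F {x n, y n}) ∧
      Module.finrank F (adjoin F {x n, y n}) = p ^ (2 * n + 1) * (p - 1) ∧
      Field.finSepDegree F (adjoin F {x n, y n}) = p ^ n * (p - 1) from hmain.2
  induction n with
  | zero =>
    set θ : F := -2 * hasseCoeff m s₀ t₀ *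
      ∏ i ∈ Finset.range (m - 1), (2 * (i + 2) * (2 * i + 3) : F) with hθ
    have hcθ : c ^ (p - 1) = algebraMap F L θ := by
      rw [hc, hθ]
      simp only [map_mul, map_neg, map_prod, map_add, map_natCast, map_ofNat, hasseCoeff_map, hs₀, ht₀]
    have hθ0 : θ ≠ 0 := by
      intro h0
      rw [h0, map_zero] at hcθ
      exact pow_ne_zero _ hc0 hcθ
    have hFc : ∀ a : F, algebraMap F L a ∈ F⟮c⟯ := fun a ↦ (F⟮c⟯).algebraMap_mem a
    have hFx : ∀ a ∈ F⟮c⟯, a ∈ F⟮c⟯⟮x 0⟯ := fun a ha ↦ (F⟮c⟯⟮x 0⟯).algebraMap_mem ⟨a, ha⟩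
    have hc' := mem_adjoin_simple_self F c
    have hx' := mem_adjoin_simple_self F⟮c⟯ (x 0)
    -- The upper bound from F(c)(x₁), separable then purely inseparable, meets the ramification
    -- bound `hlow 0`.
    have := finrank_and_finSepDegree_of_pow_mem_adjoin hprime hθ0 hcθ
      (hM (F⟮c⟯).toSubfield (hs₀ ▸ hFc s₀) (ht₀ ▸ hFc t₀) hc').1 (E := adjoin F {x 0, y 0}) (by
        rw [adjoin_le_iff, Set.insert_subset_iff, Set.singleton_subset_iff]
        exact ⟨hx', (hM (F⟮c⟯⟮x 0⟯).toSubfield (hFx _ (hs₀ ▸ hFc s₀)) (hFx _ (ht₀ ▸ hFc t₀))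
          (hFx _ hc')).2 hx'⟩) (fun hfin ↦ by simpa using hlow 0 hfin)
    simpa using this
  | succ n ih =>
    obtain ⟨hfin, hd, hsep⟩ := ih
    obtain ⟨e1, e2, e3, e4, e5⟩ := hxy n
    have hE' := adjoin_coordinates_eq_restrictScalars hs₀ ht₀ e1 (hy n)
    have hlow' := hlow (n + 1)
    have hxE : x n ∈ adjoin F {x n, y n} := subset_adjoin F _ (by simp)
    generalize adjoin F {x n, y n} = E at *
    -- The polynomial of degree p² for the next abscissa, descended to E; ramification makes it
    -- irreducible, and it has p distinct roots.
    set g : E[X] := (shortW (algebraMap F E s₀) (algebraMap F E t₀)).Φ p -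
      C ⟨x n, hxE⟩ * (shortW (algebraMap F E s₀) (algebraMap F E t₀)).ΨSq p with hg
    have hgmap : g.map (algebraMap E L) = (shortW s t).Φ p - C (x n) * (shortW s t).ΨSq p := by
      rw [hg, Polynomial.map_sub, Polynomial.map_mul, map_C, ← WeierstrassCurve.map_Φ,
        ← WeierstrassCurve.map_ΨSq, shortW_map, ← IsScalarTower.algebraMap_apply,
        ← IsScalarTower.algebraMap_apply, hs₀, ht₀]
      rfl
    have hmonic : g.Monic := by
      refine monic_of_injective (algebraMap E L).injective ?_
      rw [hgmap]
      exact monic_shortW_Φ_sub hprime _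
    have hdeg : g.natDegree = p ^ 2 := by
      rw [← natDegree_map (algebraMap E L), hgmap, natDegree_shortW_Φ_sub hprime]
    have hroot : aeval (x (n + 1)) g = 0 := by
      rw [aeval_def, ← eval_map, hgmap, eval_sub, eval_mul, eval_C, e5, sub_self]
    have hcard := card_roots_toFinset_Φ_sub hp5 hprime hs ht hΔ hP₁ hx₁ e2 e3 e1
    have hmul : p ^ (2 * n + 1) * (p - 1) * p ^ 2 = p ^ (2 * (n + 1) + 1) * (p - 1) := by ring
    have := finrank_and_finSepDegree_adjoin_root hE' hmonic hroot (fun hfin ↦ by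
      rw [hd, hdeg, hmul]
      exact hlow' hfin)
    rw [hd, hdeg, hmul, hsep, hgmap, hcard] at this
    refine ⟨this.1, this.2.1, this.2.2.trans ?_⟩
    ring

end TorsionTower

/-! ### The generic curve and the conclusion -/

section GenericCurve

open IntermediateField

lemma torsionCoordinates_eq {L : Type*} [Field L] [DecidableEq L] {W : WeierstrassCurve L} {s t : L}
    (hW : W = shortW s t) (N : ℕ) :
    {z | ∃ (x y : L) (h : W.toAffine.Nonsingular x y), N • Point.some x y h = 0 ∧ (z = x ∨ z = y)} =
      torsionCoordinates s t N := by
  subst hW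
  rfl

open Classical in
lemma torsionField_genericCurve (K : Type*) [Field K] (N : ℕ) :
    (genericCurve K).torsionField N = adjoin (RatFunc₂ K) (torsionCoordinates
      (algebraMap _ (AlgebraicClosure (RatFunc₂ K)) (RatFunc₂.s K))
      (algebraMap _ (AlgebraicClosure (RatFunc₂ K)) (RatFunc₂.t K)) N) := by
  have hW : (genericCurve K).baseChange (AlgebraicClosure (RatFunc₂ K)) = shortW
      (algebraMap _ (AlgebraicClosure (RatFunc₂ K)) (RatFunc₂.s K))
      (algebraMap _ (AlgebraicClosure (RatFunc₂ K)) (RatFunc₂.t K)) :=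
    shortW_map (RatFunc₂.s K) (RatFunc₂.t K) _
  rw [← torsionCoordinates_eq hW]
  rfl

open Classical in
-- F-embeddings of the algebraic closure act on points by group homomorphisms, so they carry
-- N-torsion coordinates to N-torsion coordinates.
lemma WeierstrassCurve.normal_torsionField {F : Type*} [Field F] (W : WeierstrassCurve F) (N : ℕ) :
    Normal F (W.torsionField N) := by
  rw [normal_iff_forall_map_le]
  intro σ
  rw [torsionField, adjoin_map, adjoin_le_iff]
  rintro _ ⟨z, ⟨x, y, h, hN, hz⟩, rfl⟩
  have hN : N • Point.some x y h = 0 := hN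
  have h1 := congrArg (Point.map (W' := W.toAffine) σ) hN
  rw [map_nsmul, map_zero, Point.map_some] at h1
  refine subset_adjoin F _ ⟨σ x, σ y, _, h1, ?_⟩
  rcases hz with rfl | rfl
  exacts [.inl rfl, .inr rfl]

end GenericCurve

theorem mainTheorem2 {K : Type*} [Field K] (p : ℕ) [CharP K p] (hp : 5 ≤ p)
    (n : ℕ) (hn : 1 ≤ n) :
    Normal (RatFunc₂ K) ((genericCurve K).torsionField (p ^ n)) ∧
      Field.finSepDegree (RatFunc₂ K) ((genericCurve K).torsionField (p ^ n)) =
        p ^ (n - 1) * (p - 1) ∧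
      Field.finInsepDegree (RatFunc₂ K) ((genericCurve K).torsionField (p ^ n)) = p ^ n := by
  classical
  refine ⟨WeierstrassCurve.normal_torsionField _ _, ?_⟩
  have hprime : p.Prime := (CharP.char_is_prime_or_zero K p).resolve_right (by omega)
  obtain ⟨m, hm⟩ : ∃ m, p = 2 * m + 1 := hprime.odd_of_ne_two (by omega)
  obtain ⟨n, rfl⟩ : ∃ k, n = k + 1 := ⟨n - 1, by omega⟩
  let R := MvPolynomial (Fin 2) K
  let F := RatFunc₂ K
  let L := AlgebraicClosure F
  have : CharP R p := inferInstance
  have : CharP F p := charP_of_injective_algebraMap (IsFractionRing.injective R F) p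
  have : CharP L p := charP_of_injective_algebraMap (algebraMap F L).injective p
  have hinj : Function.Injective (algebraMap R L) := by
    rw [IsScalarTower.algebraMap_eq R F L]
    exact (algebraMap F L).injective.comp (IsFractionRing.injective R F)
  have : FaithfulSMul R L := (faithfulSMul_iff_algebraMap_injective R L).2 hinj
  obtain ⟨hH0, π, hπ, ⟨a, ha⟩, hπ2, hπΔ⟩ := exists_prime_dvd_genericHasse K hm hp hprime
  obtain ⟨V, hV, hVπ, hV1⟩ := exists_valuationSubring_of_prime (L := L) hπ
  have hπa : ¬ π ∣ a := fun ⟨b, hb⟩ ↦ hπ2 ⟨b, by rw [ha, hb]; ring⟩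
  have hs₀ : algebraMap F L (RatFunc₂.s K) = algebraMap R L (MvPolynomial.X 0) :=
    (IsScalarTower.algebraMap_apply R F L _).symm
  have ht₀ : algebraMap F L (RatFunc₂.t K) = algebraMap R L (MvPolynomial.X 1) :=
    (IsScalarTower.algebraMap_apply R F L _).symm
  have hHL : hasseCoeff m (algebraMap R L (MvPolynomial.X 0)) (algebraMap R L (MvPolynomial.X 1)) =
      algebraMap R L (genericHasse K m) := (hasseCoeff_map _ _ _ _).symm
  have hHπ : V.valuation (algebraMap R L (genericHasse K m)) = V.valuation (algebraMap R L π) := by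
    rw [ha, map_mul, map_mul, hV1 a hπa, mul_one]
  have hΔ := hV1 _ hπΔ
  rw [genericDisc] at hΔ
  simp only [map_add, map_mul, map_pow, map_ofNat] at hΔ
  have key := finrank_and_finSepDegree_torsionCoordinates (v := V.valuation) hm hp hprime hs₀ ht₀
    (hV _) (hV _) (by simpa using hΔ) (by rwa [hHL, map_ne_zero_iff _ hinj])
    (by rwa [hHL, hHπ]) (fun b hb ↦ by
      rw [hHL, hHπ]
      exact exists_map_eq_zpow hπ hV1 hb) n
  rw [← hs₀, ← ht₀] at key
  have hE := torsionField_genericCurve K (p ^ (n + 1))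
  have hmul := Field.finSepDegree_mul_finInsepDegree F ((genericCurve K).torsionField (p ^ (n + 1)))
  rw [hE] at hmul ⊢
  refine ⟨key.2, ?_⟩
  rw [key.1, key.2] at hmul
  have hpos : 0 < p ^ n * (p - 1) := Nat.mul_pos (pow_pos hprime.pos n) (by omega)
  -- The inseparable degree is the quotient of p^(2n+1)(p-1) by p^n(p-1), where n has been shifted
  -- down by one.
  refine Nat.eq_of_mul_eq_mul_left hpos (hmul.trans ?_)
  ring
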